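/- Let $\mathbb R_+=\,]0,\infty[$ and $\beta,\alpha\in\mathbb C$, and consider the differential expression $$L_{\beta,\alpha}:=-\partial_x^2+\Big(\alpha-\frac14\Big)\frac1{x^2}-\frac{\beta}{x}$$ acting on distributions on $\mathbb R_+$. Let $L^{\max}_{\beta,\alpha}$ be the operator in $L^2(\mathbb R_+)$ acting as $L_{\beta,\alpha}$ on the domain $\mathcal D(L^{\max}_{\beta,\alpha})=\{f\in L^2(\mathbb R_+)\mid L_{\beta,\alpha}f\in L^2(\mathbb R_+)\}$, and let $L^{\min}_{\beta,\alpha}$ be the closure of the restriction of $L_{\beta,\alpha}$ to $C_{\rm c}^\infty(\mathbb R_+)$. For $A\in\{L^{\min}_{\beta,\alpha},L^{\max}_{\beta,\alpha}\}$, a function $f$ is said to be in $\mathcal D(A)$ around $0$ if there is $\zeta\in C_{\rm c}^\infty([0,\infty[)$ with $\zeta=1$ around $0$ such that $f\zeta\in\mathcal D(A)$. Let $J_\nu$ be the Bessel function and $Y_\nu$ the Neumann function (with its limiting value at integer $\nu$), and set $\mathcal J_\nu(z)=\sqrt{\pi z/2}\,J_\nu(z)$, $\mathcal Y_\nu(z)=\sqrt{\pi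 z/2}\,Y_\nu(z)$, with principal branches extended to $]-\infty,0[$ from the upper half-plane. For $m\in\mathbb C$ and $x>0$ let $$j_{\beta,m}(x)=x^{1/4}\mathcal J_{2m}(2\sqrt{\beta x}),\qquad y_{\beta,m}(x)=x^{1/4}\mathcal Y_{2m}(2\sqrt{\beta x})\qquad(\beta\neq0),$$ and for $\beta=0$ let $j_{0,m}(x)=x^{\frac12+m}$, and $y_{0,m}(x)=x^{\frac12-m}$ if $m\ne0$, $y_{0,0}(x)=x^{\frac12}\ln x$. Then the following hold. 1. If $f\in\mathcal D(L^{\max}_{\beta,\alpha})$, then $f$ and $f'$ are continuous functions on $\mathbb R_+$ (that is, $f$ has a $C^1$ representative) and converge to $0$ at infinity. 2. If $f\in\mathcal D(L^{\min}_{\beta,\alpha})$, then, with $\alpha=m^2$, near $0$ one has: * if $\alpha=0$, then $f(x)=o(x^{3/2}|\ln x|)$ and $f'(x)=o(x^{1/2}|\ln x|)$; * if $\alpha\neq0$ and $|\Re m|\neq1$, then $f(x)=o(x^{3/2})$ and $f'(x)=o(x^{1/2})$; * if $|\Re m|=1$, then $f(x)=o(x^{3/2}|\ln x|^{1/2})$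 and $f'(x)=o(x^{1/2}|\ln x|^{1/2})$. 3. If $|\Re m|<1$ and $f\in\mathcal D(L^{\max}_{\beta,m^2})$, then there exist $a,b\in\mathbb C$ such that $f-a\,j_{\beta,m}-b\,y_{\beta,m}\in\mathcal D(L^{\min}_{\beta,m^2})$ around $0$; conversely, $a\,j_{\beta,m}+b\,y_{\beta,m}\in\mathcal D(L^{\max}_{\beta,m^2})$ around $0$ for all $a,b\in\mathbb C$. 4. If $|\Re m|\geq1$, then $\mathcal D(L^{\min}_{\beta,m^2})=\mathcal D(L^{\max}_{\beta,m^2})$. 5. If $|\Re m|<1$, then $\mathcal D(L^{\min}_{\beta,m^2})$ is a subspace of $\mathcal D(L^{\max}_{\beta,m^2})$ of codimension $2$. -/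

import Mathlib

open MeasureTheory Set Filter Topology Asymptotics
open scoped ContDiff

noncomputable section

namespace Whittaker

/-- The Hilbert space `L²(ℝ₊)` with `ℝ₊ = ]0, ∞[`. -/
abbrev L2Pos : Type := Lp ℂ 2 (volume.restrict (Ioi (0 : ℝ)))

/-- The function `F : ℝ → ℂ` represents the class `u ∈ L²(ℝ₊)` (only its values on `ℝ₊` matter). -/
def Represents (F : ℝ → ℂ) (u : L2Pos) : Prop :=
  (u : ℝ → ℂ) =ᵐ[volume.restrict (Ioi (0 : ℝ))] F

/-- `φ` is (the extension by zero of) an element of `C_c^∞(ℝ₊)`. -/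
structure IsTestFunction (φ : ℝ → ℂ) : Prop where
  contDiff : ContDiff ℝ ∞ φ
  hasCompactSupport : HasCompactSupport φ
  tsupport_subset : tsupport φ ⊆ Ioi 0

/-- The differential expression
`L_{β,α} φ = -φ'' + (α - 1/4) x⁻² φ - β x⁻¹ φ` on smooth functions. -/
def diffExpr (β α : ℂ) (φ : ℝ → ℂ) (x : ℝ) : ℂ :=
  -deriv (deriv φ) x + (α - 1 / 4) * (1 / (x : ℂ) ^ 2) * φ x - β / (x : ℂ) * φ x

/-- `L_{β,α} u = w` in the sense of distributions on `ℝ₊`, for `u, w ∈ L²(ℝ₊)`.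
The expression `L_{β,α}` is its own transpose for the bilinear pairing `∫ f g`. -/
def HasDistribImage (β α : ℂ) (u w : L2Pos) : Prop :=
  ∀ φ : ℝ → ℂ, IsTestFunction φ →
    ∫ x in Ioi (0 : ℝ), u x * diffExpr β α φ x = ∫ x in Ioi (0 : ℝ), w x * φ x

lemma IsTestFunction.eventually_zero {φ : ℝ → ℂ} (h : IsTestFunction φ) :
    φ =ᶠ[𝓝 0] 0 :=
  notMem_tsupport_iff_eventuallyEq.mp fun h0 =>
    lt_irrefl (0 : ℝ) (h.tsupport_subset h0)

lemma IsTestFunction.deriv {φ : ℝ → ℂ} (h : IsTestFunction φ) :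
    IsTestFunction (deriv φ) where
  contDiff := ((contDiff_infty_iff_deriv).mp h.contDiff).2
  hasCompactSupport := h.hasCompactSupport.deriv
  tsupport_subset := (tsupport_deriv_subset (𝕜 := ℝ)).trans h.tsupport_subset

lemma IsTestFunction.diffExpr_continuous {φ : ℝ → ℂ} (h : IsTestFunction φ) (β α : ℂ) :
    Continuous (diffExpr β α φ) := by
  rw [continuous_iff_continuousAt]
  intro x
  rcases eq_or_ne x 0 with rfl | hx
  · have h0 : diffExpr β α φ =ᶠ[𝓝 0] fun _ => 0 := by
      filter_upwards [h.eventually_zero, h.deriv.deriv.eventually_zero] with y hy hy2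
      simp [diffExpr, hy, hy2]
    exact continuousAt_const.congr h0.symm
  · have hx' : (x : ℂ) ≠ 0 := by exact_mod_cast hx
    have h1 := h.deriv.deriv.contDiff.continuous.continuousAt (x := x)
    have h2 := h.contDiff.continuous.continuousAt (x := x)
    have h3 : ContinuousAt (fun y : ℝ => (y : ℂ)) x := Complex.continuous_ofReal.continuousAt
    unfold diffExpr
    exact (h1.neg.add ((continuousAt_const.mul
      (continuousAt_const.div (h3.pow 2) (pow_ne_zero 2 hx'))).mul h2)).sub
      ((continuousAt_const.div h3 hx').mul h2)

lemma IsTestFunction.diffExpr_hasCompactSupport {φ : ℝ → ℂ} (h : IsTestFunction φ) (β α : ℂ) :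
    HasCompactSupport (diffExpr β α φ) := by
  have h1 := h.hasCompactSupport.deriv.deriv
  refine ((h1.neg.add (h.hasCompactSupport.mul_left
    (f := fun x : ℝ => (α - 1 / 4) * (1 / (x : ℂ) ^ 2)))).sub
    (h.hasCompactSupport.mul_left (f := fun x : ℝ => β / (x : ℂ))))

lemma IsTestFunction.memLp {φ : ℝ → ℂ} (h : IsTestFunction φ) :
    MemLp φ 2 (volume.restrict (Ioi (0 : ℝ))) :=
  h.contDiff.continuous.memLp_of_hasCompactSupport h.hasCompactSupport

lemma IsTestFunction.diffExpr_memLp {φ : ℝ → ℂ} (h : IsTestFunction φ) (β α : ℂ) :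
    MemLp (diffExpr β α φ) 2 (volume.restrict (Ioi (0 : ℝ))) :=
  (h.diffExpr_continuous β α).memLp_of_hasCompactSupport (h.diffExpr_hasCompactSupport β α)

/-- The bilinear pairing with a square integrable function, as a Hilbert space inner product. -/
lemma integral_mul_eq_inner {ψ : ℝ → ℂ} (hψ : MemLp ψ 2 (volume.restrict (Ioi (0 : ℝ))))
    (u : L2Pos) :
    ∫ x in Ioi (0 : ℝ), u x * ψ x = inner ℂ (hψ.star.toLp (star ψ)) u := by
  rw [L2.inner_def]
  refine integral_congr_ae ?_
  filter_upwards [hψ.star.coeFn_toLp] with x hx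
  rw [hx]
  simp

lemma hasDistribImage_iff (β α : ℂ) (u w : L2Pos) :
    HasDistribImage β α u w ↔ ∀ (φ : ℝ → ℂ) (h : IsTestFunction φ),
      inner ℂ ((h.diffExpr_memLp β α).star.toLp (star (diffExpr β α φ))) u
        = inner ℂ (h.memLp.star.toLp (star φ)) w := by
  simp only [HasDistribImage]
  refine forall₂_congr fun φ h => ?_
  rw [integral_mul_eq_inner (h.diffExpr_memLp β α), integral_mul_eq_inner h.memLp]

/-- The graph `{(u, w) ∈ L²(ℝ₊) × L²(ℝ₊) | L_{β,α} u = w as distributions on ℝ₊}`. -/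
def maxGraph (β α : ℂ) : Submodule ℂ (L2Pos × L2Pos) where
  carrier := {p | HasDistribImage β α p.1 p.2}
  zero_mem' := by
    simp only [mem_ofPred_eq, hasDistribImage_iff]
    intro φ h
    simp
  add_mem' := by
    intro p q hp hq
    simp only [mem_ofPred_eq, hasDistribImage_iff] at hp hq ⊢
    intro φ h
    rw [Prod.fst_add, Prod.snd_add, inner_add_right, inner_add_right, hp φ h, hq φ h]
  smul_mem' := by
    intro c p hp
    simp only [mem_ofPred_eq, hasDistribImage_iff] at hp ⊢
    intro φ h
    rw [Prod.smul_fst, Prod.smul_snd, inner_smul_right, inner_smul_right, hp φ h]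

/-- The maximal operator `L_{β,α}^max`: its domain is `{f ∈ L²(ℝ₊) | L_{β,α} f ∈ L²(ℝ₊)}`, and it
sends `f` to the distribution `L_{β,α} f`. -/
def Lmax (β α : ℂ) : L2Pos →ₗ.[ℂ] L2Pos := (maxGraph β α).toLinearPMap

/-- `C_c^∞(ℝ₊)` as a subspace of `L²(ℝ₊)`. -/
def testSubmodule : Submodule ℂ L2Pos where
  carrier := {u | ∃ φ : ℝ → ℂ, IsTestFunction φ ∧ Represents φ u}
  zero_mem' := ⟨0, ⟨contDiff_const, HasCompactSupport.zero, by simp⟩, Lp.coeFn_zero _ _ _⟩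
  add_mem' := by
    rintro u v ⟨φ, hφ, hu⟩ ⟨ψ, hψ, hv⟩
    refine ⟨φ + ψ, ⟨hφ.contDiff.add hψ.contDiff,
      hφ.hasCompactSupport.add hψ.hasCompactSupport, ?_⟩, ?_⟩
    · exact (tsupport_add φ ψ).trans (union_subset hφ.tsupport_subset hψ.tsupport_subset)
    · exact (Lp.coeFn_add u v).trans (hu.add hv)
  smul_mem' := by
    rintro c u ⟨φ, hφ, hu⟩
    refine ⟨c • φ, ⟨contDiff_const.smul hφ.contDiff, ?_, ?_⟩, ?_⟩
    · exact hφ.hasCompactSupport.smul_left (f := fun _ => c)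
    · exact (tsupport_smul_subset_right (fun _ => c) φ).trans hφ.tsupport_subset
    · exact (Lp.coeFn_smul c u).trans (hu.const_smul c)

/-- The minimal operator `L_{β,α}^min`: the closure of the restriction of `L_{β,α}` to
`C_c^∞(ℝ₊)`. -/
def Lmin (β α : ℂ) : L2Pos →ₗ.[ℂ] L2Pos := ((Lmax β α).domRestrict testSubmodule).closure

/-- The distributional image is unique, so `Lmax` really is the operator with graph `maxGraph`. -/
lemma maxGraph_univalent (β α : ℂ) (p : L2Pos × L2Pos) (hp : p ∈ maxGraph β α)
    (h0 : p.1 = 0) : p.2 = 0 := by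
  obtain ⟨u, w⟩ := p
  obtain rfl : u = 0 := h0
  have hd : HasDistribImage β α 0 w := hp
  have hz : ∀ᵐ x ∂(volume : Measure ℝ), x ∈ Ioi (0 : ℝ) → w x = 0 := by
    refine isOpen_Ioi.ae_eq_zero_of_integral_contDiff_smul_eq_zero ?_ ?_
    · have h1 : LocallyIntegrable w (volume.restrict (Ioi (0 : ℝ))) :=
        (Lp.memLp w).locallyIntegrable (by norm_num)
      exact locallyIntegrableOn_of_locallyIntegrable_restrict h1
    · intro g hg hgc hgs
      have hsupp : Function.support (fun x => (g x : ℂ)) = Function.support g := by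
        ext x; simp
      have ht : IsTestFunction (fun x => (g x : ℂ)) := by
        refine ⟨Complex.ofRealCLM.contDiff.comp hg, ?_, ?_⟩
        · exact hgc.comp_left (g := fun t : ℝ => (t : ℂ)) (by simp)
        · rw [tsupport, hsupp]; exact hgs
      have h2 := hd _ ht
      have h3 : ∫ x in Ioi (0 : ℝ), (0 : L2Pos) x * diffExpr β α (fun x => (g x : ℂ)) x = 0 := by
        rw [integral_mul_eq_inner (ht.diffExpr_memLp β α), inner_zero_right]
      rw [h3] at h2
      rw [← setIntegral_eq_integral_of_forall_compl_eq_zero (s := Ioi (0 : ℝ))]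
      · rw [h2]
        exact integral_congr_ae (Eventually.of_forall fun x => by simp [mul_comm])
      · intro x hx
        have : g x = 0 := image_eq_zero_of_notMem_tsupport fun h => hx (hgs h)
        simp [this]
  refine Lp.ext ?_
  filter_upwards [(ae_restrict_iff' measurableSet_Ioi).mpr hz, Lp.coeFn_zero ℂ 2
    (volume.restrict (Ioi (0 : ℝ)))] with x hx hx0
  rw [hx, hx0]; rfl

lemma Lmax_graph (β α : ℂ) : (Lmax β α).graph = maxGraph β α :=
  Submodule.toLinearPMap_graph_eq _ (maxGraph_univalent β α)

lemma mem_Lmax_domain_iff (β α : ℂ) (u : L2Pos) :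
    u ∈ (Lmax β α).domain ↔ ∃ w : L2Pos, HasDistribImage β α u w := by
  rw [Lmax, Submodule.toLinearPMap_domain]
  constructor
  · rintro ⟨⟨u', w⟩, h, rfl⟩; exact ⟨w, h⟩
  · rintro ⟨w, h⟩; exact ⟨⟨u, w⟩, h, rfl⟩

lemma Lmax_isClosed (β α : ℂ) : (Lmax β α).IsClosed := by
  rw [LinearPMap.IsClosed, Lmax_graph]
  have : (maxGraph β α : Set (L2Pos × L2Pos)) = ⋂ (φ : ℝ → ℂ) (h : IsTestFunction φ),
      {p | inner ℂ ((h.diffExpr_memLp β α).star.toLp (star (diffExpr β α φ))) p.1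
        = inner ℂ (h.memLp.star.toLp (star φ)) p.2} := by
    ext p
    simp only [mem_iInter, mem_ofPred_eq]
    exact hasDistribImage_iff β α p.1 p.2
  rw [this]
  exact isClosed_iInter fun φ => isClosed_iInter fun h => isClosed_eq (by fun_prop) (by fun_prop)

/-- The restriction to `C_c^∞(ℝ₊)` is closable, so `Lmin` is a genuine closure. -/
lemma domRestrict_isClosable (β α : ℂ) :
    ((Lmax β α).domRestrict testSubmodule).IsClosable :=
  (Lmax_isClosed β α).isClosable.leIsClosable LinearPMap.domRestrict_le

lemma mem_Lmin_graph_iff (β α : ℂ) (p : L2Pos × L2Pos) :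
    p ∈ (Lmin β α).graph ↔
      p ∈ closure (((Lmax β α).domRestrict testSubmodule).graph : Set (L2Pos × L2Pos)) := by
  rw [Lmin, ← (domRestrict_isClosable β α).graph_closure_eq_closure_graph]
  rfl

lemma integral_mul_deriv_deriv {φ ψ : ℝ → ℂ} (hφ : IsTestFunction φ) (hψ : IsTestFunction ψ) :
    ∫ x, φ x * deriv ψ x = -∫ x, deriv φ x * ψ x := by
  have hi : ∀ {f g : ℝ → ℂ}, IsTestFunction f → IsTestFunction g →
      Integrable (fun x => f x * g x) := fun hf hg =>
    (hf.contDiff.continuous.mul hg.contDiff.continuous).integrable_of_hasCompactSupport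
      hg.hasCompactSupport.mul_left
  refine integral_mul_deriv_eq_deriv_mul_of_integrable
    (fun x _ => ((hφ.contDiff.differentiable (by simp)) x).hasDerivAt)
    (fun x _ => ((hψ.contDiff.differentiable (by simp)) x).hasDerivAt)
    (hi hφ hψ.deriv) (hi hφ.deriv hψ) (hi hφ hψ)

/-- On `C_c^∞(ℝ₊)` the distribution `L_{β,α} φ` is the classical one. -/
lemma hasDistribImage_of_isTestFunction (β α : ℂ) {φ : ℝ → ℂ} (hφ : IsTestFunction φ)
    {u w : L2Pos} (hu : Represents φ u) (hw : Represents (diffExpr β α φ) w) :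
    HasDistribImage β α u w := by
  intro ψ hψ
  have e1 : ∫ x in Ioi (0 : ℝ), u x * diffExpr β α ψ x = ∫ x, φ x * diffExpr β α ψ x := by
    rw [← setIntegral_eq_integral_of_forall_compl_eq_zero (s := Ioi (0 : ℝ))
      (f := fun x => φ x * diffExpr β α ψ x)]
    · exact integral_congr_ae (hu.mono fun x hx => congrArg (· * _) hx)
    · intro x hx
      rw [image_eq_zero_of_notMem_tsupport fun h => hx (hφ.tsupport_subset h), zero_mul]
  have e2 : ∫ x in Ioi (0 : ℝ), w x * ψ x = ∫ x, diffExpr β α φ x * ψ x := by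
    rw [← setIntegral_eq_integral_of_forall_compl_eq_zero (s := Ioi (0 : ℝ))
      (f := fun x => diffExpr β α φ x * ψ x)]
    · exact integral_congr_ae (hw.mono fun x hx => congrArg (· * _) hx)
    · intro x hx
      rw [image_eq_zero_of_notMem_tsupport fun h => hx (hψ.tsupport_subset h), mul_zero]
  rw [e1, e2, ← sub_eq_zero, ← integral_sub]
  · have : ∀ x, φ x * diffExpr β α ψ x - diffExpr β α φ x * ψ x
        = deriv (deriv φ) x * ψ x - φ x * deriv (deriv ψ) x := by
      intro x; unfold diffExpr; ring
    simp_rw [this]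
    have hi : ∀ {f g : ℝ → ℂ}, IsTestFunction f → IsTestFunction g →
        Integrable (fun x => f x * g x) := fun hf hg =>
      (hf.contDiff.continuous.mul hg.contDiff.continuous).integrable_of_hasCompactSupport
        hg.hasCompactSupport.mul_left
    rw [integral_sub (hi hφ.deriv.deriv hψ) (hi hφ hψ.deriv.deriv),
      integral_mul_deriv_deriv hφ hψ.deriv, integral_mul_deriv_deriv hφ.deriv hψ]
    ring
  · exact (hφ.contDiff.continuous.mul (hψ.diffExpr_continuous β α)).integrable_of_hasCompactSupport
      (hψ.diffExpr_hasCompactSupport β α).mul_left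
  · exact ((hφ.diffExpr_continuous β α).mul hψ.contDiff.continuous).integrable_of_hasCompactSupport
      hψ.hasCompactSupport.mul_left

lemma testSubmodule_le_Lmax_domain (β α : ℂ) : testSubmodule ≤ (Lmax β α).domain := by
  rintro u ⟨φ, hφ, hu⟩
  exact (mem_Lmax_domain_iff β α u).mpr ⟨(hφ.diffExpr_memLp β α).toLp _,
    hasDistribImage_of_isTestFunction β α hφ hu (MemLp.coeFn_toLp _)⟩

/-- The function `f` belongs to the domain of `A` around `0`: there is `ζ ∈ C_c^∞([0, ∞[)`, equal
to `1` around `0`, such that `f ζ` (belongs to `L²(ℝ₊)` and) lies in the domain of `A`. -/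
def InDomainAroundZero (A : L2Pos →ₗ.[ℂ] L2Pos) (f : ℝ → ℂ) : Prop :=
  ∃ ζ : ℝ → ℂ, ContDiff ℝ ∞ ζ ∧ HasCompactSupport ζ ∧ (∀ᶠ x in 𝓝 (0 : ℝ), ζ x = 1) ∧
    ∃ u ∈ A.domain, Represents (fun x => f x * ζ x) u

/-- The Bessel function `J_ν(z) = (z/2)^ν ∑ₖ (-1)ᵏ (z/2)^{2k} / (k! Γ(ν + k + 1))`,
principal branch; `1/Γ` vanishes at the poles of `Γ`, as it does here. -/
def besselJ (ν z : ℂ) : ℂ :=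
  (z / 2) ^ ν * ∑' k : ℕ,
    (-1) ^ k / ((Nat.factorial k : ℂ) * Complex.Gamma (ν + k + 1)) * (z / 2) ^ (2 * k)

/-- The quotient `(cos(πν) J_ν(z) - J_{-ν}(z)) / sin(πν)`. -/
def neumannQuotient (ν z : ℂ) : ℂ :=
  (Complex.cos (Real.pi * ν) * besselJ ν z - besselJ (-ν) z) / Complex.sin (Real.pi * ν)

open Classical in
/-- The Neumann function (Bessel function of the second kind) `Y_ν(z)`, defined by the limiting
value of the quotient when `ν` is an integer. -/
def besselY (ν z : ℂ) : ℂ :=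
  if ∃ n : ℤ, ν = n then limUnder (𝓝[≠] ν) (fun μ => neumannQuotient μ z)
  else neumannQuotient ν z

/-- The Bessel function for dimension one, `𝒥_ν(z) = √(πz/2) J_ν(z)`. -/
def besselJ1 (ν z : ℂ) : ℂ := (Real.pi * z / 2) ^ (1 / 2 : ℂ) * besselJ ν z

/-- The Neumann function for dimension one, `𝒴_ν(z) = √(πz/2) Y_ν(z)`. -/
def besselY1 (ν z : ℂ) : ℂ := (Real.pi * z / 2) ^ (1 / 2 : ℂ) * besselY ν z

open Classical in
/-- The zero-energy solution `j_{β,m}`: `x^{1/4} 𝒥_{2m}(2 √(βx))` if `β ≠ 0`, and `x^{1/2+m}` if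
`β = 0`. -/
def zeroJ (β m : ℂ) (x : ℝ) : ℂ :=
  if β = 0 then (x : ℂ) ^ (1 / 2 + m)
  else (x : ℂ) ^ (1 / 4 : ℂ) * besselJ1 (2 * m) (2 * (β * x) ^ (1 / 2 : ℂ))

open Classical in
/-- The zero-energy solution `y_{β,m}`: `x^{1/4} 𝒴_{2m}(2 √(βx))` if `β ≠ 0`; if `β = 0` it is
`x^{1/2-m}` for `m ≠ 0` and `x^{1/2} ln x` for `m = 0`. -/
def zeroY (β m : ℂ) (x : ℝ) : ℂ :=
  if β = 0 then
    if m = 0 then (x : ℂ) ^ (1 / 2 : ℂ) * (Real.log x : ℂ) else (x : ℂ) ^ (1 / 2 - m)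
  else (x : ℂ) ^ (1 / 4 : ℂ) * besselY1 (2 * m) (2 * (β * x) ^ (1 / 2 : ℂ))

end Whittaker

end

/-!
Elements of the maximal domain are handled through *strong solutions*: a weak solution of
`L u = w` with `u, w ∈ L²` has a `C¹` representative `F` whose derivative is locally absolutely
continuous with `F'' = q F - w`, where `q = (α - 1/4) x⁻² - β x⁻¹`
(`HasDistribImage.exists_isStrong`, by the lemma of du Bois-Reymond). Integrating by parts against
a cubic kernel on `[x, x + 1]` bounds `F(x)` and `F'(x)` by local `L²` norms of `F` and `F''`, which
gives the decay at infinity (`IsStrong.tendsto_atTop`).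

Since the Wronskian `W(f, g) = f g' - f' g` of two elements of the maximal domain vanishes at
infinity, Green's formula turns its limit at `0` into `∫ f L g - ∫ g L f`. The minimal operator is
the transpose of the maximal one (Hahn-Banach and Riesz), so the minimal domain consists of the `f`
with `W(f, g)(0) = 0` for all `g` in the maximal domain (`IsMax.mem_Lmin_domain_iff`).

Near `0`, variation of constants writes `f = A u + B v` for a pair of homogeneous solutions with
`W(u, v) = 1`, with `A' = w v` and `B' = - u w`. Take `Re m ≥ 0`, and `u` of order
`x ^ (1/2 + Re m)`, `v` of order `x ^ (1/2 - Re m)`, with a logarithm if `m = 0`.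
* If `|Re m| < 1`, both solutions are square integrable, so `A` and `B` have boundary values. The
  minimal domain is their common kernel, the codimension is two, and the Cauchy-Schwarz inequality
  for `A = ∫ w v` and `B = -∫ u w` gives the behavior of `f` and `f'` at `0`
  (`SolutionPair.finrank_quotient`, `SolutionPair.behavior_Lmin`).
* If `|Re m| ≥ 1`, the boundary value of `B` vanishes for every `f` in the maximal domain, as one
  sees by averaging `W(u, f)` over `[x, 2x]` (`eq_zero_of_tendsto_wronsk`), while `A` may grow no
  faster than the tail norms of `v` allow. This forces `W(f, g)(0) = 0` for all `f`, `g`, so the two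
  domains coincide, and it gives the same kind of bounds (`SolutionPair.limitPoint`).

The regular solution is `x ^ (1/2 + m) F_{2m}(βx)` with the entire function
`F_ν(w) = ∑ (-w)ᵏ / (k! Γ(ν + k + 1))`. The singular one comes from reduction of order, or is the
regular solution for `-m` if `Re m = 0 ≠ m`. The functions `j_{β,m}` and `y_{β,m}` are powers if
`β = 0 ≠ m`; if `β ≠ 0` they are combinations of the regular solutions for `±m`, unless
`2m ∈ {0, ±1}`, in which case the limit defining `Y_{2m}` produces the derivative `∂_ν F_ν` and a
logarithm. Their Wronskian is computed from its limit at `0`, and it is not zero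
(`isFundamentalPair_zeroJ_zeroY`).
-/

namespace Whittaker

/-! ### Primitives and strong solutions -/

/-- `A` is a locally absolutely continuous primitive of `a` on `s`: the function `a` is integrable
between any two points of `s`, and its integral is the increment of `A`. -/
def IsPrimitiveOn (s : Set ℝ) (A a : ℝ → ℂ) : Prop :=
  ∀ x ∈ s, ∀ y ∈ s, IntervalIntegrable a volume x y ∧ ∫ t in x..y, a t = A y - A x

lemma absolutelyContinuousOnInterval_congr {f g : ℝ → ℂ} {x y : ℝ}
    (hf : AbsolutelyContinuousOnInterval f x y) (h : EqOn f g (uIcc x y)) :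
    AbsolutelyContinuousOnInterval g x y := by
  refine Tendsto.congr' ?_ hf
  filter_upwards [mem_inf_of_right (mem_principal_self _)] with E hE
  refine Finset.sum_congr rfl fun i hi => ?_
  rw [h (hE.1 i hi).1, h (hE.1 i hi).2]

/-- The complex version is reduced to Mathlib's real one through real and imaginary parts. -/
lemma absolutelyContinuousOnInterval_integral {a : ℝ → ℂ} {x y : ℝ}
    (h : IntervalIntegrable a volume x y) :
    AbsolutelyContinuousOnInterval (fun z => ∫ t in x..z, a t) x y := by
  have hre : IntervalIntegrable (fun t => (a t).re) volume x y := ⟨h.1.re, h.2.re⟩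
  have him : IntervalIntegrable (fun t => (a t).im) volume x y := ⟨h.1.im, h.2.im⟩
  have hc : ∀ c : ℂ, AbsolutelyContinuousOnInterval (fun _ : ℝ => c) x y := fun c =>
    LipschitzOnWith.absolutelyContinuousOnInterval (K := 0)
      ((LipschitzWith.const c).lipschitzOnWith)
  have h1 := (hre.absolutelyContinuousOnInterval_intervalIntegral (c := x) (by simp)).fun_smul
    (hc 1)
  have h2 := (him.absolutelyContinuousOnInterval_intervalIntegral (c := x) (by simp)).fun_smul
    (hc Complex.I)
  refine absolutelyContinuousOnInterval_congr (h1.fun_add h2) ?_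
  intro z hz
  have hi : IntervalIntegrable a volume x z :=
    h.mono_set (uIcc_subset_uIcc left_mem_uIcc hz)
  apply Complex.ext
  · have := Complex.reCLM.intervalIntegral_comp_comm hi
    simp at this; simp [this]
  · have := Complex.imCLM.intervalIntegral_comp_comm hi
    simp at this; simp [this]

namespace IsPrimitiveOn

variable {s t : Set ℝ} {A B a b : ℝ → ℂ}

lemma mono (h : IsPrimitiveOn s A a) (hst : t ⊆ s) : IsPrimitiveOn t A a :=
  fun x hx y hy => h x (hst hx) y (hst hy)

lemma congr (h : IsPrimitiveOn s A a) (hs : s.OrdConnected) (hA : EqOn A B s) (ha : EqOn a b s) :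
    IsPrimitiveOn s B b := by
  intro x hx y hy
  have hsub : uIcc x y ⊆ s := hs.uIcc_subset hx hy
  refine ⟨(h x hx y hy).1.congr fun t ht => ha (hsub (uIoc_subset_uIcc ht)), ?_⟩
  rw [← hA hx, ← hA hy, ← (h x hx y hy).2]
  exact intervalIntegral.integral_congr fun t ht => (ha (hsub ht)).symm

lemma congr_ae (h : IsPrimitiveOn s A a) (hs : s.OrdConnected)
    (ha : ∀ᵐ x, x ∈ s → a x = b x) : IsPrimitiveOn s A b := by
  intro x hx y hy
  have hsub : uIoc x y ⊆ s := uIoc_subset_uIcc.trans (hs.uIcc_subset hx hy)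
  have h1 : ∀ᵐ t, t ∈ uIoc x y → a t = b t := ha.mono fun t ht h => ht (hsub h)
  refine ⟨(h x hx y hy).1.congr_ae ((ae_restrict_iff' measurableSet_uIoc).mpr h1), ?_⟩
  rw [← (h x hx y hy).2]
  exact intervalIntegral.integral_congr_ae (h1.mono fun t ht h => (ht h).symm)

lemma add (hA : IsPrimitiveOn s A a) (hB : IsPrimitiveOn s B b) :
    IsPrimitiveOn s (fun x => A x + B x) (fun x => a x + b x) := by
  intro x hx y hy
  refine ⟨(hA x hx y hy).1.add (hB x hx y hy).1, ?_⟩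
  rw [intervalIntegral.integral_add (hA x hx y hy).1 (hB x hx y hy).1, (hA x hx y hy).2,
    (hB x hx y hy).2]
  ring

lemma const_mul (c : ℂ) (hA : IsPrimitiveOn s A a) :
    IsPrimitiveOn s (fun x => c * A x) (fun x => c * a x) := by
  intro x hx y hy
  refine ⟨(hA x hx y hy).1.const_mul c, ?_⟩
  rw [intervalIntegral.integral_const_mul, (hA x hx y hy).2]
  ring

lemma neg (hA : IsPrimitiveOn s A a) : IsPrimitiveOn s (fun x => -A x) (fun x => -a x) := by
  simpa using hA.const_mul (-1)

lemma sub (hA : IsPrimitiveOn s A a) (hB : IsPrimitiveOn s B b) :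
    IsPrimitiveOn s (fun x => A x - B x) (fun x => a x - b x) := by
  simpa [sub_eq_add_neg] using hA.add hB.neg

lemma of_hasDerivAt (hs : s.OrdConnected) (h : ∀ x ∈ s, HasDerivAt A (a x) x)
    (ha : ContinuousOn a s) : IsPrimitiveOn s A a := by
  intro x hx y hy
  have hsub : uIcc x y ⊆ s := hs.uIcc_subset hx hy
  have hi : IntervalIntegrable a volume x y := (ha.mono hsub).intervalIntegrable
  exact ⟨hi, intervalIntegral.integral_eq_sub_of_hasDerivAt (fun t ht => h t (hsub ht)) hi⟩

lemma integral {x₀ : ℝ} (hx₀ : x₀ ∈ s)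
    (ha : ∀ x ∈ s, ∀ y ∈ s, IntervalIntegrable a volume x y) :
    IsPrimitiveOn s (fun x => ∫ t in x₀..x, a t) a := by
  intro x hx y hy
  refine ⟨ha x hx y hy, ?_⟩
  rw [intervalIntegral.integral_interval_sub_left (ha _ hx₀ _ hy) (ha _ hx₀ _ hx)]

lemma eqOn_uIcc (h : IsPrimitiveOn s A a) (hs : s.OrdConnected) {x y : ℝ} (hx : x ∈ s)
    (hy : y ∈ s) : EqOn A (fun z => A x + ∫ t in x..z, a t) (uIcc x y) := by
  intro z hz
  simp [(h x hx z (hs.uIcc_subset hx hy hz)).2]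

lemma absolutelyContinuousOnInterval (h : IsPrimitiveOn s A a) (hs : s.OrdConnected) {x y : ℝ}
    (hx : x ∈ s) (hy : y ∈ s) : AbsolutelyContinuousOnInterval A x y := by
  have h1 : AbsolutelyContinuousOnInterval (fun _ : ℝ => A x) x y :=
    LipschitzOnWith.absolutelyContinuousOnInterval (K := 0)
      ((LipschitzWith.const (A x)).lipschitzOnWith)
  exact absolutelyContinuousOnInterval_congr
    (h1.fun_add (absolutelyContinuousOnInterval_integral (h x hx y hy).1))
    (h.eqOn_uIcc hs hx hy).symm

lemma continuousOn_uIcc (h : IsPrimitiveOn s A a) (hs : s.OrdConnected) {x y : ℝ}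
    (hx : x ∈ s) (hy : y ∈ s) : ContinuousOn A (uIcc x y) :=
  (h.absolutelyContinuousOnInterval hs hx hy).continuousOn

lemma continuousOn (h : IsPrimitiveOn s A a) (hs : s.OrdConnected) (ho : IsOpen s) :
    ContinuousOn A s := by
  intro x hx
  obtain ⟨ε, hε, hsub⟩ := Metric.isOpen_iff.mp ho x hx
  have h1 : x - ε / 2 ∈ s := hsub (by simp [abs_of_pos hε, hε])
  have h2 : x + ε / 2 ∈ s := hsub (by simp [abs_of_pos hε, hε])
  refine ((h.continuousOn_uIcc hs h1 h2).continuousAt ?_).continuousWithinAt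
  rw [uIcc_of_le (by linarith)]
  exact Icc_mem_nhds (by linarith) (by linarith)

lemma ae_hasDerivAt (h : IsPrimitiveOn s A a) (hs : s.OrdConnected) {x y : ℝ}
    (hx : x ∈ s) (hy : y ∈ s) : ∀ᵐ z, z ∈ uIcc x y → HasDerivAt A (a z) z := by
  have hx' : ∀ᵐ z : ℝ, z ≠ x := by simp [ae_iff, measure_singleton]
  have hy' : ∀ᵐ z : ℝ, z ≠ y := by simp [ae_iff, measure_singleton]
  filter_upwards [(h x hx y hy).1.ae_hasDerivAt_integral, hx', hy'] with z hz hzx hzy hzm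
  have h1 := (hz hzm x left_mem_uIcc).const_add (A x)
  refine h1.congr_of_eventuallyEq ?_
  have hmem : uIcc x y ∈ 𝓝 z := by
    rcases le_total x y with hxy | hxy
    · rw [uIcc_of_le hxy] at hzm ⊢
      exact Icc_mem_nhds (lt_of_le_of_ne hzm.1 hzx.symm) (lt_of_le_of_ne hzm.2 hzy)
    · rw [uIcc_of_ge hxy] at hzm ⊢
      exact Icc_mem_nhds (lt_of_le_of_ne hzm.1 hzy.symm) (lt_of_le_of_ne hzm.2 hzx)
  filter_upwards [hmem] with z' hz' using h.eqOn_uIcc hs hx hy hz'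

/-- The product rule for absolutely continuous functions. -/
lemma mul (hA : IsPrimitiveOn s A a) (hB : IsPrimitiveOn s B b) (hs : s.OrdConnected) :
    IsPrimitiveOn s (fun x => A x * B x) (fun x => a x * B x + A x * b x) := by
  intro x hx y hy
  have hi : IntervalIntegrable (fun x => a x * B x + A x * b x) volume x y :=
    ((hA x hx y hy).1.mul_continuousOn (hB.continuousOn_uIcc hs hx hy)).add
      ((hB x hx y hy).1.continuousOn_mul (hA.continuousOn_uIcc hs hx hy))
  refine ⟨hi, ?_⟩
  have hac := ((hA.absolutelyContinuousOnInterval hs hx hy).fun_smul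
    (hB.absolutelyContinuousOnInterval hs hx hy)).fun_sub
    (absolutelyContinuousOnInterval_integral hi)
  obtain ⟨C, hC⟩ := hac.const_of_ae_hasDerivAt_zero (by
    filter_upwards [hA.ae_hasDerivAt hs hx hy, hB.ae_hasDerivAt hs hx hy,
      hi.ae_hasDerivAt_integral] with z h1 h2 h3 hz
    have := ((h1 hz).mul (h2 hz)).sub (h3 hz x left_mem_uIcc)
    exact this.congr_deriv (sub_self _))
  have e1 := hC x left_mem_uIcc
  have e2 := hC y right_mem_uIcc
  simp only [smul_eq_mul, intervalIntegral.integral_same, sub_zero] at e1 e2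
  change _ = A y * B y - A x * B x
  rw [e1, ← e2]; ring

/-- A primitive of a function that is integrable up to the endpoint `0` has a limit there. -/
lemma exists_tendsto {c : ℝ} (hc : 0 < c) (h : IsPrimitiveOn (Ioo 0 c) A a)
    (ha : IntegrableOn a (Ioo 0 c)) :
    ∃ A₀, Tendsto A (𝓝[>] 0) (𝓝 A₀) ∧ ∀ x ∈ Ioo 0 c, A x = A₀ + ∫ t in Ioc 0 x, a t := by
  have hm : c / 2 ∈ Ioo 0 c := ⟨by linarith, by linarith⟩
  have hI : ∀ x ∈ Ioo 0 c, IntegrableOn a (Ioc 0 x) := fun x hx =>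
    ha.mono_set fun t ht => ⟨ht.1, ht.2.trans_lt hx.2⟩
  have key : ∀ x ∈ Ioo 0 c, A x = (A (c / 2) - ∫ t in Ioc 0 (c / 2), a t)
      + ∫ t in Ioc 0 x, a t := by
    intro x hx
    have h1 := (h x hx _ hm).2
    have h2 := intervalIntegral.integral_add_adjacent_intervals
      ((intervalIntegrable_iff_integrableOn_Ioc_of_le hx.1.le).mpr (hI x hx)) (h x hx _ hm).1
    rw [intervalIntegral.integral_of_le hx.1.le, intervalIntegral.integral_of_le hm.1.le, h1] at h2
    rw [← h2]; ring
  refine ⟨_, ?_, key⟩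
  have hcont : Tendsto (fun x => ∫ t in (0 : ℝ)..x, a t) (𝓝[>] 0) (𝓝 0) := by
    have h3 := intervalIntegral.continuousOn_primitive_interval (a := 0) (b := c / 2) (f := a)
      (μ := volume) (by
        rw [uIcc_of_le hm.1.le, integrableOn_Icc_iff_integrableOn_Ioc]
        exact hI _ hm)
    have h4 := h3 0 left_mem_uIcc
    rw [uIcc_of_le hm.1.le] at h4
    have h5 : 𝓝[>] (0 : ℝ) ≤ 𝓝[Icc 0 (c / 2)] 0 :=
      nhdsWithin_le_of_mem (mem_of_superset (Ioo_mem_nhdsGT hm.1) Ioo_subset_Icc_self)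
    simpa [ContinuousWithinAt] using h4.mono_left h5
  have h6 : (fun x => (A (c / 2) - ∫ t in Ioc 0 (c / 2), a t) + ∫ t in (0 : ℝ)..x, a t)
      =ᶠ[𝓝[>] 0] A := by
    filter_upwards [Ioo_mem_nhdsGT hc] with x hx
    rw [key x hx, intervalIntegral.integral_of_le hx.1.le]
  simpa using (hcont.const_add _).congr' h6

/-- Primitives on two overlapping intervals covering the half-line fit together. -/
lemma glue {c d : ℝ} (hd : 0 < d) (hdc : d < c) (h1 : IsPrimitiveOn (Ioo 0 c) A a)
    (h2 : IsPrimitiveOn (Ioi d) A a) : IsPrimitiveOn (Ioi 0) A a := by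
  obtain ⟨e, hde, hec⟩ := exists_between hdc
  have he1 : e ∈ Ioo 0 c := ⟨hd.trans hde, hec⟩
  have key : ∀ x ∈ Ioi (0 : ℝ), IntervalIntegrable a volume x e ∧ ∫ t in x..e, a t = A e - A x := by
    intro x hx
    rcases lt_or_ge x c with hxc | hxc
    · exact h1 x ⟨hx, hxc⟩ e he1
    · exact h2 x (hdc.trans_le hxc) e hde
  intro x hx y hy
  refine ⟨(key x hx).1.trans (key y hy).1.symm, ?_⟩
  rw [← intervalIntegral.integral_add_adjacent_intervals (key x hx).1 (key y hy).1.symm,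
    (key x hx).2, intervalIntegral.integral_symm, (key y hy).2]
  ring

end IsPrimitiveOn

/-- The potential `(α - 1/4) x⁻² - β x⁻¹` of `L_{β,α}`. -/
noncomputable def pot (β α : ℂ) (x : ℝ) : ℂ := (α - 1 / 4) * (1 / (x : ℂ) ^ 2) - β / (x : ℂ)

lemma pot_zero : pot 0 (1 / 4) = 0 := by ext x; simp [pot]

lemma continuousOn_pot (β α : ℂ) : ContinuousOn (pot β α) (Ioi 0) := by
  have h : ∀ x ∈ Ioi (0 : ℝ), (x : ℂ) ≠ 0 := fun x hx => by exact_mod_cast (ne_of_gt hx)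
  have h3 : ContinuousOn (fun y : ℝ => (y : ℂ)) (Ioi 0) := Complex.continuous_ofReal.continuousOn
  exact (continuousOn_const.mul (continuousOn_const.div (h3.pow 2) fun x hx =>
    pow_ne_zero 2 (h x hx))).sub (continuousOn_const.div h3 h)

/-- `F` is a strong solution of `L_{β,α} F = w` on `s`: it is differentiable with derivative `F₁`,
and `F₁` is locally absolutely continuous with almost everywhere derivative `pot F - w`. -/
structure IsStrong (β α : ℂ) (s : Set ℝ) (F F₁ w : ℝ → ℂ) : Prop where
  hasDerivAt : ∀ x ∈ s, HasDerivAt F (F₁ x) x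
  prim : IsPrimitiveOn s F₁ (fun x => pot β α x * F x - w x)

namespace IsStrong

variable {β α : ℂ} {s t : Set ℝ} {F F₁ G G₁ w h : ℝ → ℂ}

lemma mono (hF : IsStrong β α s F F₁ w) (hst : t ⊆ s) : IsStrong β α t F F₁ w :=
  ⟨fun x hx => hF.hasDerivAt x (hst hx), hF.prim.mono hst⟩

lemma continuousOn (hF : IsStrong β α s F F₁ w) : ContinuousOn F s :=
  fun x hx => (hF.hasDerivAt x hx).continuousAt.continuousWithinAt

lemma continuousOn_deriv (hF : IsStrong β α s F F₁ w) (hs : s.OrdConnected) (ho : IsOpen s) :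
    ContinuousOn F₁ s := hF.prim.continuousOn hs ho

lemma isPrimitiveOn (hF : IsStrong β α s F F₁ w) (hs : s.OrdConnected) (ho : IsOpen s) :
    IsPrimitiveOn s F F₁ :=
  IsPrimitiveOn.of_hasDerivAt hs hF.hasDerivAt (hF.continuousOn_deriv hs ho)

/-- A classical solution is a strong solution. -/
lemma of_hasDerivAt (hs : s.OrdConnected) (hs0 : s ⊆ Ioi 0)
    (h1 : ∀ x ∈ s, HasDerivAt F (F₁ x) x)
    (h2 : ∀ x ∈ s, HasDerivAt F₁ (pot β α x * F x - w x) x) (hw : ContinuousOn w s) :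
    IsStrong β α s F F₁ w where
  hasDerivAt := h1
  prim := IsPrimitiveOn.of_hasDerivAt hs h2
    ((((continuousOn_pot β α).mono hs0).mul
      fun x hx => (h1 x hx).continuousAt.continuousWithinAt).sub hw)

lemma add (hF : IsStrong β α s F F₁ w) (hG : IsStrong β α s G G₁ h) (hs : s.OrdConnected) :
    IsStrong β α s (fun x => F x + G x) (fun x => F₁ x + G₁ x) (fun x => w x + h x) :=
  ⟨fun x hx => (hF.hasDerivAt x hx).add (hG.hasDerivAt x hx),
    (hF.prim.add hG.prim).congr hs (fun _ _ => rfl) fun x _ => by ring⟩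

lemma const_mul (c : ℂ) (hF : IsStrong β α s F F₁ w) (hs : s.OrdConnected) :
    IsStrong β α s (fun x => c * F x) (fun x => c * F₁ x) (fun x => c * w x) :=
  ⟨fun x hx => (hF.hasDerivAt x hx).const_mul c,
    (hF.prim.const_mul c).congr hs (fun _ _ => rfl) fun x _ => by ring⟩

end IsStrong

/-- The Wronskian, with the derivatives as separate arguments. -/
def wronsk (F F₁ G G₁ : ℝ → ℂ) (x : ℝ) : ℂ := F x * G₁ x - F₁ x * G x

/-- Lagrange's identity. -/
lemma IsStrong.isPrimitiveOn_wronsk {β α : ℂ} {s : Set ℝ} {F F₁ G G₁ w h : ℝ → ℂ}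
    (hF : IsStrong β α s F F₁ w) (hG : IsStrong β α s G G₁ h) (hs : s.OrdConnected)
    (ho : IsOpen s) :
    IsPrimitiveOn s (wronsk F F₁ G G₁) (fun x => w x * G x - F x * h x) := by
  have h1 := (hF.isPrimitiveOn hs ho).mul hG.prim hs
  have h2 := hF.prim.mul (hG.isPrimitiveOn hs ho) hs
  exact (h1.sub h2).congr hs (fun _ _ => rfl) fun x _ => by ring

lemma IsStrong.wronsk_eq {β α : ℂ} {s : Set ℝ} {F F₁ G G₁ : ℝ → ℂ}
    (hF : IsStrong β α s F F₁ 0) (hG : IsStrong β α s G G₁ 0) (hs : s.OrdConnected)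
    (ho : IsOpen s) {x y : ℝ} (hx : x ∈ s) (hy : y ∈ s) :
    wronsk F F₁ G G₁ x = wronsk F F₁ G G₁ y := by
  have := ((hF.isPrimitiveOn_wronsk hG hs ho) x hx y hy).2
  simp only [Pi.zero_apply, zero_mul, mul_zero, sub_zero, intervalIntegral.integral_zero] at this
  exact (sub_eq_zero.mp this.symm).symm

/-! ### Distributional solutions are strong solutions -/

lemma IsTestFunction.exists_tsupport_subset_Ioo {φ : ℝ → ℂ} (h : IsTestFunction φ) :
    ∃ a b : ℝ, 0 < a ∧ a < b ∧ tsupport φ ⊆ Ioo a b := by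
  rcases (tsupport φ).eq_empty_or_nonempty with he | hne
  · exact ⟨1, 2, one_pos, one_lt_two, by simp [he]⟩
  · obtain ⟨a, ha⟩ := h.hasCompactSupport.isCompact.exists_isLeast hne
    obtain ⟨b, hb⟩ := h.hasCompactSupport.isCompact.exists_isGreatest hne
    have ha0 : 0 < a := h.tsupport_subset ha.1
    have hab : a ≤ b := hb.2 ha.1
    exact ⟨a / 2, b + 1, by linarith, by linarith, fun x hx =>
      ⟨by linarith [ha.2 hx], by linarith [hb.2 hx]⟩⟩

lemma setIntegral_Ioi_eq_intervalIntegral {g : ℝ → ℂ} {a b : ℝ} (ha : 0 < a) (hab : a < b)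
    (hg : ∀ x ∉ Ioo a b, g x = 0) : ∫ x in Ioi (0 : ℝ), g x = ∫ x in a..b, g x := by
  rw [intervalIntegral.integral_of_le hab.le]
  refine setIntegral_eq_of_subset_of_forall_sdiff_eq_zero measurableSet_Ioi
    (fun x hx => ha.trans hx.1) fun x hx => hg x fun h => hx.2 (Ioo_subset_Ioc_self h)

lemma IsTestFunction.isStrong {φ : ℝ → ℂ} (h : IsTestFunction φ) (β α : ℂ) :
    IsStrong β α (Ioi 0) φ (_root_.deriv φ) (diffExpr β α φ) := by
  refine IsStrong.of_hasDerivAt ordConnected_Ioi subset_rfl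
    (fun x _ => ((h.contDiff.differentiable (by simp)) x).hasDerivAt) (fun x _ => ?_)
    (h.diffExpr_continuous β α).continuousOn
  refine ((h.deriv.contDiff.differentiable (by simp)) x).hasDerivAt.congr_deriv ?_
  simp only [pot, diffExpr]; ring

lemma diffExpr_eq_zero {φ : ℝ → ℂ} (β α : ℂ) {x : ℝ}
    (hx : x ∉ tsupport φ) : diffExpr β α φ x = 0 := by
  have h1 : φ x = 0 := image_eq_zero_of_notMem_tsupport hx
  have h2 : _root_.deriv (_root_.deriv φ) x = 0 := image_eq_zero_of_notMem_tsupport fun h' =>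
    hx (tsupport_deriv_subset (𝕜 := ℝ) (tsupport_deriv_subset (𝕜 := ℝ) h'))
  simp [diffExpr, h1, h2]

lemma IsStrong.intervalIntegrable {β α : ℂ} {s : Set ℝ} {F F₁ w : ℝ → ℂ}
    (hF : IsStrong β α s F F₁ w) (hs : s.OrdConnected) (hs0 : s ⊆ Ioi 0) {x y : ℝ} (hx : x ∈ s)
    (hy : y ∈ s) : IntervalIntegrable w volume x y := by
  have h1 : IntervalIntegrable (fun x => pot β α x * F x) volume x y :=
    (((continuousOn_pot β α).mono hs0).mul hF.continuousOn).mono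
      (hs.uIcc_subset hx hy) |>.intervalIntegrable
  simpa using h1.sub (hF.prim x hx y hy).1

/-- Strong solutions of `L F = w` are weak solutions. -/
lemma IsStrong.integral_mul_diffExpr {β α : ℂ} {F F₁ w φ : ℝ → ℂ}
    (hF : IsStrong β α (Ioi 0) F F₁ w) (hφ : IsTestFunction φ) :
    ∫ x in Ioi (0 : ℝ), F x * diffExpr β α φ x = ∫ x in Ioi (0 : ℝ), w x * φ x := by
  obtain ⟨a, b, ha, hab, hsub⟩ := hφ.exists_tsupport_subset_Ioo
  have hb : 0 < b := ha.trans hab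
  have hz : ∀ x ∉ Ioo a b, x ∉ tsupport φ := fun x hx h => hx (hsub h)
  have hφ0 : ∀ x ∉ Ioo a b, φ x = 0 := fun x hx => image_eq_zero_of_notMem_tsupport (hz x hx)
  have hφ1 : ∀ x ∉ Ioo a b, _root_.deriv φ x = 0 := fun x hx =>
    image_eq_zero_of_notMem_tsupport fun h => hz x hx (tsupport_deriv_subset (𝕜 := ℝ) h)
  rw [setIntegral_Ioi_eq_intervalIntegral ha hab fun x hx => by
      rw [diffExpr_eq_zero β α (hz x hx), mul_zero],
    setIntegral_Ioi_eq_intervalIntegral ha hab fun x hx => by rw [hφ0 x hx, mul_zero]]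
  have hL := ((hF.isPrimitiveOn_wronsk (hφ.isStrong β α) ordConnected_Ioi isOpen_Ioi)
    a ha b hb).2
  have hsub' : uIcc a b ⊆ Ioi 0 := ordConnected_Ioi.uIcc_subset (mem_Ioi.mpr ha) (mem_Ioi.mpr hb)
  have i1 : IntervalIntegrable (fun x => w x * φ x) volume a b :=
    (hF.intervalIntegrable ordConnected_Ioi subset_rfl ha hb).mul_continuousOn
      hφ.contDiff.continuous.continuousOn
  have i2 : IntervalIntegrable (fun x => F x * diffExpr β α φ x) volume a b :=
    ((hF.continuousOn.mono hsub').mul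
      (hφ.diffExpr_continuous β α).continuousOn).intervalIntegrable
  rw [intervalIntegral.integral_sub i1 i2] at hL
  have ha' : a ∉ Ioo a b := by simp
  have hb' : b ∉ Ioo a b := by simp
  simp only [wronsk, hφ0 a ha', hφ0 b hb', hφ1 a ha', hφ1 b hb', mul_zero, sub_zero] at hL
  exact (sub_eq_zero.mp hL).symm

lemma IsStrong.hasDistribImage {β α : ℂ} {F F₁ w' : ℝ → ℂ} {u w : L2Pos}
    (hF : IsStrong β α (Ioi 0) F F₁ w') (hu : Represents F u) (hw : Represents w' w) :
    HasDistribImage β α u w := by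
  intro φ hφ
  refine (integral_congr_ae (hu.mono fun x hx => congrArg (· * diffExpr β α φ x) hx)).trans
    ((hF.integral_mul_diffExpr hφ).trans ?_)
  exact integral_congr_ae (hw.mono fun x hx => congrArg (· * φ x) hx.symm)

lemma IsTestFunction.sub {φ ψ : ℝ → ℂ} (hφ : IsTestFunction φ) (hψ : IsTestFunction ψ) :
    IsTestFunction (fun x => φ x - ψ x) where
  contDiff := hφ.contDiff.sub hψ.contDiff
  hasCompactSupport := hφ.hasCompactSupport.sub hψ.hasCompactSupport
  tsupport_subset := (tsupport_sub φ ψ).trans (union_subset hφ.tsupport_subset hψ.tsupport_subset)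

lemma IsTestFunction.const_mul {φ : ℝ → ℂ} (hφ : IsTestFunction φ) (c : ℂ) :
    IsTestFunction (fun x => c * φ x) where
  contDiff := contDiff_const.mul hφ.contDiff
  hasCompactSupport := hφ.hasCompactSupport.mul_left (f := fun _ => c)
  tsupport_subset := (tsupport_mul_subset_right (f := fun _ => c)).trans hφ.tsupport_subset

lemma isTestFunction_ofReal {g : ℝ → ℝ} (hg : ContDiff ℝ ∞ g) (hgc : HasCompactSupport g)
    (hgs : tsupport g ⊆ Ioi 0) : IsTestFunction (fun x => (g x : ℂ)) := by
  have hsupp : Function.support (fun x => (g x : ℂ)) = Function.support g := by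
    ext x; simp
  refine ⟨Complex.ofRealCLM.contDiff.comp hg, ?_, ?_⟩
  · exact hgc.comp_left (g := fun t : ℝ => (t : ℂ)) (by simp)
  · rw [tsupport, hsupp]; exact hgs

lemma exists_isTestFunction_integral_eq_one :
    ∃ ρ : ℝ → ℂ, IsTestFunction ρ ∧ ∫ x in Ioi (0 : ℝ), ρ x = 1 := by
  let f : ContDiffBump (1 : ℝ) := ⟨1 / 4, 1 / 2, by norm_num, by norm_num⟩
  have hts : tsupport (f.normed volume) = Metric.closedBall 1 (1 / 2) := f.tsupport_normed_eq
  have hsub : tsupport (f.normed volume) ⊆ Ioi 0 := by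
    rw [hts]
    intro x hx
    rw [Real.closedBall_eq_Icc] at hx
    have := hx.1
    rw [mem_Ioi]; linarith
  refine ⟨fun x => (f.normed volume x : ℂ), isTestFunction_ofReal f.contDiff_normed
    f.hasCompactSupport_normed hsub, ?_⟩
  rw [setIntegral_eq_integral_of_forall_compl_eq_zero, integral_complex_ofReal, f.integral_normed]
  · simp
  · intro x hx
    rw [image_eq_zero_of_notMem_tsupport fun h => hx (hsub h), Complex.ofReal_zero]

/-- A test function with vanishing integral is the derivative of a test function. -/
lemma IsTestFunction.exists_deriv_eq {ψ : ℝ → ℂ} (h : IsTestFunction ψ)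
    (h0 : ∫ x in Ioi (0 : ℝ), ψ x = 0) : ∃ φ, IsTestFunction φ ∧ _root_.deriv φ = ψ := by
  obtain ⟨a, b, ha, hab, hsub⟩ := h.exists_tsupport_subset_Ioo
  have hψ0 : ∀ x ∉ Ioo a b, ψ x = 0 := fun x hx =>
    image_eq_zero_of_notMem_tsupport fun h => hx (hsub h)
  have hc : Continuous ψ := h.contDiff.continuous
  have hd : ∀ x, HasDerivAt (fun x => ∫ t in a..x, ψ t) (ψ x) x := fun x =>
    intervalIntegral.integral_hasDerivAt_right (hc.intervalIntegrable _ _)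
      (hc.stronglyMeasurableAtFilter _ _) hc.continuousAt
  have hde : _root_.deriv (fun x => ∫ t in a..x, ψ t) = ψ := funext fun x => (hd x).deriv
  have hs : Function.support (fun x => ∫ t in a..x, ψ t) ⊆ Icc a b := by
    intro x hx
    by_contra hxn
    apply hx
    change ∫ t in a..x, ψ t = 0
    rcases lt_or_ge x a with hxa | hxa
    · refine intervalIntegral.integral_zero_ae (Eventually.of_forall fun t ht => hψ0 t fun h' => ?_)
      rw [uIoc_of_ge hxa.le] at ht
      exact absurd h'.1 (not_lt.mpr ht.2)
    · have hbx : b ≤ x := by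
        by_contra hb
        exact hxn ⟨hxa, (not_le.mp hb).le⟩
      rw [← intervalIntegral.integral_add_adjacent_intervals (hc.intervalIntegrable a b)
        (hc.intervalIntegrable b x), ← setIntegral_Ioi_eq_intervalIntegral ha hab hψ0, h0, zero_add]
      refine intervalIntegral.integral_zero_ae (Eventually.of_forall fun t ht => hψ0 t fun h' => ?_)
      rw [uIoc_of_le hbx] at ht
      exact absurd h'.2 (not_lt.mpr ht.1.le)
  refine ⟨fun x => ∫ t in a..x, ψ t, ⟨?_, ?_, ?_⟩, hde⟩
  · rw [contDiff_infty_iff_deriv, hde]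
    exact ⟨fun x => (hd x).differentiableAt, h.contDiff⟩
  · exact HasCompactSupport.of_support_subset_isCompact isCompact_Icc hs
  · exact (closure_minimal hs isClosed_Icc).trans fun x hx => ha.trans_le hx.1

/-- Local integrability on the half-line, through interval integrals. -/
def LocInt (v : ℝ → ℂ) : Prop :=
  ∀ x ∈ Ioi (0 : ℝ), ∀ y ∈ Ioi (0 : ℝ), IntervalIntegrable v volume x y

lemma LocInt.integrableOn_mul {v φ : ℝ → ℂ} (hv : LocInt v) (hφ : IsTestFunction φ) :
    IntegrableOn (fun x => v x * φ x) (Ioi 0) := by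
  obtain ⟨a, b, ha, hab, hsub⟩ := hφ.exists_tsupport_subset_Ioo
  have h1 : IntegrableOn (fun x => v x * φ x) (Ioc a b) :=
    (intervalIntegrable_iff_integrableOn_Ioc_of_le hab.le).mp
      ((hv a ha b (ha.trans hab)).mul_continuousOn hφ.contDiff.continuous.continuousOn)
  refine h1.of_forall_sdiff_eq_zero measurableSet_Ioi fun x hx => ?_
  rw [image_eq_zero_of_notMem_tsupport fun h => hx.2 (Ioo_subset_Ioc_self (hsub h)), mul_zero]

lemma LocInt.locallyIntegrableOn {v : ℝ → ℂ} (hv : LocInt v) :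
    LocallyIntegrableOn v (Ioi 0) := by
  rw [locallyIntegrableOn_iff isOpen_Ioi.isLocallyClosed]
  intro K hK hKc
  rcases K.eq_empty_or_nonempty with rfl | hne
  · simp
  · obtain ⟨a, ha⟩ := hKc.exists_isLeast hne
    obtain ⟨b, hb⟩ := hKc.exists_isGreatest hne
    have h := (intervalIntegrable_iff_integrableOn_Icc_of_le (ha.2 hb.1)).mp
      (hv a (hK ha.1) b (hK hb.1))
    exact h.mono_set fun x hx => ⟨ha.2 hx, hb.2 hx⟩

lemma locInt_of_continuousOn {v : ℝ → ℂ} (h : ContinuousOn v (Ioi 0)) : LocInt v :=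
  fun _ hx _ hy => (h.mono (ordConnected_Ioi.uIcc_subset hx hy)).intervalIntegrable

/-- The lemma of du Bois-Reymond: a function with vanishing weak derivative is constant. -/
lemma LocInt.ae_eq_const {v : ℝ → ℂ} (hv : LocInt v)
    (h : ∀ φ, IsTestFunction φ → ∫ x in Ioi (0 : ℝ), v x * deriv φ x = 0) :
    ∃ c : ℂ, ∀ᵐ x, x ∈ Ioi (0 : ℝ) → v x = c := by
  obtain ⟨ρ, hρ, hρ1⟩ := exists_isTestFunction_integral_eq_one
  set c := ∫ x in Ioi (0 : ℝ), v x * ρ x with hc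
  have hconst : LocInt (fun _ => c) := locInt_of_continuousOn continuousOn_const
  have hone : LocInt (fun _ => 1) := locInt_of_continuousOn continuousOn_const
  have hvc : LocInt (fun x => v x - c) := fun x hx y hy => (hv x hx y hy).sub (hconst x hx y hy)
  refine ⟨c, ?_⟩
  have key := isOpen_Ioi.ae_eq_zero_of_integral_contDiff_smul_eq_zero
    hvc.locallyIntegrableOn (μ := volume) ?_
  · exact key.mono fun x hx hx0 => sub_eq_zero.mp (hx hx0)
  · intro g hg hgc hgs
    have ht := isTestFunction_ofReal hg hgc hgs
    set I := ∫ x in Ioi (0 : ℝ), (g x : ℂ) with hI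
    have hint : ∀ {φ : ℝ → ℂ}, IsTestFunction φ → IntegrableOn φ (Ioi 0) := fun hφ => by
      simpa using hone.integrableOn_mul hφ
    obtain ⟨φ, hφ, hφd⟩ := (ht.sub (hρ.const_mul I)).exists_deriv_eq (by
      rw [integral_sub (hint ht) (hint (hρ.const_mul I)), integral_const_mul, hρ1, ← hI]; ring)
    have h1 := h φ hφ
    rw [hφd] at h1
    have h2 : ∫ x in Ioi (0 : ℝ), v x * ((g x : ℂ) - I * ρ x)
        = (∫ x in Ioi (0 : ℝ), v x * (g x : ℂ)) - I * c := by
      rw [hc, ← integral_const_mul, ← integral_sub (hv.integrableOn_mul ht)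
        ((hv.integrableOn_mul hρ).const_mul I)]
      exact integral_congr_ae (Eventually.of_forall fun x => by ring)
    rw [← setIntegral_eq_integral_of_forall_compl_eq_zero (s := Ioi (0 : ℝ))]
    · have h3 : ∫ x in Ioi (0 : ℝ), g x • (v x - c)
          = (∫ x in Ioi (0 : ℝ), v x * (g x : ℂ)) - c * I := by
        rw [hI, ← integral_const_mul, ← integral_sub (hv.integrableOn_mul ht)
          (hconst.integrableOn_mul ht)]
        exact integral_congr_ae (Eventually.of_forall fun x => by simp; ring)
      rw [h3, mul_comm c I, ← h2, h1]
    · intro x hx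
      rw [image_eq_zero_of_notMem_tsupport fun h => hx (hgs h), zero_smul]

/-- A function with vanishing second weak derivative is affine. -/
lemma LocInt.ae_eq_affine {v : ℝ → ℂ} (hv : LocInt v)
    (h : ∀ φ, IsTestFunction φ → ∫ x in Ioi (0 : ℝ), v x * deriv (deriv φ) x = 0) :
    ∃ a b : ℂ, ∀ᵐ x, x ∈ Ioi (0 : ℝ) → v x = a + b * x := by
  obtain ⟨ρ, hρ, hρ1⟩ := exists_isTestFunction_integral_eq_one
  set b := -∫ x in Ioi (0 : ℝ), v x * deriv ρ x with hb
  have hlin : LocInt (fun x => (x : ℂ)) :=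
    locInt_of_continuousOn Complex.continuous_ofReal.continuousOn
  have hone : LocInt (fun _ => 1) := locInt_of_continuousOn continuousOn_const
  have hint : ∀ {φ : ℝ → ℂ}, IsTestFunction φ → IntegrableOn φ (Ioi 0) := fun hφ => by
    simpa using hone.integrableOn_mul hφ
  have hvb : LocInt (fun x => v x - b * x) := fun x hx y hy =>
    (hv x hx y hy).sub ((hlin x hx y hy).const_mul b)
  obtain ⟨a, ha⟩ := hvb.ae_eq_const fun g hg => by
    set I := ∫ x in Ioi (0 : ℝ), g x with hI
    obtain ⟨φ, hφ, hφd⟩ := (hg.sub (hρ.const_mul I)).exists_deriv_eq (by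
      rw [integral_sub (hint hg) (hint (hρ.const_mul I)), integral_const_mul, hρ1, ← hI]; ring)
    have hφ2 : deriv (deriv φ) = fun x => deriv g x - I * deriv ρ x := by
      rw [hφd]; ext x
      have h1 := ((hg.contDiff.differentiable (by simp)) x).hasDerivAt
      have h2 := ((hρ.contDiff.differentiable (by simp)) x).hasDerivAt
      exact (h1.sub (h2.const_mul I)).deriv
    have h1 := h φ hφ
    rw [hφ2] at h1
    have h2 : ∫ x in Ioi (0 : ℝ), v x * (deriv g x - I * deriv ρ x)
        = (∫ x in Ioi (0 : ℝ), v x * deriv g x) - I * (-b) := by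
      rw [hb, neg_neg, ← integral_const_mul, ← integral_sub (hv.integrableOn_mul hg.deriv)
        ((hv.integrableOn_mul hρ.deriv).const_mul I)]
      exact integral_congr_ae (Eventually.of_forall fun x => by ring)
    have h3 : ∫ x in Ioi (0 : ℝ), (x : ℂ) * deriv g x = -I := by
      have e : ∀ f : ℝ → ℂ, (∀ x ∉ Ioi (0 : ℝ), f x = 0) → ∫ x in Ioi (0 : ℝ), f x = ∫ x, f x :=
        fun f hf => setIntegral_eq_integral_of_forall_compl_eq_zero hf
      have z1 : ∀ x ∉ Ioi (0 : ℝ), g x = 0 := fun x hx =>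
        image_eq_zero_of_notMem_tsupport fun h => hx (hg.tsupport_subset h)
      have z2 : ∀ x ∉ Ioi (0 : ℝ), deriv g x = 0 := fun x hx =>
        image_eq_zero_of_notMem_tsupport fun h => hx (hg.deriv.tsupport_subset h)
      rw [hI, e _ z1, e _ fun x hx => by rw [z2 x hx, mul_zero]]
      have := integral_mul_deriv_eq_deriv_mul_of_integrable (u := fun x : ℝ => (x : ℂ)) (v := g)
        (u' := fun _ => 1) (v' := deriv g) (fun x _ => Complex.ofRealCLM.hasDerivAt)
        (fun x _ => ((hg.contDiff.differentiable (by simp)) x).hasDerivAt)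
        ((Complex.continuous_ofReal.mul
          hg.deriv.contDiff.continuous).integrable_of_hasCompactSupport
          hg.deriv.hasCompactSupport.mul_left)
        ((continuous_const.mul hg.contDiff.continuous).integrable_of_hasCompactSupport
          hg.hasCompactSupport.mul_left)
        ((Complex.continuous_ofReal.mul
          hg.contDiff.continuous).integrable_of_hasCompactSupport
          hg.hasCompactSupport.mul_left)
      simpa using this
    have h4 : ∫ x in Ioi (0 : ℝ), (v x - b * x) * deriv g x
        = (∫ x in Ioi (0 : ℝ), v x * deriv g x) - b * (-I) := by
      rw [← h3, ← integral_const_mul, ← integral_sub (hv.integrableOn_mul hg.deriv)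
        ((hlin.integrableOn_mul hg.deriv).const_mul b)]
      exact integral_congr_ae (Eventually.of_forall fun x => by ring)
    rw [h4, ← h1, h2]; ring
  exact ⟨a, b, ha.mono fun x hx hx0 => by rw [← hx hx0]; ring⟩

lemma locInt_L2Pos (u : L2Pos) : LocInt u := by
  have key : ∀ x ∈ Ioi (0 : ℝ), ∀ y, IntegrableOn u (Ioc x y) := by
    intro x hx y
    have h1 : MemLp u 2 (volume.restrict (Ioc x y)) :=
      (Lp.memLp u).mono_measure (Measure.restrict_mono (fun t ht => lt_trans hx ht.1) le_rfl)
    exact h1.integrable (by norm_num)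
  exact fun x hx y hy => ⟨key x hx y, key y hy x⟩

/-- Regularity of weak solutions: an element of the maximal domain is represented by a strong
solution. -/
lemma HasDistribImage.exists_isStrong {β α : ℂ} {u w : L2Pos} (h : HasDistribImage β α u w) :
    ∃ F F₁ : ℝ → ℂ, Represents F u ∧ IsStrong β α (Ioi 0) F F₁ w := by
  set k : ℝ → ℂ := fun x => pot β α x * u x - w x with hk
  have hpu : LocInt (fun x => pot β α x * u x) := fun x hx y hy =>
    (locInt_L2Pos u x hx y hy).continuousOn_mul
      ((continuousOn_pot β α).mono (ordConnected_Ioi.uIcc_subset hx hy))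
  have hkl : LocInt k := fun x hx y hy => (hpu x hx y hy).sub (locInt_L2Pos w x hx y hy)
  have h1 : (1 : ℝ) ∈ Ioi (0 : ℝ) := mem_Ioi.mpr one_pos
  -- `H` is a second primitive of `k`, so `u - H` has vanishing second weak derivative
  set H₁ : ℝ → ℂ := fun x => ∫ t in (1 : ℝ)..x, k t with hH₁
  have hP : IsPrimitiveOn (Ioi 0) H₁ k := IsPrimitiveOn.integral h1 hkl
  have hc : ContinuousOn H₁ (Ioi 0) := hP.continuousOn ordConnected_Ioi isOpen_Ioi
  set H : ℝ → ℂ := fun x => ∫ t in (1 : ℝ)..x, H₁ t with hH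
  have hHd : ∀ x ∈ Ioi (0 : ℝ), HasDerivAt H (H₁ x) x := fun x hx =>
    intervalIntegral.integral_hasDerivAt_right (locInt_of_continuousOn hc 1 h1 x hx)
      (hc.stronglyMeasurableAtFilter isOpen_Ioi x hx) (hc.continuousAt (Ioi_mem_nhds hx))
  -- the parameters `β = 0`, `α = 1/4` turn `L` into `-∂²`
  have hS : IsStrong 0 (1 / 4) (Ioi 0) H H₁ (fun x => -k x) := by
    refine ⟨hHd, hP.congr ordConnected_Ioi (fun _ _ => rfl) fun x _ => ?_⟩
    simp only [pot_zero, Pi.zero_apply]; ring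
  have hHl : LocInt H := locInt_of_continuousOn hS.continuousOn
  have hv : LocInt (fun x => u x - H x) := fun x hx y hy =>
    (locInt_L2Pos u x hx y hy).sub (hHl x hx y hy)
  obtain ⟨a, b, hab⟩ := hv.ae_eq_affine fun φ hφ => by
    have e1 := hS.integral_mul_diffExpr hφ
    have e2 := h φ hφ
    have e3 : ∀ x, diffExpr 0 (1 / 4) φ x = -deriv (deriv φ) x := fun x => by simp [diffExpr]
    have e4 : ∀ x, u x * diffExpr β α φ x
        = pot β α x * u x * φ x - u x * deriv (deriv φ) x := fun x => by
      simp only [diffExpr, pot]; ring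
    simp only [e3, mul_neg, neg_mul, integral_neg] at e1
    simp only [e4] at e2
    rw [integral_sub (hpu.integrableOn_mul hφ) ((locInt_L2Pos u).integrableOn_mul hφ.deriv.deriv)]
      at e2
    have e5 : ∫ x in Ioi (0 : ℝ), k x * φ x = (∫ x in Ioi (0 : ℝ), pot β α x * u x * φ x)
        - ∫ x in Ioi (0 : ℝ), w x * φ x := by
      rw [← integral_sub (hpu.integrableOn_mul hφ) ((locInt_L2Pos w).integrableOn_mul hφ)]
      exact integral_congr_ae (Eventually.of_forall fun x => by simp only [hk]; ring)
    simp only [sub_mul]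
    rw [integral_sub ((locInt_L2Pos u).integrableOn_mul hφ.deriv.deriv)
      (hHl.integrableOn_mul hφ.deriv.deriv), neg_inj.mp e1, e5, ← e2]
    ring
  refine ⟨fun x => H x + (a + b * x), fun x => H₁ x + b, ?_, ?_, ?_⟩
  · rw [Represents, EventuallyEq, ae_restrict_iff' measurableSet_Ioi]
    exact hab.mono fun x hx hx0 => by rw [← hx hx0]; ring
  · intro x hx
    have hl : HasDerivAt (fun x : ℝ => (x : ℂ)) 1 x := Complex.ofRealCLM.hasDerivAt
    exact ((hHd x hx).add ((hl.const_mul b).const_add a)).congr_deriv (by simp)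
  · have hb : IsPrimitiveOn (Ioi 0) (fun _ => b) 0 :=
      IsPrimitiveOn.of_hasDerivAt ordConnected_Ioi (fun x _ => hasDerivAt_const x b)
        continuousOn_const
    refine (hP.add hb).congr_ae ordConnected_Ioi ?_
    exact hab.mono fun x hx hx0 => by
      have := hx hx0
      simp only [hk, Pi.zero_apply]
      rw [← this]; ring

/-! ### Decay at infinity and the Green formula -/

/-- The `L²` norm of `f` over the set `s`, as a real number. -/
noncomputable def l2norm (s : Set ℝ) (f : ℝ → ℂ) : ℝ := (∫ x in s, ‖f x‖ ^ 2) ^ (1 / 2 : ℝ)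

lemma l2norm_nonneg (s : Set ℝ) (f : ℝ → ℂ) : 0 ≤ l2norm s f :=
  Real.rpow_nonneg (integral_nonneg fun _ => by positivity) _

/-- The Cauchy-Schwarz inequality. -/
lemma setIntegral_norm_mul_norm_le {s : Set ℝ} {f g : ℝ → ℂ} (hf : MemLp f 2 (volume.restrict s))
    (hg : MemLp g 2 (volume.restrict s)) :
    ∫ x in s, ‖f x‖ * ‖g x‖ ≤ l2norm s f * l2norm s g := by
  have h := integral_mul_norm_le_Lp_mul_Lq (μ := volume.restrict s) (f := f) (g := g)
    Real.HolderConjugate.two_two (by simpa using hf) (by simpa using hg)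
  simpa [l2norm] using h

lemma norm_setIntegral_mul_le {s : Set ℝ} {f g : ℝ → ℂ} (hf : MemLp f 2 (volume.restrict s))
    (hg : MemLp g 2 (volume.restrict s)) :
    ‖∫ x in s, f x * g x‖ ≤ l2norm s f * l2norm s g := by
  refine (norm_integral_le_integral_norm _).trans ?_
  simpa only [norm_mul] using setIntegral_norm_mul_norm_le hf hg

lemma memLp_mono {s t : Set ℝ} {f : ℝ → ℂ} (hf : MemLp f 2 (volume.restrict s)) (h : t ⊆ s) :
    MemLp f 2 (volume.restrict t) :=
  hf.mono_measure (Measure.restrict_mono h le_rfl)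

lemma integrableOn_mul_of_memLp {s : Set ℝ} {f g : ℝ → ℂ} (hf : MemLp f 2 (volume.restrict s))
    (hg : MemLp g 2 (volume.restrict s)) : IntegrableOn (fun x => f x * g x) s :=
  hf.integrable_mul hg

lemma integrableOn_norm_sq {s : Set ℝ} {f : ℝ → ℂ} (hf : MemLp f 2 (volume.restrict s)) :
    IntegrableOn (fun x => ‖f x‖ ^ 2) s := by
  exact hf.integrable_norm_pow (p := 2) (by norm_num)

lemma tendsto_setIntegral_norm_Ioc_atTop {g : ℝ → ℂ}
    (hg : MemLp g 2 (volume.restrict (Ioi (1 : ℝ)))) :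
    Tendsto (fun x : ℝ => ∫ t in Ioc x (x + 1), ‖g t‖) atTop (𝓝 0) := by
  have hi := integrableOn_norm_sq hg
  have h1 := intervalIntegral_tendsto_integral_Ioi 1 hi tendsto_id
  have h2 := intervalIntegral_tendsto_integral_Ioi 1 hi
    (tendsto_atTop_add_const_right atTop 1 tendsto_id)
  have h3 : Tendsto (fun x : ℝ => ∫ t in Ioc x (x + 1), ‖g t‖ ^ 2) atTop (𝓝 0) := by
    have := h2.sub h1
    rw [sub_self] at this
    refine this.congr' ?_
    filter_upwards [eventually_ge_atTop 1] with x hx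
    have hii : ∀ y, 1 ≤ y → IntervalIntegrable (fun x => ‖g x‖ ^ 2) volume 1 y := fun y hy =>
      (intervalIntegrable_iff_integrableOn_Ioc_of_le hy).mpr (hi.mono_set fun t ht => ht.1)
    simp only [id]
    rw [intervalIntegral.integral_interval_sub_left (hii _ (by linarith)) (hii _ hx),
      intervalIntegral.integral_of_le (by linarith)]
  have h4 : Tendsto (fun x : ℝ => l2norm (Ioc x (x + 1)) g) atTop (𝓝 0) := by
    have := h3.rpow_const (p := 1 / 2) (Or.inr (by norm_num))
    simpa [l2norm] using this
  refine tendsto_of_tendsto_of_tendsto_of_le_of_le' tendsto_const_nhds h4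
    (Eventually.of_forall fun x => integral_nonneg fun _ => norm_nonneg _) ?_
  filter_upwards [eventually_ge_atTop 1] with x hx
  have hm := memLp_mono hg (t := Ioc x (x + 1)) fun t ht => lt_of_le_of_lt hx ht.1
  have := setIntegral_norm_mul_norm_le hm (memLp_const (1 : ℂ))
  have e : l2norm (Ioc x (x + 1)) (fun _ => (1 : ℂ)) = 1 := by simp [l2norm]
  rw [e] at this
  simpa using this

/-- The values of `F` and `F'` at `x`, read off with a kernel `κ` that vanishes to second order at
`x + 1`, are controlled by the integrals of `F` and `F''` over `]x, x + 1]`. -/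
lemma norm_wronsk_le_of_kernel {F F₁ k κ κ₁ κ₂ : ℝ → ℂ}
    (hF : IsStrong 0 (1 / 4) (Ioi 0) F F₁ k) (h1 : ∀ t, HasDerivAt κ (κ₁ t) t)
    (h2 : ∀ t, HasDerivAt κ₁ (κ₂ t) t) (hc : Continuous κ₂) {C x : ℝ} (hx : 0 < x)
    (hκ : ∀ t ∈ Icc x (x + 1), ‖κ t‖ ≤ C) (hκ₂ : ∀ t ∈ Icc x (x + 1), ‖κ₂ t‖ ≤ C)
    (h0 : κ (x + 1) = 0) (h0' : κ₁ (x + 1) = 0) :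
    ‖wronsk F F₁ κ κ₁ x‖ ≤ C * ((∫ t in Ioc x (x + 1), ‖k t‖) + ∫ t in Ioc x (x + 1), ‖F t‖) := by
  -- with `β = 0` and `α = 1/4` the potential vanishes, so Lagrange's identity is Green's for `-∂²`
  have hκS : IsStrong 0 (1 / 4) (Ioi 0) κ κ₁ (fun t => -κ₂ t) := by
    refine IsStrong.of_hasDerivAt ordConnected_Ioi subset_rfl (fun t _ => h1 t) (fun t _ => ?_)
      hc.neg.continuousOn
    refine (h2 t).congr_deriv ?_
    simp only [pot_zero, Pi.zero_apply]; ring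
  have hx1 : (0 : ℝ) < x + 1 := by linarith
  have hL := ((hF.isPrimitiveOn_wronsk hκS ordConnected_Ioi isOpen_Ioi) x hx (x + 1) hx1).2
  have e : wronsk F F₁ κ κ₁ (x + 1) = 0 := by simp [wronsk, h0, h0']
  rw [e, zero_sub, intervalIntegral.integral_of_le (by linarith)] at hL
  rw [← norm_neg, ← hL]
  have hFi : IntegrableOn (fun t => ‖F t‖) (Ioc x (x + 1)) :=
    ((intervalIntegrable_iff_integrableOn_Ioc_of_le (by linarith)).mp
      (locInt_of_continuousOn hF.continuousOn x hx (x + 1) hx1)).norm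
  have hki : IntegrableOn (fun t => ‖k t‖) (Ioc x (x + 1)) :=
    ((intervalIntegrable_iff_integrableOn_Ioc_of_le (by linarith)).mp
      (hF.intervalIntegrable ordConnected_Ioi subset_rfl hx hx1)).norm
  rw [← integral_add hki hFi, ← integral_const_mul]
  refine norm_integral_le_of_norm_le (Integrable.const_mul (hki.add hFi) C) ?_
  refine (ae_restrict_iff' measurableSet_Ioc).mpr (Eventually.of_forall fun t ht => ?_)
  have ht' := Ioc_subset_Icc_self ht
  refine (norm_sub_le _ _).trans ?_
  rw [norm_mul, norm_mul, norm_neg, mul_add, mul_comm, mul_comm ‖F t‖]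
  exact add_le_add (mul_le_mul_of_nonneg_right (hκ t ht') (norm_nonneg _))
    (mul_le_mul_of_nonneg_right (hκ₂ t ht') (norm_nonneg _))

lemma norm_pot_le {β α : ℂ} {x : ℝ} (hx : 1 ≤ x) : ‖pot β α x‖ ≤ ‖α - 1 / 4‖ + ‖β‖ := by
  have hn : ‖(x : ℂ)‖ = x := by rw [Complex.norm_real, Real.norm_of_nonneg (by linarith)]
  refine (norm_sub_le _ _).trans (add_le_add ?_ ?_)
  · rw [norm_mul, norm_div, norm_pow, hn, norm_one]
    refine mul_le_of_le_one_right (norm_nonneg _) ?_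
    rw [div_le_one (by positivity)]
    nlinarith
  · rw [norm_div, hn]
    exact div_le_self (norm_nonneg _) hx

/-- Strong square integrable solutions decay at infinity together with their derivative. -/
lemma IsStrong.tendsto_atTop {β α : ℂ} {F F₁ w : ℝ → ℂ} (hF : IsStrong β α (Ioi 0) F F₁ w)
    (hF2 : MemLp F 2 (volume.restrict (Ioi (0 : ℝ))))
    (hw2 : MemLp w 2 (volume.restrict (Ioi (0 : ℝ)))) :
    Tendsto F atTop (𝓝 0) ∧ Tendsto F₁ atTop (𝓝 0) := by
  have hsub : Ioi (1 : ℝ) ⊆ Ioi 0 := Ioi_subset_Ioi zero_le_one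
  set k : ℝ → ℂ := fun x => w x - pot β α x * F x with hk
  have hS : IsStrong 0 (1 / 4) (Ioi 0) F F₁ k := by
    refine ⟨hF.hasDerivAt, hF.prim.congr ordConnected_Ioi (fun _ _ => rfl) fun x _ => ?_⟩
    simp only [pot_zero, Pi.zero_apply, hk]; ring
  have hF2' := memLp_mono hF2 hsub
  have hpF : MemLp (fun x => pot β α x * F x) 2 (volume.restrict (Ioi (1 : ℝ))) := by
    refine hF2'.of_le_mul (c := ‖α - 1 / 4‖ + ‖β‖) ?_ ?_
    · exact (((continuousOn_pot β α).mono hsub).mul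
        (hF.continuousOn.mono hsub)).aestronglyMeasurable measurableSet_Ioi
    · refine (ae_restrict_iff' measurableSet_Ioi).mpr (Eventually.of_forall fun t ht => ?_)
      rw [norm_mul]
      gcongr
      exact norm_pot_le (le_of_lt ht)
  have hk2 : MemLp k 2 (volume.restrict (Ioi (1 : ℝ))) := (memLp_mono hw2 hsub).sub hpF
  -- 18 bounds both kernels used below, and their second derivatives, for `0 ≤ z ≤ 1`
  have hlim : Tendsto (fun x : ℝ => 18 * ((∫ t in Ioc x (x + 1), ‖k t‖)
      + ∫ t in Ioc x (x + 1), ‖F t‖)) atTop (𝓝 0) := by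
    simpa using ((tendsto_setIntegral_norm_Ioc_atTop hk2).add
      (tendsto_setIntegral_norm_Ioc_atTop hF2')).const_mul 18
  have hz : ∀ x t : ℝ, HasDerivAt (fun t : ℝ => (t : ℂ) - x) 1 t := fun x t =>
    (Complex.ofRealCLM.hasDerivAt (x := t)).sub_const (x : ℂ)
  have hzn : ∀ x t : ℝ, t ∈ Icc x (x + 1) → ‖(t : ℂ) - x‖ ≤ 1 ∧ ‖1 - ((t : ℂ) - x)‖ ≤ 1 := by
    intro x t ht
    constructor
    · rw [← Complex.ofReal_sub, Complex.norm_real, Real.norm_eq_abs, abs_le]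
      exact ⟨by linarith [ht.1], by linarith [ht.2]⟩
    · rw [← Complex.ofReal_sub, ← Complex.ofReal_one, ← Complex.ofReal_sub, Complex.norm_real,
        Real.norm_eq_abs, abs_le]
      exact ⟨by linarith [ht.2], by linarith [ht.1]⟩
  constructor
  · refine squeeze_zero_norm' ?_ hlim
    filter_upwards [eventually_ge_atTop 1] with x hx
    have hx0 : 0 < x := by linarith
    -- the kernel is `z (1 - z)²` with `z = t - x`
    have := norm_wronsk_le_of_kernel (C := 18) (x := x) hS
      (κ := fun t => ((t : ℂ) - x) * (1 - ((t : ℂ) - x)) ^ 2)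
      (κ₁ := fun t => (1 - ((t : ℂ) - x)) ^ 2 - 2 * ((t : ℂ) - x) * (1 - ((t : ℂ) - x)))
      (κ₂ := fun t => 6 * ((t : ℂ) - x) - 4)
      (fun t => ((hz x t).mul (((hz x t).const_sub 1).pow 2)).congr_deriv
        (by simp only [Pi.pow_apply]; push_cast; ring))
      (fun t => ((((hz x t).const_sub 1).pow 2).sub
        (((hz x t).const_mul 2).mul ((hz x t).const_sub 1))).congr_deriv (by push_cast; ring))
      (by fun_prop) hx0
      (fun t ht => by
        obtain ⟨h1, h2⟩ := hzn x t ht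
        rw [norm_mul, norm_pow]
        calc _ ≤ (1 : ℝ) * 1 ^ 2 := by gcongr
          _ ≤ 18 := by norm_num)
      (fun t ht => by
        obtain ⟨h1, h2⟩ := hzn x t ht
        refine (norm_sub_le _ _).trans ?_
        rw [norm_mul]
        simp only [Complex.norm_ofNat]
        linarith)
      (by push_cast; ring) (by push_cast; ring)
    simpa [wronsk] using this
  · refine squeeze_zero_norm' ?_ hlim
    filter_upwards [eventually_ge_atTop 1] with x hx
    have hx0 : 0 < x := by linarith
    -- the kernel is `(1 - z)² (1 + 2z)` with `z = t - x`
    have := norm_wronsk_le_of_kernel (C := 18) (x := x) hS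
      (κ := fun t => (1 - ((t : ℂ) - x)) ^ 2 * (1 + 2 * ((t : ℂ) - x)))
      (κ₁ := fun t => -(6 * ((t : ℂ) - x)) * (1 - ((t : ℂ) - x)))
      (κ₂ := fun t => 12 * ((t : ℂ) - x) - 6)
      (fun t => ((((hz x t).const_sub 1).pow 2).mul
        (((hz x t).const_mul 2).const_add 1)).congr_deriv
          (by simp only [Pi.pow_apply]; push_cast; ring))
      (fun t => (((hz x t).const_mul 6).neg.mul ((hz x t).const_sub 1)).congr_deriv
        (by simp only [Pi.neg_apply]; ring))
      (by fun_prop) hx0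
      (fun t ht => by
        obtain ⟨h1, h2⟩ := hzn x t ht
        rw [norm_mul, norm_pow]
        have h3 : ‖1 + 2 * ((t : ℂ) - x)‖ ≤ 3 := by
          refine (norm_add_le _ _).trans ?_
          rw [norm_mul, norm_one]
          simp only [Complex.norm_ofNat]
          linarith
        calc _ ≤ (1 : ℝ) ^ 2 * 3 := by gcongr
          _ ≤ 18 := by norm_num)
      (fun t ht => by
        obtain ⟨h1, h2⟩ := hzn x t ht
        refine (norm_sub_le _ _).trans ?_
        rw [norm_mul]
        simp only [Complex.norm_ofNat]
        linarith)
      (by push_cast; ring) (by push_cast; ring)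
    simpa [wronsk] using this

/-- Green's formula: since the Wronskian vanishes at infinity, its limit at `0` is an integral. -/
lemma IsStrong.tendsto_wronsk {β α : ℂ} {F F₁ w G G₁ h : ℝ → ℂ}
    (hF : IsStrong β α (Ioi 0) F F₁ w) (hG : IsStrong β α (Ioi 0) G G₁ h)
    (hF2 : MemLp F 2 (volume.restrict (Ioi (0 : ℝ))))
    (hw2 : MemLp w 2 (volume.restrict (Ioi (0 : ℝ))))
    (hG2 : MemLp G 2 (volume.restrict (Ioi (0 : ℝ))))
    (hh2 : MemLp h 2 (volume.restrict (Ioi (0 : ℝ)))) :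
    Tendsto (wronsk F F₁ G G₁) (𝓝[>] 0)
      (𝓝 (-((∫ x in Ioi (0 : ℝ), w x * G x) - ∫ x in Ioi (0 : ℝ), F x * h x))) := by
  have hi : IntegrableOn (fun x => w x * G x - F x * h x) (Ioi 0) :=
    (integrableOn_mul_of_memLp hw2 hG2).sub (integrableOn_mul_of_memLp hF2 hh2)
  rw [← integral_sub (integrableOn_mul_of_memLp hw2 hG2) (integrableOn_mul_of_memLp hF2 hh2)]
  have hP := hF.isPrimitiveOn_wronsk hG ordConnected_Ioi isOpen_Ioi
  obtain ⟨L, hL, hLx⟩ := (hP.mono Ioo_subset_Ioi_self).exists_tendsto (c := 1) one_pos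
    (hi.mono_set Ioo_subset_Ioi_self)
  have hinf : Tendsto (wronsk F F₁ G G₁) atTop (𝓝 0) := by
    obtain ⟨a, b⟩ := hF.tendsto_atTop hF2 hw2
    obtain ⟨c, d⟩ := hG.tendsto_atTop hG2 hh2
    have := (a.mul d).sub (b.mul c)
    rwa [mul_zero, sub_zero] at this
  have h2 : (1 / 2 : ℝ) ∈ Ioo (0 : ℝ) 1 := by norm_num
  have h3 := intervalIntegral_tendsto_integral_Ioi (1 / 2 : ℝ)
    (hi.mono_set (Ioi_subset_Ioi h2.1.le)) tendsto_id
  have h4 : Tendsto (fun y => wronsk F F₁ G G₁ y - wronsk F F₁ G G₁ (1 / 2)) atTop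
      (𝓝 (∫ x in Ioi (1 / 2 : ℝ), (w x * G x - F x * h x))) := by
    refine h3.congr' ?_
    filter_upwards [eventually_gt_atTop 0] with y hy
    exact (hP _ h2.1 y hy).2
  have h5 := tendsto_nhds_unique h4 (hinf.sub_const _)
  have h6 : ∫ x in Ioi (0 : ℝ), (w x * G x - F x * h x) = -L := by
    rw [← Ioc_union_Ioi_eq_Ioi h2.1.le, setIntegral_union (Ioc_disjoint_Ioi le_rfl)
      measurableSet_Ioi (hi.mono_set Ioc_subset_Ioi_self)
      (hi.mono_set (Ioi_subset_Ioi h2.1.le)), h5, hLx _ h2]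
    ring
  rw [h6, neg_neg]
  exact hL

/-! ### The minimal domain in terms of the pairing -/

/-- The bilinear pairing `∫ u v` on `L²(ℝ₊)`. -/
noncomputable def pairing (u v : L2Pos) : ℂ := ∫ x in Ioi (0 : ℝ), u x * v x

lemma pairing_comm (u v : L2Pos) : pairing u v = pairing v u :=
  integral_congr_ae (Eventually.of_forall fun _ => mul_comm _ _)

lemma pairing_eq_inner (u v : L2Pos) : pairing u v = inner ℂ (star v) u := by
  rw [pairing, L2.inner_def]
  refine integral_congr_ae ?_
  filter_upwards [Lp.coeFn_star v] with x hx
  rw [hx]; simp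

lemma pairing_add_left (u u' v : L2Pos) : pairing (u + u') v = pairing u v + pairing u' v := by
  simp only [pairing_eq_inner, inner_add_right]

lemma pairing_smul_left (c : ℂ) (u v : L2Pos) : pairing (c • u) v = c * pairing u v := by
  simp only [pairing_eq_inner, inner_smul_right]

lemma continuous_pairing_left (v : L2Pos) : Continuous fun u => pairing u v := by
  simp only [pairing_eq_inner]; fun_prop

lemma pairing_congr {u v : L2Pos} {F G : ℝ → ℂ} (hF : Represents F u) (hG : Represents G v) :
    pairing u v = ∫ x in Ioi (0 : ℝ), F x * G x := by
  refine integral_congr_ae ?_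
  filter_upwards [hF, hG] with x h1 h2
  rw [h1, h2]

/-- A point outside a closed complex subspace is separated from it by a continuous functional. -/
lemma exists_functional_of_notMem_closure {E : Type*} [NormedAddCommGroup E] [NormedSpace ℂ E]
    (p : Submodule ℂ E) {x : E} (hx : x ∉ closure (p : Set E)) :
    ∃ f : StrongDual ℂ E, (∀ y ∈ p, f y = 0) ∧ f x ≠ 0 := by
  have hconv : Convex ℝ (closure (p : Set E)) := (p.restrictScalars ℝ).convex.closure
  obtain ⟨f, u, hu, hp⟩ := RCLike.geometric_hahn_banach_point_closed (𝕜 := ℂ) hconv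
    isClosed_closure hx
  have hu0 : u < 0 := by simpa using hp 0 (subset_closure p.zero_mem)
  have hz : ∀ y ∈ p, f y = 0 := by
    intro y hy
    by_contra hne
    have h1 := hp (((u : ℂ) / f y) • y) (subset_closure (p.smul_mem _ hy))
    rw [map_smul, smul_eq_mul, div_mul_cancel₀ _ hne] at h1
    simp at h1
  refine ⟨f, hz, fun h0 => ?_⟩
  rw [h0] at hu
  simp at hu
  linarith

lemma mem_graph_domRestrict_iff (β α : ℂ) (p : L2Pos × L2Pos) :
    p ∈ ((Lmax β α).domRestrict testSubmodule).graph ↔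
      p ∈ maxGraph β α ∧ p.1 ∈ testSubmodule := by
  constructor
  · intro h
    refine ⟨?_, ?_⟩
    · rw [← Lmax_graph]
      exact LinearPMap.le_graph_of_le LinearPMap.domRestrict_le h
    · have := LinearPMap.mem_domain_of_mem_graph h
      exact this.1
  · rintro ⟨h1, h2⟩
    rw [← Lmax_graph, LinearPMap.mem_graph_iff] at h1
    obtain ⟨y, hy1, hy2⟩ := h1
    rw [LinearPMap.mem_graph_iff]
    refine ⟨⟨p.1, h2, hy1 ▸ y.2⟩, rfl, ?_⟩
    rw [← hy2]
    exact LinearPMap.domRestrict_apply (x := ⟨p.1, h2, hy1 ▸ y.2⟩) (y := y) hy1.symm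

/-- On test functions the operator is its own transpose, by the definition of the distributional
image. -/
lemma pairing_symm_of_test {β α : ℂ} {p q : L2Pos × L2Pos} (hp : p ∈ maxGraph β α)
    (hpt : p.1 ∈ testSubmodule) (hq : q ∈ maxGraph β α) :
    pairing p.2 q.1 = pairing p.1 q.2 := by
  obtain ⟨φ, hφ, hr⟩ := hpt
  set w := (hφ.diffExpr_memLp β α).toLp _ with hw
  have hw' : Represents (diffExpr β α φ) w := MemLp.coeFn_toLp _
  have h1 : (p.1, w) ∈ maxGraph β α := hasDistribImage_of_isTestFunction β α hφ hr hw'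
  have h2 : p.2 = w := by
    have := maxGraph_univalent β α (p - (p.1, w)) (Submodule.sub_mem _ hp h1) (by simp)
    simpa [sub_eq_zero] using this
  have h3 := hq φ hφ
  rw [h2, pairing_comm, pairing_comm p.1]
  have e1 : pairing q.1 w = ∫ x in Ioi (0 : ℝ), q.1 x * diffExpr β α φ x :=
    pairing_congr (EventuallyEq.refl _ _) hw'
  have e2 : pairing q.2 p.1 = ∫ x in Ioi (0 : ℝ), q.2 x * φ x :=
    pairing_congr (EventuallyEq.refl _ _) hr
  rw [e1, e2, h3]

/-- The minimal operator is the transpose of the maximal one: its graph consists of the elements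
of the maximal graph that annihilate the maximal graph under `(p, q) ↦ ∫ p₂ q₁ - ∫ p₁ q₂`. -/
lemma mem_Lmin_graph_iff_pairing (β α : ℂ) (p : L2Pos × L2Pos) :
    p ∈ (Lmin β α).graph ↔
      p ∈ maxGraph β α ∧ ∀ q ∈ maxGraph β α, pairing p.2 q.1 = pairing p.1 q.2 := by
  rw [mem_Lmin_graph_iff]
  constructor
  · intro h
    refine ⟨?_, fun q hq => ?_⟩
    · have hcl : IsClosed (maxGraph β α : Set (L2Pos × L2Pos)) := by
        have := Lmax_isClosed β α
        rwa [LinearPMap.IsClosed, Lmax_graph] at this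
      exact closure_minimal (fun q hq => ((mem_graph_domRestrict_iff β α q).mp hq).1) hcl h
    · have hcl : IsClosed {r : L2Pos × L2Pos | pairing r.2 q.1 = pairing r.1 q.2} :=
        isClosed_eq ((continuous_pairing_left q.1).comp continuous_snd)
          ((continuous_pairing_left q.2).comp continuous_fst)
      refine closure_minimal (fun r hr => ?_) hcl h
      obtain ⟨h1, h2⟩ := (mem_graph_domRestrict_iff β α r).mp hr
      exact pairing_symm_of_test h1 h2 hq
  · rintro ⟨hp, hall⟩
    by_contra hn
    obtain ⟨f, hf0, hfp⟩ := exists_functional_of_notMem_closure _ hn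
    -- Riesz representation of the two components of the separating functional
    set a : L2Pos := star ((InnerProductSpace.toDual ℂ L2Pos).symm
      (f.comp (ContinuousLinearMap.inl ℂ L2Pos L2Pos))) with ha
    set b : L2Pos := star ((InnerProductSpace.toDual ℂ L2Pos).symm
      (f.comp (ContinuousLinearMap.inr ℂ L2Pos L2Pos))) with hb
    have hf : ∀ r : L2Pos × L2Pos, f r = pairing r.1 a + pairing r.2 b := by
      intro r
      rw [pairing_eq_inner, pairing_eq_inner, ha, hb, star_star, star_star,
        InnerProductSpace.toDual_symm_apply, InnerProductSpace.toDual_symm_apply]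
      simp [← map_add]
    -- the functional kills the graph over the test functions, which says `L b = -a`
    have hmem : (b, -a) ∈ maxGraph β α := by
      intro φ hφ
      set u := hφ.memLp.toLp φ with hu
      set w := (hφ.diffExpr_memLp β α).toLp _ with hw
      have hu' : Represents φ u := MemLp.coeFn_toLp _
      have hw' : Represents (diffExpr β α φ) w := MemLp.coeFn_toLp _
      have h0 := hf0 (u, w) ((mem_graph_domRestrict_iff β α _).mpr
        ⟨hasDistribImage_of_isTestFunction β α hφ hu' hw', φ, hφ, hu'⟩)
      rw [hf] at h0
      have e1 : pairing b w = ∫ x in Ioi (0 : ℝ), b x * diffExpr β α φ x :=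
        pairing_congr (EventuallyEq.refl _ _) hw'
      have e2 : pairing (-a) u = ∫ x in Ioi (0 : ℝ), (-a : L2Pos) x * φ x :=
        pairing_congr (EventuallyEq.refl _ _) hu'
      change ∫ x in Ioi (0 : ℝ), b x * _ = ∫ x in Ioi (0 : ℝ), (-a : L2Pos) x * _
      rw [← e1, ← e2, ← neg_one_smul ℂ a, pairing_smul_left, pairing_comm b, pairing_comm a]
      simp only at h0
      linear_combination h0
    have h1 := hall _ hmem
    simp only at h1
    rw [pairing_comm p.1, ← neg_one_smul ℂ a, pairing_smul_left, pairing_comm a] at h1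
    exact hfp (by rw [hf, h1]; ring)

lemma mem_maxGraph_of_isStrong {β α : ℂ} {F F₁ w' : ℝ → ℂ}
    (hF : IsStrong β α (Ioi 0) F F₁ w') (hF2 : MemLp F 2 (volume.restrict (Ioi (0 : ℝ))))
    (hw2 : MemLp w' 2 (volume.restrict (Ioi (0 : ℝ)))) :
    (hF2.toLp F, hw2.toLp w') ∈ maxGraph β α :=
  hF.hasDistribImage hF2.coeFn_toLp hw2.coeFn_toLp

lemma Represents.memLp {F : ℝ → ℂ} {u : L2Pos} (h : Represents F u) :
    MemLp F 2 (volume.restrict (Ioi (0 : ℝ))) :=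
  (memLp_congr_ae h).mp (Lp.memLp u)

/-- A square integrable strong solution of `L F = w`, with `w` square integrable: the concrete form
of an element of the maximal domain. -/
structure IsMax (β α : ℂ) (F F₁ w : ℝ → ℂ) : Prop where
  isStrong : IsStrong β α (Ioi 0) F F₁ w
  memLp : MemLp F 2 (volume.restrict (Ioi (0 : ℝ)))
  memLp_image : MemLp w 2 (volume.restrict (Ioi (0 : ℝ)))

lemma exists_isMax {β α : ℂ} {p : L2Pos × L2Pos} (hp : p ∈ maxGraph β α) :
    ∃ F F₁ : ℝ → ℂ, Represents F p.1 ∧ IsMax β α F F₁ p.2 := by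
  obtain ⟨F, F₁, h1, h2⟩ := HasDistribImage.exists_isStrong (u := p.1) (w := p.2) hp
  exact ⟨F, F₁, h1, h2, h1.memLp, Lp.memLp _⟩

lemma exists_mem_maxGraph {β α : ℂ} {u : L2Pos} (hu : u ∈ (Lmax β α).domain) :
    ∃ w, (u, w) ∈ maxGraph β α := (mem_Lmax_domain_iff β α u).mp hu

lemma exists_isMax_of_mem_domain {β α : ℂ} {u : L2Pos} (hu : u ∈ (Lmax β α).domain) :
    ∃ F F₁ w : ℝ → ℂ, Represents F u ∧ IsMax β α F F₁ w := by
  obtain ⟨w, hw⟩ := exists_mem_maxGraph hu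
  obtain ⟨F, F₁, h1, h2⟩ := exists_isMax hw
  exact ⟨F, F₁, w, h1, h2⟩

lemma IsMax.mem_domain {β α : ℂ} {F F₁ w : ℝ → ℂ} (hF : IsMax β α F F₁ w) {u : L2Pos}
    (hu : Represents F u) : u ∈ (Lmax β α).domain :=
  (mem_Lmax_domain_iff β α u).mpr ⟨hF.memLp_image.toLp w,
    hF.isStrong.hasDistribImage hu hF.memLp_image.coeFn_toLp⟩

lemma mem_Lmin_domain_iff_pairing {β α : ℂ} {u : L2Pos} :
    u ∈ (Lmin β α).domain ↔
      ∃ w, (u, w) ∈ maxGraph β α ∧ ∀ q ∈ maxGraph β α, pairing w q.1 = pairing u q.2 := by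
  rw [LinearPMap.mem_domain_iff]
  simp only [mem_Lmin_graph_iff_pairing]

lemma Lmin_domain_le (β α : ℂ) : (Lmin β α).domain ≤ (Lmax β α).domain := by
  intro u hu
  obtain ⟨w, hw, -⟩ := mem_Lmin_domain_iff_pairing.mp hu
  exact (mem_Lmax_domain_iff β α u).mpr ⟨w, hw⟩

/-- The minimal domain consists of the functions whose Wronskian with every element of the maximal
domain vanishes at `0`. -/
lemma IsMax.mem_Lmin_domain_iff {β α : ℂ} {F F₁ w : ℝ → ℂ} (hF : IsMax β α F F₁ w) {u : L2Pos}
    (hu : Represents F u) :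
    u ∈ (Lmin β α).domain ↔ ∀ G G₁ h, IsMax β α G G₁ h →
      Tendsto (wronsk F F₁ G G₁) (𝓝[>] 0) (𝓝 0) := by
  have hw : Represents w (hF.memLp_image.toLp w) := hF.memLp_image.coeFn_toLp
  have hmem : (u, hF.memLp_image.toLp w) ∈ maxGraph β α := hF.isStrong.hasDistribImage hu hw
  constructor
  · intro h G G₁ k hG
    obtain ⟨w', hw', hall⟩ := mem_Lmin_domain_iff_pairing.mp h
    have hww : w' = hF.memLp_image.toLp w := by
      have := maxGraph_univalent β α ((u, w') - (u, hF.memLp_image.toLp w))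
        (Submodule.sub_mem _ hw' hmem) (by simp)
      simpa [sub_eq_zero] using this
    have h1 := hall _ (mem_maxGraph_of_isStrong hG.isStrong hG.memLp hG.memLp_image)
    rw [hww, pairing_congr hw hG.memLp.coeFn_toLp,
      pairing_congr hu hG.memLp_image.coeFn_toLp] at h1
    have := hF.isStrong.tendsto_wronsk hG.isStrong hF.memLp hF.memLp_image hG.memLp hG.memLp_image
    rwa [h1, sub_self, neg_zero] at this
  · intro h
    refine mem_Lmin_domain_iff_pairing.mpr ⟨_, hmem, fun q hq => ?_⟩
    obtain ⟨G, G₁, hq1, hG⟩ := exists_isMax hq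
    have := hF.isStrong.tendsto_wronsk hG.isStrong hF.memLp hF.memLp_image hG.memLp hG.memLp_image
    have h0 := tendsto_nhds_unique this (h G G₁ _ hG)
    rw [pairing_congr hw hq1, pairing_congr hu (EventuallyEq.refl _ _)]
    exact sub_eq_zero.mp (neg_eq_zero.mp h0)

/-! ### Pairs of homogeneous solutions and the boundary data -/

lemma exists_cutoff {c : ℝ} (hc : 0 < c) : ∃ ζ : ℝ → ℂ, ContDiff ℝ ∞ ζ ∧ HasCompactSupport ζ ∧
    (∀ x, |x| ≤ c / 3 → ζ x = 1) ∧ ∀ x, 2 * c / 3 ≤ |x| → ζ x = 0 := by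
  let f : ContDiffBump (0 : ℝ) := ⟨c / 3, 2 * c / 3, by linarith, by linarith⟩
  refine ⟨fun x => (f x : ℂ), Complex.ofRealCLM.contDiff.comp f.contDiff,
    f.hasCompactSupport.comp_left (g := fun t : ℝ => (t : ℂ)) (by simp), fun x hx => ?_,
    fun x hx => ?_⟩
  · change ((f x : ℝ) : ℂ) = 1
    rw [f.one_of_mem_closedBall (by simpa using hx), Complex.ofReal_one]
  · change ((f x : ℝ) : ℂ) = 0
    rw [f.zero_of_le_dist (by simpa using hx), Complex.ofReal_zero]

lemma memLp_of_eq_zero {s t : Set ℝ} {f : ℝ → ℂ} (hs : MeasurableSet s) (ht : MeasurableSet t)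
    (hf : MemLp f 2 (volume.restrict t)) (h0 : ∀ x ∈ s, x ∉ t → f x = 0) :
    MemLp f 2 (volume.restrict s) := by
  have h1 : MemLp (t.indicator f) 2 (volume.restrict s) :=
    ((memLp_indicator_iff_restrict ht).mpr hf).mono_measure Measure.restrict_le_self
  refine (memLp_congr_ae ?_).mp h1
  refine (ae_restrict_iff' hs).mpr (Eventually.of_forall fun x hx => ?_)
  by_cases hxt : x ∈ t
  · rw [indicator_of_mem hxt]
  · rw [indicator_of_notMem hxt, h0 x hx hxt]

lemma memLp_of_continuousOn_Icc {a b : ℝ} {f : ℝ → ℂ} (hf : ContinuousOn f (Icc a b)) :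
    MemLp f 2 (volume.restrict (Icc a b)) := by
  obtain ⟨C, hC⟩ := isCompact_Icc.exists_bound_of_continuousOn hf
  exact MemLp.of_bound (hf.aestronglyMeasurable measurableSet_Icc) C
    ((ae_restrict_iff' measurableSet_Icc).mpr (Eventually.of_forall hC))

/-- Multiplication by a smooth function vanishing far out extends a strong solution on `]0, c[` to
the half-line. -/
lemma IsStrong.mul_cutoff {β α : ℂ} {c d : ℝ} {F F₁ w ζ : ℝ → ℂ}
    (hF : IsStrong β α (Ioo 0 c) F F₁ w) (hζ : ContDiff ℝ ∞ ζ) (hd : 0 < d) (hdc : d < c)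
    (hζ0 : ∀ x, d ≤ x → ζ x = 0) :
    IsStrong β α (Ioi 0) (fun x => F x * ζ x) (fun x => F₁ x * ζ x + F x * deriv ζ x)
      (fun x => w x * ζ x - 2 * F₁ x * deriv ζ x - F x * deriv (deriv ζ) x) := by
  have hζd : ∀ x, HasDerivAt ζ (deriv ζ x) x := fun x =>
    ((hζ.differentiable (by simp)) x).hasDerivAt
  have hζ1 : ContDiff ℝ ∞ (deriv ζ) := ((contDiff_infty_iff_deriv).mp hζ).2
  have hζdd : ∀ x, HasDerivAt (deriv ζ) (deriv (deriv ζ) x) x := fun x =>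
    ((hζ1.differentiable (by simp)) x).hasDerivAt
  have hζ2 : ContDiff ℝ ∞ (deriv (deriv ζ)) := ((contDiff_infty_iff_deriv).mp hζ1).2
  have hev : ∀ x, d < x → ζ =ᶠ[𝓝 x] 0 := fun x hx => by
    filter_upwards [Ioi_mem_nhds hx] with y hy using hζ0 y (le_of_lt hy)
  have hz1 : ∀ x, d < x → deriv ζ x = 0 := fun x hx => by
    rw [(hev x hx).deriv_eq]; simp
  have hz2 : ∀ x, d < x → deriv (deriv ζ) x = 0 := fun x hx => by
    have : deriv ζ =ᶠ[𝓝 x] 0 := by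
      filter_upwards [Ioi_mem_nhds hx] with y hy using hz1 y hy
    rw [this.deriv_eq]; simp
  constructor
  · intro x hx
    rcases lt_or_ge x c with hxc | hxc
    · exact (hF.hasDerivAt x ⟨hx, hxc⟩).mul (hζd x)
    · have hdx : d < x := hdc.trans_le hxc
      have h0 : (fun x => F x * ζ x) =ᶠ[𝓝 x] fun _ => 0 := by
        filter_upwards [hev x hdx] with y hy
        rw [hy]; simp
      refine ((hasDerivAt_const x (0 : ℂ)).congr_of_eventuallyEq h0).congr_deriv ?_
      rw [hζ0 x hdx.le, hz1 x hdx]; ring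
  · have p1 : IsPrimitiveOn (Ioo 0 c) ζ (deriv ζ) :=
      IsPrimitiveOn.of_hasDerivAt ordConnected_Ioo (fun x _ => hζd x) hζ1.continuous.continuousOn
    have p2 : IsPrimitiveOn (Ioo 0 c) (deriv ζ) (deriv (deriv ζ)) :=
      IsPrimitiveOn.of_hasDerivAt ordConnected_Ioo (fun x _ => hζdd x) hζ2.continuous.continuousOn
    refine IsPrimitiveOn.glue hd hdc ?_ ?_
    · refine ((hF.prim.mul p1 ordConnected_Ioo).add
        ((hF.isPrimitiveOn ordConnected_Ioo isOpen_Ioo).mul p2 ordConnected_Ioo)).congr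
        ordConnected_Ioo (fun _ _ => rfl) fun x _ => ?_
      ring
    · have p0 : IsPrimitiveOn (Ioi d) (fun _ => 0) (fun _ => 0) :=
        IsPrimitiveOn.of_hasDerivAt ordConnected_Ioi (fun x _ => hasDerivAt_const x 0)
          continuousOn_const
      refine p0.congr ordConnected_Ioi (fun x hx => ?_) fun x hx => ?_
      · simp only [hζ0 x (le_of_lt hx), hz1 x hx]; ring
      · simp only [hζ0 x (le_of_lt hx), hz1 x hx, hz2 x hx]; ring

/-- A solution that is square integrable near `0` gives, after a cutoff, an element of the maximal
domain with the same germ at `0`. -/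
lemma IsStrong.exists_isMax_cutoff {β α : ℂ} {c : ℝ} {F F₁ w ζ : ℝ → ℂ} (hc : 0 < c)
    (hF : IsStrong β α (Ioo 0 c) F F₁ w) (hF2 : MemLp F 2 (volume.restrict (Ioo 0 c)))
    (hw2 : MemLp w 2 (volume.restrict (Ioo 0 c))) (hζ : ContDiff ℝ ∞ ζ)
    (h1 : ∀ x, |x| ≤ c / 3 → ζ x = 1) (h0 : ∀ x, 2 * c / 3 ≤ |x| → ζ x = 0) :
    ∃ G₁ k : ℝ → ℂ, IsMax β α (fun x => F x * ζ x) G₁ k ∧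
      ∀ x ∈ Ioo 0 (c / 3), F x * ζ x = F x ∧ G₁ x = F₁ x := by
  have h0' : ∀ x, 2 * c / 3 ≤ x → ζ x = 0 := fun x hx => h0 x (hx.trans (le_abs_self x))
  have hS := hF.mul_cutoff hζ (d := 2 * c / 3) (by linarith) (by linarith) h0'
  have hζc : Continuous ζ := hζ.continuous
  have hζ1 : ContDiff ℝ ∞ (deriv ζ) := ((contDiff_infty_iff_deriv).mp hζ).2
  have hζ2 : ContDiff ℝ ∞ (deriv (deriv ζ)) := ((contDiff_infty_iff_deriv).mp hζ1).2
  have hd1 : ∀ x ∈ Ioo 0 (c / 3), ∀ᶠ y in 𝓝 x, ζ y = 1 := fun x hx => by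
    filter_upwards [isOpen_Ioo.mem_nhds hx] with y hy
    exact h1 y (by rw [abs_of_pos hy.1]; exact hy.2.le)
  have hd1' : ∀ x ∈ Ioo 0 (c / 3), deriv ζ x = 0 := fun x hx => by
    rw [EventuallyEq.deriv_eq (f := fun _ => 1) (hd1 x hx)]; simp
  have hd2' : ∀ x ∈ Ioo 0 (c / 3), deriv (deriv ζ) x = 0 := fun x hx => by
    rw [EventuallyEq.deriv_eq (f := fun _ => 0)
      (by filter_upwards [isOpen_Ioo.mem_nhds hx] with y hy using hd1' y hy)]; simp
  have he0 : ∀ x, 2 * c / 3 < x → deriv ζ x = 0 := fun x hx => by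
    rw [EventuallyEq.deriv_eq (f := fun _ => 0)
      (by filter_upwards [Ioi_mem_nhds hx] with y hy using h0' y (le_of_lt hy))]; simp
  have he0' : ∀ x, 2 * c / 3 < x → deriv (deriv ζ) x = 0 := fun x hx => by
    rw [EventuallyEq.deriv_eq (f := fun _ => 0)
      (by filter_upwards [Ioi_mem_nhds hx] with y hy using he0 y hy)]; simp
  have hsub : Icc (c / 3) (2 * c / 3) ⊆ Ioo 0 c := fun x hx =>
    ⟨by linarith [hx.1], by linarith [hx.2]⟩
  obtain ⟨C, hC⟩ := (isCompact_Icc (a := (0 : ℝ)) (b := c)).exists_bound_of_continuousOn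
    hζc.continuousOn
  have hbd : ∀ f : ℝ → ℂ, MemLp f 2 (volume.restrict (Ioo 0 c)) →
      MemLp (fun x => f x * ζ x) 2 (volume.restrict (Ioi 0)) := fun f hf => by
    refine memLp_of_eq_zero (t := Ioo 0 c) measurableSet_Ioi measurableSet_Ioo ?_ ?_
    · refine hf.of_le_mul (c := C) (hf.1.mul hζc.aestronglyMeasurable) ?_
      refine (ae_restrict_iff' measurableSet_Ioo).mpr (Eventually.of_forall fun x hx => ?_)
      rw [norm_mul, mul_comm]
      exact mul_le_mul_of_nonneg_right (hC x (Ioo_subset_Icc_self hx)) (norm_nonneg _)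
    · intro x hx hxn
      rw [h0' x (by by_contra hlt; exact hxn ⟨hx, by linarith⟩), mul_zero]
  have hmid : ∀ f g : ℝ → ℂ, ContinuousOn f (Ioo 0 c) → Continuous g →
      (∀ x ∈ Ioo 0 (c / 3), g x = 0) → (∀ x, 2 * c / 3 < x → g x = 0) →
      MemLp (fun x => f x * g x) 2 (volume.restrict (Ioi 0)) := fun f g hf hg hg1 hg2 => by
    refine memLp_of_eq_zero (t := Icc (c / 3) (2 * c / 3)) measurableSet_Ioi measurableSet_Icc
      (memLp_of_continuousOn_Icc ((hf.mono hsub).mul hg.continuousOn)) fun x hx hxn => ?_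
    rcases lt_or_ge x (c / 3) with h | h
    · rw [hg1 x ⟨hx, h⟩, mul_zero]
    · rw [hg2 x (by by_contra hlt; exact hxn ⟨h, by linarith⟩), mul_zero]
  refine ⟨_, _, ⟨hS, hbd F hF2, ?_⟩, fun x hx => ?_⟩
  · exact ((hbd w hw2).sub (hmid (fun x => 2 * F₁ x) (deriv ζ)
      (continuousOn_const.mul (hF.continuousOn_deriv ordConnected_Ioo isOpen_Ioo))
      hζ1.continuous hd1' he0)).sub (hmid F _ hF.continuousOn hζ2.continuous hd2' he0')
  · simp [h1 x (by rw [abs_of_pos hx.1]; exact hx.2.le), hd1' x hx]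

lemma IsStrong.linearCombination {β α : ℂ} {s : Set ℝ} {F F₁ G G₁ : ℝ → ℂ}
    (hF : IsStrong β α s F F₁ 0) (hG : IsStrong β α s G G₁ 0) (hs : s.OrdConnected) (a b : ℂ) :
    IsStrong β α s (fun x => a * F x + b * G x) (fun x => a * F₁ x + b * G₁ x) 0 := by
  have h := (hF.const_mul a hs).add (hG.const_mul b hs) hs
  exact ⟨h.hasDerivAt, h.prim.congr hs (fun _ _ => rfl) fun x _ => by simp⟩

/-- Two solutions of `L u = 0` on `]0, c[` with Wronskian `1`. -/
structure SolutionPair (β α : ℂ) (c : ℝ) (u u₁ v v₁ : ℝ → ℂ) : Prop where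
  pos : 0 < c
  left : IsStrong β α (Ioo 0 c) u u₁ 0
  right : IsStrong β α (Ioo 0 c) v v₁ 0
  wronsk_eq_one : ∀ x ∈ Ioo 0 c, wronsk u u₁ v v₁ x = 1

namespace SolutionPair

variable {β α : ℂ} {c : ℝ} {u u₁ v v₁ F F₁ w G G₁ h : ℝ → ℂ}

/-- Variation of constants: the coordinates of `F` in the basis `u`, `v`. -/
lemma eq_add (hp : SolutionPair β α c u u₁ v v₁) {x : ℝ} (hx : x ∈ Ioo 0 c) :
    F x = wronsk F F₁ v v₁ x * u x + wronsk u u₁ F F₁ x * v x := by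
  have := hp.wronsk_eq_one x hx
  simp only [wronsk] at this ⊢
  linear_combination -F x * this

lemma deriv_eq_add (hp : SolutionPair β α c u u₁ v v₁) {x : ℝ} (hx : x ∈ Ioo 0 c) :
    F₁ x = wronsk F F₁ v v₁ x * u₁ x + wronsk u u₁ F F₁ x * v₁ x := by
  have := hp.wronsk_eq_one x hx
  simp only [wronsk] at this ⊢
  linear_combination -F₁ x * this

/-- The Wronskian of two functions is the determinant of their coordinates in `u`, `v`. -/
lemma wronsk_eq (hp : SolutionPair β α c u u₁ v v₁) {x : ℝ} (hx : x ∈ Ioo 0 c) :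
    wronsk F F₁ G G₁ x = wronsk F F₁ v v₁ x * wronsk u u₁ G G₁ x
      - wronsk u u₁ F F₁ x * wronsk G G₁ v v₁ x := by
  have := hp.wronsk_eq_one x hx
  simp only [wronsk] at this ⊢
  linear_combination -(F x * G₁ x - F₁ x * G x) * this

/-- The coordinates of a homogeneous solution in the basis `u`, `v` are constant, so it is square
integrable when `u` and `v` are. -/
lemma memLp_of_isStrong (hp : SolutionPair β α c u u₁ v v₁)
    (hu : MemLp u 2 (volume.restrict (Ioo 0 c))) (hv : MemLp v 2 (volume.restrict (Ioo 0 c)))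
    (hF : IsStrong β α (Ioo 0 c) F F₁ 0) : MemLp F 2 (volume.restrict (Ioo 0 c)) := by
  have hm : c / 2 ∈ Ioo 0 c := ⟨by linarith [hp.pos], by linarith [hp.pos]⟩
  have h1 := (hu.const_mul (wronsk F F₁ v v₁ (c / 2))).add
    (hv.const_mul (wronsk u u₁ F F₁ (c / 2)))
  refine (memLp_congr_ae ?_).mp h1
  refine (ae_restrict_iff' measurableSet_Ioo).mpr (Eventually.of_forall fun x hx => ?_)
  rw [hp.eq_add (F := F) (F₁ := F₁) hx,
    hF.wronsk_eq hp.right ordConnected_Ioo isOpen_Ioo hx hm,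
    hp.left.wronsk_eq hF ordConnected_Ioo isOpen_Ioo hx hm]
  rfl

/-- The coordinate of `F` along `v` has a boundary value at `0` if `u` is square integrable. -/
lemma exists_tendsto_left (hp : SolutionPair β α c u u₁ v v₁)
    (hu : MemLp u 2 (volume.restrict (Ioo 0 c))) (hF : IsMax β α F F₁ w) :
    ∃ B₀, Tendsto (wronsk u u₁ F F₁) (𝓝[>] 0) (𝓝 B₀) ∧
      ∀ x ∈ Ioo 0 c, wronsk u u₁ F F₁ x = B₀ - ∫ t in Ioc 0 x, u t * w t := by
  have hw := memLp_mono hF.memLp_image (t := Ioo 0 c) Ioo_subset_Ioi_self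
  have h1 := hp.left.isPrimitiveOn_wronsk (hF.isStrong.mono Ioo_subset_Ioi_self) ordConnected_Ioo
    isOpen_Ioo
  have h2 : IsPrimitiveOn (Ioo 0 c) (wronsk u u₁ F F₁) (fun x => -(u x * w x)) :=
    h1.congr ordConnected_Ioo (fun _ _ => rfl) fun x _ => by simp
  simpa only [integral_neg, ← sub_eq_add_neg] using
    h2.exists_tendsto hp.pos (integrableOn_mul_of_memLp hu hw).neg

/-- The coordinate of `F` along `u` has a boundary value at `0` if `v` is square integrable. -/
lemma exists_tendsto_right (hp : SolutionPair β α c u u₁ v v₁)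
    (hv : MemLp v 2 (volume.restrict (Ioo 0 c))) (hF : IsMax β α F F₁ w) :
    ∃ A₀, Tendsto (wronsk F F₁ v v₁) (𝓝[>] 0) (𝓝 A₀) ∧
      ∀ x ∈ Ioo 0 c, wronsk F F₁ v v₁ x = A₀ + ∫ t in Ioc 0 x, w t * v t := by
  have hw := memLp_mono hF.memLp_image (t := Ioo 0 c) Ioo_subset_Ioi_self
  have h1 := (hF.isStrong.mono Ioo_subset_Ioi_self).isPrimitiveOn_wronsk hp.right ordConnected_Ioo
    isOpen_Ioo
  have h2 : IsPrimitiveOn (Ioo 0 c) (wronsk F F₁ v v₁) (fun x => w x * v x) :=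
    h1.congr ordConnected_Ioo (fun _ _ => rfl) fun x _ => by simp
  exact h2.exists_tendsto hp.pos (integrableOn_mul_of_memLp hw hv)

lemma exists_isMax_left (hp : SolutionPair β α c u u₁ v v₁)
    (hu : MemLp u 2 (volume.restrict (Ioo 0 c))) :
    ∃ G G₁ k, IsMax β α G G₁ k ∧ ∀ x ∈ Ioo 0 (c / 3), G x = u x ∧ G₁ x = u₁ x := by
  obtain ⟨ζ, hζ, -, h1, h0⟩ := exists_cutoff hp.pos
  obtain ⟨G₁, k, hG, hx⟩ := hp.left.exists_isMax_cutoff hp.pos hu MemLp.zero hζ h1 h0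
  exact ⟨_, G₁, k, hG, hx⟩

/-- Exchanging the two solutions costs a sign. -/
lemma symm (hp : SolutionPair β α c u u₁ v v₁) :
    SolutionPair β α c v v₁ (fun x => (-1) * u x) (fun x => (-1) * u₁ x) where
  pos := hp.pos
  left := hp.right
  right := by simpa using hp.left.linearCombination hp.left ordConnected_Ioo (-1) 0
  wronsk_eq_one x hx := by
    have := hp.wronsk_eq_one x hx
    simp only [wronsk] at this ⊢
    linear_combination this

lemma exists_isMax_right (hp : SolutionPair β α c u u₁ v v₁)
    (hv : MemLp v 2 (volume.restrict (Ioo 0 c))) :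
    ∃ G G₁ k, IsMax β α G G₁ k ∧ ∀ x ∈ Ioo 0 (c / 3), G x = v x ∧ G₁ x = v₁ x :=
  hp.symm.exists_isMax_left hv

/-- If all solutions are square integrable near `0`, the minimal domain is cut out by the vanishing
of the two boundary values. -/
lemma mem_Lmin_domain_iff (hp : SolutionPair β α c u u₁ v v₁)
    (hu : MemLp u 2 (volume.restrict (Ioo 0 c))) (hv : MemLp v 2 (volume.restrict (Ioo 0 c)))
    (hF : IsMax β α F F₁ w) {f : L2Pos} (hf : Represents F f) :
    f ∈ (Lmin β α).domain ↔ Tendsto (wronsk F F₁ v v₁) (𝓝[>] 0) (𝓝 0) ∧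
      Tendsto (wronsk u u₁ F F₁) (𝓝[>] 0) (𝓝 0) := by
  have hc3 : 0 < c / 3 := by linarith [hp.pos]
  rw [hF.mem_Lmin_domain_iff hf]
  constructor
  · intro hall
    constructor
    · obtain ⟨G, G₁, k, hG, he⟩ := hp.exists_isMax_right hv
      refine (hall G G₁ k hG).congr' ?_
      filter_upwards [Ioo_mem_nhdsGT hc3] with x hx
      simp only [wronsk, (he x hx).1, (he x hx).2]
    · obtain ⟨G, G₁, k, hG, he⟩ := hp.exists_isMax_left hu
      have h1 := (hall G G₁ k hG).neg
      rw [neg_zero] at h1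
      refine h1.congr' ?_
      filter_upwards [Ioo_mem_nhdsGT hc3] with x hx
      simp only [wronsk, (he x hx).1, (he x hx).2]; ring
  · rintro ⟨hA, hB⟩ G G₁ k hG
    obtain ⟨B, hB', -⟩ := hp.exists_tendsto_left hu hG
    obtain ⟨A, hA', -⟩ := hp.exists_tendsto_right hv hG
    have h1 := (hA.mul hB').sub (hB.mul hA')
    rw [zero_mul, zero_mul, sub_zero] at h1
    refine h1.congr' ?_
    filter_upwards [Ioo_mem_nhdsGT hp.pos] with x hx
    rw [hp.wronsk_eq (F := F) (F₁ := F₁) (G := G) (G₁ := G₁) hx]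

/-- Subtracting `a u + b v`, with `a` and `b` the boundary values of `f`, leaves a function with
vanishing boundary values. -/
lemma inDomainAroundZero_Lmin (hp : SolutionPair β α c u u₁ v v₁)
    (hu : MemLp u 2 (volume.restrict (Ioo 0 c))) (hv : MemLp v 2 (volume.restrict (Ioo 0 c)))
    {f : L2Pos} (hf : f ∈ (Lmax β α).domain) :
    ∃ a b : ℂ, InDomainAroundZero (Lmin β α) (fun x => f x - a * u x - b * v x) := by
  obtain ⟨F, F₁, w, hFf, hF⟩ := exists_isMax_of_mem_domain hf
  obtain ⟨b, hb, -⟩ := hp.exists_tendsto_left hu hF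
  obtain ⟨a, ha, -⟩ := hp.exists_tendsto_right hv hF
  refine ⟨a, b, ?_⟩
  obtain ⟨ζ, hζ, hζc, h1, h0⟩ := exists_cutoff hp.pos
  have hc3 : 0 < c / 3 := by linarith [hp.pos]
  have hS : IsStrong β α (Ioo 0 c) (fun x => F x + (-a * u x + -b * v x))
      (fun x => F₁ x + (-a * u₁ x + -b * v₁ x)) w := by
    have := (hF.isStrong.mono Ioo_subset_Ioi_self).add
      ((hp.left.const_mul (-a) ordConnected_Ioo).add
      (hp.right.const_mul (-b) ordConnected_Ioo) ordConnected_Ioo) ordConnected_Ioo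
    simpa using this
  obtain ⟨G₁, k, hG, he⟩ := hS.exists_isMax_cutoff hp.pos
    ((memLp_mono hF.memLp Ioo_subset_Ioi_self).add ((hu.const_mul (-a)).add (hv.const_mul (-b))))
    (memLp_mono hF.memLp_image Ioo_subset_Ioi_self) hζ h1 h0
  refine ⟨ζ, hζ, hζc, ?_, hG.memLp.toLp _, ?_, ?_⟩
  · filter_upwards [Metric.closedBall_mem_nhds (0 : ℝ) hc3] with x hx
    exact h1 x (by simpa using hx)
  · rw [hp.mem_Lmin_domain_iff hu hv hG hG.memLp.coeFn_toLp]
    have hmem : Ioo 0 (c / 3) ∈ 𝓝[>] (0 : ℝ) := Ioo_mem_nhdsGT hc3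
    constructor
    · have h2 := ha.sub_const a
      rw [sub_self] at h2
      refine h2.congr' ?_
      filter_upwards [hmem] with x hx
      have hw := hp.wronsk_eq_one x ⟨hx.1, by linarith [hx.2, hp.pos]⟩
      simp only [wronsk] at hw ⊢
      rw [(he x hx).1, (he x hx).2]
      linear_combination a * hw
    · have h2 := hb.sub_const b
      rw [sub_self] at h2
      refine h2.congr' ?_
      filter_upwards [hmem] with x hx
      have hw := hp.wronsk_eq_one x ⟨hx.1, by linarith [hx.2, hp.pos]⟩
      simp only [wronsk] at hw ⊢
      rw [(he x hx).1, (he x hx).2]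
      linear_combination b * hw
  · refine hG.memLp.coeFn_toLp.trans ?_
    filter_upwards [hFf] with x hx
    rw [hx]; ring

lemma inDomainAroundZero_Lmax (hp : SolutionPair β α c u u₁ v v₁)
    (hu : MemLp u 2 (volume.restrict (Ioo 0 c))) (hv : MemLp v 2 (volume.restrict (Ioo 0 c)))
    (a b : ℂ) : InDomainAroundZero (Lmax β α) (fun x => a * u x + b * v x) := by
  obtain ⟨ζ, hζ, hζc, h1, h0⟩ := exists_cutoff hp.pos
  have hc3 : 0 < c / 3 := by linarith [hp.pos]
  have hS : IsStrong β α (Ioo 0 c) (fun x => a * u x + b * v x)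
      (fun x => a * u₁ x + b * v₁ x) 0 := hp.left.linearCombination hp.right ordConnected_Ioo a b
  obtain ⟨G₁, k, hG, -⟩ := hS.exists_isMax_cutoff hp.pos
    ((hu.const_mul a).add (hv.const_mul b)) MemLp.zero hζ h1 h0
  refine ⟨ζ, hζ, hζc, ?_, hG.memLp.toLp _, hG.mem_domain hG.memLp.coeFn_toLp,
    hG.memLp.coeFn_toLp⟩
  filter_upwards [Metric.closedBall_mem_nhds (0 : ℝ) hc3] with x hx
  exact h1 x (by simpa using hx)

end SolutionPair

/-- The boundary functional `f ↦ ∫ f h - ∫ (L f) g` on the maximal domain. For `(g, h)` in the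
maximal graph it is the limit at `0` of the Wronskian of `f` and `g`. -/
noncomputable def boundaryFunctional (β α : ℂ) (q : L2Pos × L2Pos) :
    (Lmax β α).domain →ₗ[ℂ] ℂ where
  toFun f := pairing f q.2 - pairing (Lmax β α f) q.1
  map_add' f g := by
    rw [LinearPMap.map_add, Submodule.coe_add, pairing_add_left, pairing_add_left]; ring
  map_smul' a f := by
    rw [LinearPMap.map_smul, Submodule.coe_smul, pairing_smul_left, pairing_smul_left]
    simp only [RingHom.id_apply, smul_eq_mul]; ring

lemma mk_Lmax_mem_maxGraph {β α : ℂ} (f : (Lmax β α).domain) :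
    ((f : L2Pos), Lmax β α f) ∈ maxGraph β α := by
  rw [← Lmax_graph]; exact LinearPMap.mem_graph _ f

lemma IsMax.tendsto_boundaryFunctional {β α : ℂ} {F F₁ w G G₁ k : ℝ → ℂ}
    (hF : IsMax β α F F₁ w) (hG : IsMax β α G G₁ k) {f : (Lmax β α).domain}
    (hf : Represents F f) :
    Tendsto (wronsk F F₁ G G₁) (𝓝[>] 0)
      (𝓝 (boundaryFunctional β α (hG.memLp.toLp G, hG.memLp_image.toLp k) f)) := by
  have h1 := hF.isStrong.tendsto_wronsk hG.isStrong hF.memLp hF.memLp_image hG.memLp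
    hG.memLp_image
  have hw : Lmax β α f = hF.memLp_image.toLp w := by
    have := maxGraph_univalent β α
      (((f : L2Pos), Lmax β α f) - ((f : L2Pos), hF.memLp_image.toLp w))
      (Submodule.sub_mem _ (mk_Lmax_mem_maxGraph f)
        (hF.isStrong.hasDistribImage hf hF.memLp_image.coeFn_toLp)) (by simp)
    simpa [sub_eq_zero] using this
  convert h1 using 2
  change pairing f _ - pairing (Lmax β α f) _ = _
  rw [hw, pairing_congr hf hG.memLp_image.coeFn_toLp,
    pairing_congr hF.memLp_image.coeFn_toLp hG.memLp.coeFn_toLp]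
  ring

/-- If all solutions are square integrable near `0`, the two boundary values identify the quotient
of the maximal by the minimal domain with `ℂ²`. -/
lemma SolutionPair.finrank_quotient {β α : ℂ} {c : ℝ} {u u₁ v v₁ : ℝ → ℂ}
    (hp : SolutionPair β α c u u₁ v v₁) (hu : MemLp u 2 (volume.restrict (Ioo 0 c)))
    (hv : MemLp v 2 (volume.restrict (Ioo 0 c))) :
    Module.finrank ℂ ((Lmax β α).domain ⧸
      (Lmin β α).domain.submoduleOf (Lmax β α).domain) = 2 := by
  obtain ⟨U, U₁, hU, hUmax, hUe⟩ := hp.exists_isMax_left hu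
  obtain ⟨V, V₁, hV, hVmax, hVe⟩ := hp.exists_isMax_right hv
  have hmem : Ioo 0 (c / 3) ∈ 𝓝[>] (0 : ℝ) := Ioo_mem_nhdsGT (by linarith [hp.pos])
  set ΛU := boundaryFunctional β α (hUmax.memLp.toLp U, hUmax.memLp_image.toLp hU)
  set ΛV := boundaryFunctional β α (hVmax.memLp.toLp V, hVmax.memLp_image.toLp hV)
  set Φ : (Lmax β α).domain →ₗ[ℂ] ℂ × ℂ := ΛV.prod (-ΛU) with hΦ
  -- `Φ` sends an element of the maximal domain to its two boundary values
  have hval : ∀ {F F₁ w : ℝ → ℂ} (hF : IsMax β α F F₁ w) {f : (Lmax β α).domain},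
      Represents F f → Tendsto (wronsk F F₁ v v₁) (𝓝[>] 0) (𝓝 (ΛV f)) ∧
        Tendsto (wronsk u u₁ F F₁) (𝓝[>] 0) (𝓝 (-ΛU f)) := by
    intro F F₁ w hF f hf
    constructor
    · refine (hF.tendsto_boundaryFunctional hVmax hf).congr' ?_
      filter_upwards [hmem] with x hx
      simp only [wronsk, (hVe x hx).1, (hVe x hx).2]
    · refine (hF.tendsto_boundaryFunctional hUmax hf).neg.congr' ?_
      filter_upwards [hmem] with x hx
      simp only [wronsk, (hUe x hx).1, (hUe x hx).2]; ring
  have hker : (Lmin β α).domain.submoduleOf (Lmax β α).domain = LinearMap.ker Φ := by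
    ext f
    obtain ⟨F, F₁, w, hFf, hF⟩ := exists_isMax_of_mem_domain f.2
    obtain ⟨h1, h2⟩ := hval hF hFf
    change (f : L2Pos) ∈ (Lmin β α).domain ↔ _
    rw [hp.mem_Lmin_domain_iff hu hv hF hFf, LinearMap.mem_ker]
    change _ ↔ (ΛV f, -ΛU f) = (0 : ℂ × ℂ)
    rw [Prod.mk_eq_zero]
    constructor
    · rintro ⟨a, b⟩
      exact ⟨tendsto_nhds_unique h1 a, tendsto_nhds_unique h2 b⟩
    · rintro ⟨a, b⟩
      rw [a] at h1; rw [b] at h2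
      exact ⟨h1, h2⟩
  have hone : ∀ x ∈ Ioo 0 (c / 3), u x * v₁ x - u₁ x * v x = 1 := fun x hx =>
    hp.wronsk_eq_one x ⟨hx.1, by linarith [hx.2, hp.pos]⟩
  have hsurj : Function.Surjective Φ := by
    rintro ⟨a, b⟩
    set fU : (Lmax β α).domain := ⟨hUmax.memLp.toLp U, hUmax.mem_domain hUmax.memLp.coeFn_toLp⟩
    set fV : (Lmax β α).domain := ⟨hVmax.memLp.toLp V, hVmax.mem_domain hVmax.memLp.coeFn_toLp⟩
    have eU : Φ fU = (1, 0) := by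
      obtain ⟨h1, h2⟩ := hval hUmax (f := fU) hUmax.memLp.coeFn_toLp
      refine Prod.ext (tendsto_nhds_unique h1 ?_) (tendsto_nhds_unique h2 ?_)
      · refine tendsto_const_nhds.congr' ?_
        filter_upwards [hmem] with x hx
        simp only [wronsk, (hUe x hx).1, (hUe x hx).2, hone x hx]
      · refine tendsto_const_nhds.congr' ?_
        filter_upwards [hmem] with x hx
        simp only [wronsk, (hUe x hx).1, (hUe x hx).2]; ring
    have eV : Φ fV = (0, 1) := by
      obtain ⟨h1, h2⟩ := hval hVmax (f := fV) hVmax.memLp.coeFn_toLp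
      refine Prod.ext (tendsto_nhds_unique h1 ?_) (tendsto_nhds_unique h2 ?_)
      · refine tendsto_const_nhds.congr' ?_
        filter_upwards [hmem] with x hx
        simp only [wronsk, (hVe x hx).1, (hVe x hx).2]; ring
      · refine tendsto_const_nhds.congr' ?_
        filter_upwards [hmem] with x hx
        simp only [wronsk, (hVe x hx).1, (hVe x hx).2, hone x hx]
    exact ⟨a • fU + b • fV, by rw [map_add, map_smul, map_smul, eU, eV]; simp⟩
  rw [hker, (Φ.quotKerEquivOfSurjective hsurj).finrank_eq]
  simp

/-! ### Norm estimates near zero -/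

lemma l2norm_mono {s t : Set ℝ} {f : ℝ → ℂ} (hf : MemLp f 2 (volume.restrict t)) (h : s ⊆ t) :
    l2norm s f ≤ l2norm t f :=
  Real.rpow_le_rpow (integral_nonneg fun _ => by positivity)
    (setIntegral_mono_set (integrableOn_norm_sq hf) (Eventually.of_forall fun _ => by positivity)
      (Eventually.of_forall h)) (by norm_num)

lemma l2norm_le_of_norm_le {s : Set ℝ} (hs : MeasurableSet s) {f : ℝ → ℂ} {g : ℝ → ℝ} {K : ℝ}
    (hfg : ∀ x ∈ s, ‖f x‖ ^ 2 ≤ g x) (hg : IntegrableOn g s) (hK : ∫ x in s, g x ≤ K) :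
    l2norm s f ≤ K ^ (1 / 2 : ℝ) := by
  refine Real.rpow_le_rpow (integral_nonneg fun _ => by positivity) (le_trans ?_ hK) (by norm_num)
  exact integral_mono_of_nonneg (Eventually.of_forall fun _ => by positivity) hg
    ((ae_restrict_iff' hs).mpr (Eventually.of_forall hfg))

lemma tendsto_l2norm_Ioc {w : ℝ → ℂ} {c : ℝ} (hc : 0 < c)
    (hw : MemLp w 2 (volume.restrict (Ioo 0 c))) :
    Tendsto (fun x => l2norm (Ioc 0 x) w) (𝓝[>] 0) (𝓝 0) := by
  have hi := integrableOn_norm_sq hw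
  have hcont : Tendsto (fun x => ∫ t in (0 : ℝ)..x, ‖w t‖ ^ 2) (𝓝[>] 0) (𝓝 0) := by
    have h3 := intervalIntegral.continuousOn_primitive_interval (a := 0) (b := c)
      (f := fun t => ‖w t‖ ^ 2) (μ := volume) (by
        rw [uIcc_of_le hc.le, integrableOn_Icc_iff_integrableOn_Ioo]
        exact hi)
    have h4 := h3 0 left_mem_uIcc
    rw [uIcc_of_le hc.le] at h4
    have h5 : 𝓝[>] (0 : ℝ) ≤ 𝓝[Icc 0 c] 0 :=
      nhdsWithin_le_of_mem (mem_of_superset (Ioo_mem_nhdsGT hc) Ioo_subset_Icc_self)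
    simpa [ContinuousWithinAt] using h4.mono_left h5
  have h1 := hcont.rpow_const (p := 1 / 2) (Or.inr (by norm_num))
  rw [Real.zero_rpow (by norm_num)] at h1
  refine h1.congr' ?_
  filter_upwards [self_mem_nhdsWithin] with x hx
  rw [l2norm, intervalIntegral.integral_of_le (le_of_lt hx)]

lemma integrableOn_rpow_Ioc {p x : ℝ} (hp : -1 < p) : IntegrableOn (fun t => t ^ p) (Ioc 0 x) := by
  rcases le_or_gt x 0 with hx | hx
  · simp [Ioc_eq_empty_of_le hx]
  · exact (intervalIntegrable_iff_integrableOn_Ioc_of_le hx.le).mp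
      (intervalIntegral.intervalIntegrable_rpow' hp)

lemma sq_mul_rpow {C p t : ℝ} (ht : 0 < t) : (C * t ^ p) ^ 2 = C ^ 2 * t ^ (2 * p) := by
  rw [mul_pow, ← Real.rpow_natCast (t ^ p), ← Real.rpow_mul ht.le]
  congr 2; push_cast; ring

lemma memLp_of_norm_le_rpow {f : ℝ → ℂ} {c C p : ℝ} (hp : -1 / 2 < p)
    (hf : ContinuousOn f (Ioo 0 c)) (h : ∀ x ∈ Ioo 0 c, ‖f x‖ ≤ C * x ^ p) :
    MemLp f 2 (volume.restrict (Ioo 0 c)) := by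
  have hm := hf.aestronglyMeasurable (μ := volume) measurableSet_Ioo
  rw [memLp_two_iff_integrable_sq_norm hm]
  have hi : IntegrableOn (fun t => C ^ 2 * t ^ (2 * p)) (Ioo 0 c) :=
    ((integrableOn_rpow_Ioc (by linarith)).mono_set Ioo_subset_Ioc_self).const_mul _
  refine Integrable.mono' hi (hm.norm.pow 2) ?_
  refine (ae_restrict_iff' measurableSet_Ioo).mpr (Eventually.of_forall fun x hx => ?_)
  rw [Real.norm_of_nonneg (by positivity), ← sq_mul_rpow hx.1]
  exact pow_le_pow_left₀ (norm_nonneg _) (h x hx) 2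

lemma l2norm_Ioc_le_rpow {f : ℝ → ℂ} {C p x : ℝ} (hp : -1 / 2 < p) (hx : 0 < x)
    (h : ∀ t ∈ Ioc 0 x, ‖f t‖ ≤ C * t ^ p) :
    l2norm (Ioc 0 x) f ≤ (C ^ 2 / (2 * p + 1)) ^ (1 / 2 : ℝ) * x ^ (p + 1 / 2) := by
  have hp' : 0 < 2 * p + 1 := by linarith
  have hi : IntegrableOn (fun t => C ^ 2 * t ^ (2 * p)) (Ioc 0 x) :=
    (integrableOn_rpow_Ioc (by linarith)).const_mul _
  have h1 := l2norm_le_of_norm_le (K := C ^ 2 / (2 * p + 1) * x ^ (2 * p + 1)) measurableSet_Ioc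
    (fun t ht => by
      rw [← sq_mul_rpow ht.1]
      exact pow_le_pow_left₀ (norm_nonneg _) (h t ht) 2) hi (by
    rw [integral_const_mul, ← intervalIntegral.integral_of_le hx.le,
      integral_rpow (Or.inl (by linarith)), Real.zero_rpow (by linarith)]
    exact le_of_eq (by ring))
  refine h1.trans (le_of_eq ?_)
  rw [Real.mul_rpow (by positivity) (by positivity), ← Real.rpow_mul hx.le]
  congr 2; ring

/-- Integrals from `0` against a square integrable function gain a factor `o(1)` over the
Cauchy-Schwarz bound. -/
lemma isLittleO_setIntegral {u w : ℝ → ℂ} {g : ℝ → ℝ} {c : ℝ} (hc : 0 < c)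
    (hu : MemLp u 2 (volume.restrict (Ioo 0 c))) (hw : MemLp w 2 (volume.restrict (Ioo 0 c)))
    (hg : (fun x => l2norm (Ioc 0 x) u) =O[𝓝[>] 0] g) :
    (fun x => ∫ t in Ioc 0 x, u t * w t) =o[𝓝[>] 0] g := by
  have h1 : (fun x => l2norm (Ioc 0 x) w) =o[𝓝[>] 0] (fun _ => (1 : ℝ)) :=
    (isLittleO_one_iff ℝ).mpr (tendsto_l2norm_Ioc hc hw)
  have h2 := hg.mul_isLittleO h1
  simp only [mul_one] at h2
  refine IsBigO.trans_isLittleO (IsBigO.of_bound 1 ?_) h2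
  filter_upwards [Ioo_mem_nhdsGT hc] with x hx
  have hsub : Ioc 0 x ⊆ Ioo 0 c := fun t ht => ⟨ht.1, ht.2.trans_lt hx.2⟩
  rw [one_mul, Real.norm_of_nonneg (mul_nonneg (l2norm_nonneg _ _) (l2norm_nonneg _ _))]
  exact norm_setIntegral_mul_le (memLp_mono hu hsub) (memLp_mono hw hsub)

/-- A primitive of `w v` with `w` square integrable and `v` possibly not: it is negligible against
any gauge tending to infinity that dominates the tail norms of `v`. -/
lemma IsPrimitiveOn.isLittleO_gauge {v w A : ℝ → ℂ} {a : ℝ → ℝ} {c C : ℝ} (hc : 0 < c)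
    (hA : IsPrimitiveOn (Ioo 0 c) A (fun x => w x * v x)) (hv : ContinuousOn v (Ioo 0 c))
    (hw : MemLp w 2 (volume.restrict (Ioo 0 c))) (ha : Tendsto a (𝓝[>] 0) atTop)
    (hva : ∀ x ∈ Ioo 0 c, ∀ δ ∈ Ioo 0 c, x < δ → l2norm (Ioc x δ) v ≤ C * a x) :
    A =o[𝓝[>] 0] a := by
  refine isLittleO_iff.mpr fun ε hε => ?_
  have hC : 0 < |C| + 1 := by positivity
  have hsmall : ∀ᶠ δ in 𝓝[>] (0 : ℝ), l2norm (Ioc 0 δ) w < ε / 2 / (|C| + 1) :=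
    (tendsto_l2norm_Ioc hc hw).eventually_lt_const (by positivity)
  obtain ⟨δ, hδw, hδ⟩ := (hsmall.and (Ioo_mem_nhdsGT hc)).exists
  have hbig : ∀ᶠ x in 𝓝[>] (0 : ℝ), ‖A δ‖ / (ε / 2) ≤ a x := ha.eventually_ge_atTop _
  have hpos : ∀ᶠ x in 𝓝[>] (0 : ℝ), 0 ≤ a x := ha.eventually_ge_atTop 0
  filter_upwards [hbig, hpos, Ioo_mem_nhdsGT hδ.1] with x hxa hx0 hx
  have hxc : x ∈ Ioo 0 c := ⟨hx.1, hx.2.trans hδ.2⟩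
  have h1 := (hA x hxc δ hδ).2
  rw [intervalIntegral.integral_of_le hx.2.le] at h1
  have hsub : Ioc x δ ⊆ Icc x δ := Ioc_subset_Icc_self
  have hv2 : MemLp v 2 (volume.restrict (Ioc x δ)) :=
    memLp_mono (memLp_of_continuousOn_Icc (hv.mono fun t ht =>
      ⟨hx.1.trans_le ht.1, ht.2.trans_lt hδ.2⟩)) hsub
  have hw2 : MemLp w 2 (volume.restrict (Ioc 0 δ)) :=
    memLp_mono hw fun t ht => ⟨ht.1, ht.2.trans_lt hδ.2⟩
  have hss : Ioc x δ ⊆ Ioc 0 δ := Ioc_subset_Ioc_left hx.1.le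
  have h2 := norm_setIntegral_mul_le (memLp_mono hw2 hss) hv2
  have h3 : l2norm (Ioc x δ) w * l2norm (Ioc x δ) v ≤ ε / 2 / (|C| + 1) * ((|C| + 1) * a x) := by
    refine mul_le_mul ((l2norm_mono hw2 hss).trans hδw.le) ?_ (l2norm_nonneg _ _) (by positivity)
    refine (hva x hxc δ hδ hx.2).trans (mul_le_mul_of_nonneg_right ?_ hx0)
    linarith [le_abs_self C]
  have h4 : ε / 2 / (|C| + 1) * ((|C| + 1) * a x) = ε / 2 * a x := by field_simp
  have h5 : ‖A δ‖ ≤ ε / 2 * a x := by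
    rw [div_le_iff₀ (by positivity)] at hxa; linarith
  have h6 : A x = A δ - ∫ t in Ioc x δ, w t * v t := by rw [h1]; ring
  rw [h6, Real.norm_of_nonneg hx0]
  refine (norm_sub_le _ _).trans ?_
  linarith

/-- A first-order zero of the weight `(t - x)(2x - t)` at both ends of `[x, 2x]` turns the
integral of the Wronskian into one that involves no derivative of `F`. -/
lemma integral_weight_mul_wronsk {β α : ℂ} {c : ℝ} {u u₁ F F₁ h w : ℝ → ℂ}
    (hu : IsStrong β α (Ioo 0 c) u u₁ h) (hF : IsStrong β α (Ioo 0 c) F F₁ w) {x : ℝ} (hx : 0 < x)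
    (hxc : 2 * x < c) :
    ∫ t in x..(2 * x), (((t - x) * (2 * x - t) : ℝ) : ℂ) * wronsk u u₁ F F₁ t =
      -∫ t in x..(2 * x), (((3 * x - 2 * t : ℝ) : ℂ) * u t
        + 2 * (((t - x) * (2 * x - t) : ℝ) : ℂ) * u₁ t) * F t := by
  have hsub : uIcc x (2 * x) ⊆ Ioo 0 c := by
    rw [uIcc_of_le (by linarith)]
    exact fun t ht => ⟨hx.trans_le ht.1, ht.2.trans_lt hxc⟩
  have cu := hu.continuousOn.mono hsub
  have cu₁ := (hu.continuousOn_deriv ordConnected_Ioo isOpen_Ioo).mono hsub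
  have cF := hF.continuousOn.mono hsub
  have cF₁ := (hF.continuousOn_deriv ordConnected_Ioo isOpen_Ioo).mono hsub
  have cφ : ContinuousOn (fun t : ℝ => (((t - x) * (2 * x - t) : ℝ) : ℂ)) (uIcc x (2 * x)) := by
    fun_prop
  have cφ' : ContinuousOn (fun t : ℝ => ((3 * x - 2 * t : ℝ) : ℂ)) (uIcc x (2 * x)) := by
    fun_prop
  have hφ : ∀ t : ℝ, HasDerivAt (fun t : ℝ => (((t - x) * (2 * x - t) : ℝ) : ℂ))
      ((3 * x - 2 * t : ℝ) : ℂ) t := fun t =>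
    ((((hasDerivAt_id t).sub_const x).mul ((hasDerivAt_id t).const_sub (2 * x))).congr_deriv
      (by simp only [id]; ring)).ofReal_comp
  have hd : ∀ t ∈ uIcc x (2 * x),
      HasDerivAt (fun t : ℝ => (((t - x) * (2 * x - t) : ℝ) : ℂ) * u t * F t)
        ((((t - x) * (2 * x - t) : ℝ) : ℂ) * wronsk u u₁ F F₁ t +
          (((3 * x - 2 * t : ℝ) : ℂ) * u t
            + 2 * (((t - x) * (2 * x - t) : ℝ) : ℂ) * u₁ t) * F t) t := fun t ht =>
    (((hφ t).mul (hu.hasDerivAt t (hsub ht))).mul (hF.hasDerivAt t (hsub ht))).congr_deriv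
      (by simp only [wronsk, Pi.mul_apply]; ring)
  have i1 : IntervalIntegrable (fun t : ℝ => (((t - x) * (2 * x - t) : ℝ) : ℂ)
      * wronsk u u₁ F F₁ t) volume x (2 * x) :=
    (cφ.mul ((cu.mul cF₁).sub (cu₁.mul cF))).intervalIntegrable
  have i2 : IntervalIntegrable (fun t : ℝ => (((3 * x - 2 * t : ℝ) : ℂ) * u t
      + 2 * (((t - x) * (2 * x - t) : ℝ) : ℂ) * u₁ t) * F t) volume x (2 * x) :=
    (((cφ'.mul cu).add ((continuousOn_const.mul cφ).mul cu₁)).mul cF).intervalIntegrable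
  have h1 := intervalIntegral.integral_eq_sub_of_hasDerivAt hd (i1.add i2)
  rw [intervalIntegral.integral_add i1 i2] at h1
  simp only [sub_self, zero_mul, mul_zero, Complex.ofReal_zero] at h1
  exact eq_neg_of_add_eq_zero_left h1

/-- If `u` vanishes at `0` to order `1/2 + μ` with `μ ≥ 1`, then the Wronskian of `u` with a square
integrable solution has no other possible limit at `0` than `0`: this is the limit point case. -/
lemma eq_zero_of_tendsto_wronsk {β α : ℂ} {c μ C : ℝ} {u u₁ F F₁ h w : ℝ → ℂ} (hc : 0 < c)
    (hμ : 1 ≤ μ) (hu : IsStrong β α (Ioo 0 c) u u₁ h) (hF : IsStrong β α (Ioo 0 c) F F₁ w)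
    (hF2 : MemLp F 2 (volume.restrict (Ioo 0 c)))
    (hbu : ∀ x ∈ Ioo 0 c, ‖u x‖ ≤ C * x ^ (1 / 2 + μ))
    (hbu₁ : ∀ x ∈ Ioo 0 c, ‖u₁ x‖ ≤ C * x ^ (-1 / 2 + μ)) {B₀ : ℂ}
    (hB : Tendsto (wronsk u u₁ F F₁) (𝓝[>] 0) (𝓝 B₀)) : B₀ = 0 := by
  have hm : c / 2 ∈ Ioo 0 c := ⟨by linarith, by linarith⟩
  have hC : 0 ≤ C := by
    have h1 := (norm_nonneg _).trans (hbu _ hm)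
    exact nonneg_of_mul_nonneg_left h1 (Real.rpow_pos_of_pos hm.1 _)
  have key : ∀ ε > 0, ‖B₀‖ / 6 ≤ ε := by
    intro ε hε
    have hl : Tendsto (fun x : ℝ => ε + 16 * C * l2norm (Ioc 0 (2 * x)) F) (𝓝[>] 0) (𝓝 ε) := by
      have h2 : Tendsto (fun x : ℝ => 2 * x) (𝓝[>] 0) (𝓝[>] 0) := by
        refine tendsto_nhdsWithin_iff.mpr ⟨?_, ?_⟩
        · have : Tendsto (fun x : ℝ => 2 * x) (𝓝 0) (𝓝 (2 * 0)) := tendsto_id.const_mul 2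
          rw [mul_zero] at this
          exact this.mono_left nhdsWithin_le_nhds
        · filter_upwards [self_mem_nhdsWithin] with x hx
          rw [mem_Ioi] at hx ⊢; linarith
      simpa using (((tendsto_l2norm_Ioc hc hF2).comp h2).const_mul (16 * C)).const_add ε
    refine ge_of_tendsto hl ?_
    have hnear := Metric.tendsto_nhds.mp hB ε hε
    rw [eventually_nhdsWithin_iff, Metric.eventually_nhds_iff] at hnear
    obtain ⟨r, hr, hnear⟩ := hnear
    have hs : 0 < min (min (r / 2) (c / 2)) (1 / 2) := by positivity
    filter_upwards [Ioo_mem_nhdsGT hs] with x hx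
    have hx0 : 0 < x := hx.1
    have hxr : 2 * x < r := by
      linarith [hx.2.trans_le ((min_le_left _ _).trans (min_le_left _ _))]
    have hxc : 2 * x < c := by
      linarith [hx.2.trans_le ((min_le_left _ _).trans (min_le_right _ _))]
    have hx1 : 2 * x ≤ 1 := by linarith [hx.2.trans_le (min_le_right _ _)]
    have hle : x ≤ 2 * x := by linarith
    have hsub : Ioc x (2 * x) ⊆ Ioo 0 c := fun t ht => ⟨hx0.trans ht.1, ht.2.trans_lt hxc⟩
    -- averaging over `[x, 2x]` with this weight avoids a pointwise bound on `F'`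
    set φ : ℝ → ℂ := fun t => (((t - x) * (2 * x - t) : ℝ) : ℂ) with hφ
    have hφn : ∀ t ∈ Ioc x (2 * x), ‖φ t‖ ≤ x ^ 2 := fun t ht => by
      rw [hφ, Complex.norm_real, Real.norm_of_nonneg
        (mul_nonneg (by linarith [ht.1]) (by linarith [ht.2]))]
      nlinarith [ht.1, ht.2]
    -- the mass of the weight
    have hmass : ∫ t in x..(2 * x), φ t = ((x ^ 3 / 6 : ℝ) : ℂ) := by
      rw [hφ, intervalIntegral.integral_ofReal]
      congr 1
      have hd : ∀ t : ℝ, HasDerivAt (fun t : ℝ => 3 * x * t ^ 2 / 2 - t ^ 3 / 3 - 2 * x ^ 2 * t)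
          ((t - x) * (2 * x - t)) t := fun t =>
        (((((hasDerivAt_pow 2 t).const_mul (3 * x)).div_const 2).sub
          ((hasDerivAt_pow 3 t).div_const 3)).sub
          ((hasDerivAt_id t).const_mul (2 * x ^ 2))).congr_deriv (by norm_num; ring)
      rw [intervalIntegral.integral_eq_sub_of_hasDerivAt (fun t _ => hd t)
        (Continuous.intervalIntegrable (by fun_prop) _ _)]
      ring
    have cW : ContinuousOn (wronsk u u₁ F F₁) (Ioo 0 c) :=
      (hu.isPrimitiveOn_wronsk hF ordConnected_Ioo isOpen_Ioo).continuousOn ordConnected_Ioo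
        isOpen_Ioo
    have hsub' : uIcc x (2 * x) ⊆ Ioo 0 c := by
      rw [uIcc_of_le hle]
      exact fun t ht => ⟨hx0.trans_le ht.1, ht.2.trans_lt hxc⟩
    have cφ : ContinuousOn φ (uIcc x (2 * x)) := by rw [hφ]; fun_prop
    have e1 : B₀ * ((x ^ 3 / 6 : ℝ) : ℂ) = (∫ t in x..(2 * x), φ t * wronsk u u₁ F F₁ t)
        - ∫ t in x..(2 * x), φ t * (wronsk u u₁ F F₁ t - B₀) := by
      have i1 : IntervalIntegrable (fun t => φ t * wronsk u u₁ F F₁ t) volume x (2 * x) :=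
        (cφ.mul (cW.mono hsub')).intervalIntegrable
      have i2 : IntervalIntegrable (fun t => φ t * (wronsk u u₁ F F₁ t - B₀)) volume x (2 * x) :=
        (cφ.mul ((cW.mono hsub').sub continuousOn_const)).intervalIntegrable
      rw [← intervalIntegral.integral_sub i1 i2, ← hmass, mul_comm,
        ← intervalIntegral.integral_mul_const]
      exact intervalIntegral.integral_congr fun t _ => by ring
    have e2 : ‖∫ t in x..(2 * x), φ t * (wronsk u u₁ F F₁ t - B₀)‖ ≤ x ^ 2 * ε * x := by
      have := intervalIntegral.norm_integral_le_of_norm_le_const (a := x) (b := 2 * x)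
        (C := x ^ 2 * ε) (f := fun t => φ t * (wronsk u u₁ F F₁ t - B₀)) fun t ht => by
          rw [uIoc_of_le hle] at ht
          rw [norm_mul]
          refine mul_le_mul (hφn t ht) ?_ (norm_nonneg _) (by positivity)
          rw [← dist_eq_norm]
          refine (hnear ?_ (hx0.trans ht.1)).le
          rw [Real.dist_eq, sub_zero, abs_of_pos (hx0.trans ht.1)]
          linarith [ht.2]
      rwa [show 2 * x - x = x by ring, abs_of_pos hx0] at this
    have e3 : ‖∫ t in x..(2 * x), φ t * wronsk u u₁ F F₁ t‖
        ≤ 16 * C * l2norm (Ioc 0 (2 * x)) F * x ^ 3 := by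
      rw [hφ, integral_weight_mul_wronsk hu hF hx0 hxc, norm_neg,
        intervalIntegral.integral_of_le hle]
      have cψ : ContinuousOn (fun t : ℝ => ((3 * x - 2 * t : ℝ) : ℂ) * u t
          + 2 * (((t - x) * (2 * x - t) : ℝ) : ℂ) * u₁ t) (Icc x (2 * x)) := by
        rw [← uIcc_of_le hle]
        refine ContinuousOn.add (ContinuousOn.mul (by fun_prop) (hu.continuousOn.mono hsub'))
          (ContinuousOn.mul (by fun_prop)
            ((hu.continuousOn_deriv ordConnected_Ioo isOpen_Ioo).mono hsub'))
      have hψ2 := memLp_mono (memLp_of_continuousOn_Icc cψ) Ioc_subset_Icc_self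
      refine (norm_setIntegral_mul_le hψ2 (memLp_mono hF2 hsub)).trans ?_
      have hψn : ∀ t ∈ Ioc x (2 * x), ‖((3 * x - 2 * t : ℝ) : ℂ) * u t
          + 2 * (((t - x) * (2 * x - t) : ℝ) : ℂ) * u₁ t‖ ≤ 8 * C * x ^ (5 / 2 : ℝ) := by
        intro t ht
        have ht0 : 0 < t := hx0.trans ht.1
        have b1 : ‖u t‖ ≤ C * (2 * x) ^ (3 / 2 : ℝ) := by
          refine (hbu t (hsub ht)).trans (mul_le_mul_of_nonneg_left ?_ hC)
          exact (Real.rpow_le_rpow ht0.le ht.2 (by linarith)).trans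
            (Real.rpow_le_rpow_of_exponent_ge (by linarith) hx1 (by linarith))
        have b2 : ‖u₁ t‖ ≤ C * (2 * x) ^ (1 / 2 : ℝ) := by
          refine (hbu₁ t (hsub ht)).trans (mul_le_mul_of_nonneg_left ?_ hC)
          exact (Real.rpow_le_rpow ht0.le ht.2 (by linarith)).trans
            (Real.rpow_le_rpow_of_exponent_ge (by linarith) hx1 (by linarith))
        have b3 : ‖((3 * x - 2 * t : ℝ) : ℂ)‖ ≤ x := by
          rw [Complex.norm_real, Real.norm_eq_abs, abs_le]
          constructor <;> linarith [ht.1, ht.2]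
        have e32 : (2 * x) ^ (3 / 2 : ℝ) = 2 * x * (2 * x) ^ (1 / 2 : ℝ) := by
          rw [show (3 / 2 : ℝ) = 1 + 1 / 2 by norm_num, Real.rpow_add (by linarith),
            Real.rpow_one]
        have e52 : x ^ (5 / 2 : ℝ) = x ^ 2 * x ^ (1 / 2 : ℝ) := by
          rw [show (5 / 2 : ℝ) = 2 + 1 / 2 by norm_num, Real.rpow_add hx0, Real.rpow_two]
        have e2x : (2 * x) ^ (1 / 2 : ℝ) ≤ 2 * x ^ (1 / 2 : ℝ) := by
          rw [Real.mul_rpow (by norm_num) hx0.le]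
          refine mul_le_mul_of_nonneg_right ?_ (by positivity)
          calc (2 : ℝ) ^ (1 / 2 : ℝ) ≤ 2 ^ (1 : ℝ) :=
                Real.rpow_le_rpow_of_exponent_le (by norm_num) (by norm_num)
            _ = 2 := Real.rpow_one 2
        have hpos : 0 ≤ (2 * x) ^ (1 / 2 : ℝ) := by positivity
        refine (norm_add_le _ _).trans ?_
        rw [norm_mul, norm_mul, norm_mul, Complex.norm_ofNat]
        have f1 : ‖((3 * x - 2 * t : ℝ) : ℂ)‖ * ‖u t‖ ≤ x * (C * (2 * x) ^ (3 / 2 : ℝ)) :=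
          mul_le_mul b3 b1 (norm_nonneg _) hx0.le
        have f2 : 2 * ‖(((t - x) * (2 * x - t) : ℝ) : ℂ)‖ * ‖u₁ t‖
            ≤ 2 * x ^ 2 * (C * (2 * x) ^ (1 / 2 : ℝ)) :=
          mul_le_mul (mul_le_mul_of_nonneg_left (hφn t ht) (by norm_num)) b2 (norm_nonneg _)
            (by positivity)
        have f3 : 4 * C * x ^ 2 * (2 * x) ^ (1 / 2 : ℝ)
            ≤ 4 * C * x ^ 2 * (2 * x ^ (1 / 2 : ℝ)) :=
          mul_le_mul_of_nonneg_left e2x (by positivity)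
        rw [e32] at f1
        rw [e52]
        nlinarith [f1, f2, f3]
      have g1 : l2norm (Ioc x (2 * x)) (fun t : ℝ => ((3 * x - 2 * t : ℝ) : ℂ) * u t
          + 2 * (((t - x) * (2 * x - t) : ℝ) : ℂ) * u₁ t) ≤ 8 * C * x ^ 3 := by
        have := l2norm_le_of_norm_le (K := (8 * C * x ^ 3) ^ 2) (g := fun _ => 64 * C ^ 2 * x ^ 5)
          measurableSet_Ioc (fun t ht => by
            refine (pow_le_pow_left₀ (norm_nonneg _) (hψn t ht) 2).trans (le_of_eq ?_)
            rw [sq_mul_rpow hx0, show (2 * (5 / 2) : ℝ) = ((5 : ℕ) : ℝ) by norm_num,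
              Real.rpow_natCast]
            ring) continuous_const.integrableOn_Ioc (by
            rw [setIntegral_const, Real.volume_real_Ioc_of_le hle, smul_eq_mul]
            exact le_of_eq (by ring))
        refine this.trans (le_of_eq ?_)
        rw [← Real.sqrt_eq_rpow, Real.sqrt_sq (by positivity)]
      have g2 : l2norm (Ioc x (2 * x)) F ≤ l2norm (Ioc 0 (2 * x)) F :=
        l2norm_mono (memLp_mono hF2 fun t ht => ⟨ht.1, ht.2.trans_lt hxc⟩)
          (Ioc_subset_Ioc_left hx0.le)
      have g3 := mul_le_mul g1 g2 (l2norm_nonneg _ _) (by positivity)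
      have g4 : 0 ≤ C * x ^ 3 * l2norm (Ioc 0 (2 * x)) F :=
        mul_nonneg (by positivity) (l2norm_nonneg _ _)
      nlinarith
    have e4 : ‖B₀‖ * (x ^ 3 / 6) ≤ 16 * C * l2norm (Ioc 0 (2 * x)) F * x ^ 3 + x ^ 2 * ε * x := by
      have h1 : ‖B₀ * ((x ^ 3 / 6 : ℝ) : ℂ)‖ = ‖B₀‖ * (x ^ 3 / 6) := by
        rw [norm_mul, Complex.norm_real, Real.norm_of_nonneg (by positivity)]
      rw [← h1, e1]
      exact (norm_sub_le _ _).trans (add_le_add e3 e2)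
    have hx3 : 0 < x ^ 3 := by positivity
    refine le_of_mul_le_mul_right ?_ hx3
    linarith
  have h0 : ‖B₀‖ / 6 ≤ 0 := le_of_forall_pos_le_add fun ε hε => by linarith [key ε hε]
  exact norm_le_zero_iff.mp (by linarith)

/-! ### Asymptotics on the minimal domain -/

/-- Pointwise bounds on a pair of solutions near `0`: `u` is of order `x ^ (1/2 + μ)`, and `v` of
order `x ^ (1/2 - μ)` up to a factor `ℓ`, with the corresponding bounds on the derivatives. -/
structure PairBounds (c μ C : ℝ) (ℓ : ℝ → ℝ) (u u₁ v v₁ : ℝ → ℂ) : Prop where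
  le_one : c ≤ 1
  left : ∀ x ∈ Ioo 0 c, ‖u x‖ ≤ C * x ^ (1 / 2 + μ)
  left_deriv : ∀ x ∈ Ioo 0 c, ‖u₁ x‖ ≤ C * x ^ (-1 / 2 + μ)
  right : ∀ x ∈ Ioo 0 c, ‖v x‖ ≤ C * (x ^ (1 / 2 - μ) * ℓ x)
  right_deriv : ∀ x ∈ Ioo 0 c, ‖v₁ x‖ ≤ C * (x ^ (-1 / 2 - μ) * ℓ x)

lemma IsMax.contDiffOn {β α : ℂ} {F F₁ w : ℝ → ℂ} (hF : IsMax β α F F₁ w) :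
    ContDiffOn ℝ 1 F (Ioi 0) := by
  have hd : ∀ x ∈ Ioi (0 : ℝ), deriv F x = F₁ x := fun x hx =>
    (hF.isStrong.hasDerivAt x hx).deriv
  rw [show (1 : WithTop ℕ∞) = 0 + 1 by simp, contDiffOn_succ_iff_deriv_of_isOpen isOpen_Ioi]
  refine ⟨fun x hx => (hF.isStrong.hasDerivAt x hx).differentiableAt.differentiableWithinAt,
    by simp, contDiffOn_zero.mpr ?_⟩
  exact (hF.isStrong.continuousOn_deriv ordConnected_Ioi isOpen_Ioi).congr hd

lemma IsMax.deriv_eq {β α : ℂ} {F F₁ w : ℝ → ℂ} (hF : IsMax β α F F₁ w) {x : ℝ} (hx : 0 < x) :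
    deriv F x = F₁ x := (hF.isStrong.hasDerivAt x hx).deriv

lemma isBigO_of_forall_Ioo {f : ℝ → ℂ} {g : ℝ → ℝ} {c C : ℝ} (hc : 0 < c)
    (h : ∀ x ∈ Ioo 0 c, ‖f x‖ ≤ C * g x) : f =O[𝓝[>] 0] g := by
  refine IsBigO.of_bound |C| ?_
  filter_upwards [Ioo_mem_nhdsGT hc] with x hx
  refine (h x hx).trans ?_
  rw [Real.norm_eq_abs, ← abs_mul]
  exact le_abs_self _

lemma rpow_mul_rpow_eventuallyEq {a b d : ℝ} (h : a + b = d) (ρ : ℝ → ℝ) :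
    (fun x : ℝ => x ^ a * ρ x * x ^ b) =ᶠ[𝓝[>] 0] fun x => x ^ d * ρ x := by
  filter_upwards [self_mem_nhdsWithin] with x hx
  rw [← h, Real.rpow_add hx]; ring

section

variable {β α : ℂ} {c μ C : ℝ} {ℓ ρ : ℝ → ℝ} {u u₁ v v₁ F F₁ w : ℝ → ℂ}

/-- Estimates of the coordinates of `F` in the basis `u`, `v` turn into estimates of `F`, `F'`. -/
lemma SolutionPair.isLittleO (hp : SolutionPair β α c u u₁ v v₁)
    (hb : PairBounds c μ C ℓ u u₁ v v₁) (hℓ : ℓ =O[𝓝[>] 0] ρ)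
    (hA : wronsk F F₁ v v₁ =o[𝓝[>] 0] fun x => x ^ (1 - μ) * ρ x)
    (hB : wronsk u u₁ F F₁ =o[𝓝[>] 0] fun x => x ^ (1 + μ)) :
    (F =o[𝓝[>] 0] fun x => x ^ (3 / 2 : ℝ) * ρ x) ∧
      F₁ =o[𝓝[>] 0] fun x => x ^ (1 / 2 : ℝ) * ρ x := by
  have hu := isBigO_of_forall_Ioo hp.pos hb.left
  have hu₁ := isBigO_of_forall_Ioo hp.pos hb.left_deriv
  have hv := (isBigO_of_forall_Ioo hp.pos hb.right).trans
    ((isBigO_refl (fun x : ℝ => x ^ (1 / 2 - μ)) _).mul hℓ)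
  have hv₁ := (isBigO_of_forall_Ioo hp.pos hb.right_deriv).trans
    ((isBigO_refl (fun x : ℝ => x ^ (-1 / 2 - μ)) _).mul hℓ)
  constructor
  · have h1 := (hA.mul_isBigO hu).trans_eventuallyEq
      (rpow_mul_rpow_eventuallyEq (d := 3 / 2) (by ring) ρ)
    have h2 := (hv.mul_isLittleO hB).trans_eventuallyEq
      (rpow_mul_rpow_eventuallyEq (d := 3 / 2) (by ring) ρ)
    refine (h1.add h2).congr' ?_ EventuallyEq.rfl
    filter_upwards [Ioo_mem_nhdsGT hp.pos] with x hx
    rw [hp.eq_add (F := F) (F₁ := F₁) hx]; ring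
  · have h1 := (hA.mul_isBigO hu₁).trans_eventuallyEq
      (rpow_mul_rpow_eventuallyEq (d := 1 / 2) (by ring) ρ)
    have h2 := (hv₁.mul_isLittleO hB).trans_eventuallyEq
      (rpow_mul_rpow_eventuallyEq (d := 1 / 2) (by ring) ρ)
    refine (h1.add h2).congr' ?_ EventuallyEq.rfl
    filter_upwards [Ioo_mem_nhdsGT hp.pos] with x hx
    rw [hp.deriv_eq_add (F := F) (F₁ := F₁) hx]; ring

lemma PairBounds.memLp_left (hb : PairBounds c μ C ℓ u u₁ v v₁)
    (hp : SolutionPair β α c u u₁ v v₁) (hμ : 0 ≤ μ) :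
    MemLp u 2 (volume.restrict (Ioo 0 c)) :=
  memLp_of_norm_le_rpow (by linarith) hp.left.continuousOn hb.left

lemma PairBounds.isBigO_l2norm_left (hb : PairBounds c μ C ℓ u u₁ v v₁)
    (hp : SolutionPair β α c u u₁ v v₁) (hμ : 0 ≤ μ) :
    (fun x => l2norm (Ioc 0 x) u) =O[𝓝[>] 0] fun x => x ^ (1 + μ) := by
  refine IsBigO.of_bound ((C ^ 2 / (2 * (1 / 2 + μ) + 1)) ^ (1 / 2 : ℝ)) ?_
  filter_upwards [Ioo_mem_nhdsGT hp.pos] with x hx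
  rw [Real.norm_of_nonneg (l2norm_nonneg _ _), Real.norm_of_nonneg (Real.rpow_nonneg hx.1.le _)]
  have := l2norm_Ioc_le_rpow (f := u) (C := C) (p := 1 / 2 + μ) (by linarith) hx.1 fun t ht =>
    hb.left t ⟨ht.1, ht.2.trans_lt hx.2⟩
  rwa [show 1 / 2 + μ + 1 / 2 = 1 + μ by ring] at this

/-- Behavior at `0` on the minimal domain when all solutions are square integrable near `0`. -/
lemma SolutionPair.behavior_Lmin (hp : SolutionPair β α c u u₁ v v₁)
    (hb : PairBounds c μ C ℓ u u₁ v v₁) (hμ : 0 ≤ μ)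
    (hv : MemLp v 2 (volume.restrict (Ioo 0 c)))
    (hvn : (fun x => l2norm (Ioc 0 x) v) =O[𝓝[>] 0] fun x => x ^ (1 - μ) * ℓ x) {f : L2Pos}
    (hf : f ∈ (Lmin β α).domain) :
    ∃ F : ℝ → ℂ, Represents F f ∧ ContDiffOn ℝ 1 F (Ioi 0) ∧
      (F =o[𝓝[>] 0] fun x => x ^ (3 / 2 : ℝ) * ℓ x) ∧
      deriv F =o[𝓝[>] 0] fun x => x ^ (1 / 2 : ℝ) * ℓ x := by
  obtain ⟨F, F₁, w, hFf, hF⟩ := exists_isMax_of_mem_domain (Lmin_domain_le β α hf)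
  have hu := hb.memLp_left hp hμ
  have hw := memLp_mono hF.memLp_image (t := Ioo 0 c) Ioo_subset_Ioi_self
  obtain ⟨hA0, hB0⟩ := (hp.mem_Lmin_domain_iff hu hv hF hFf).mp hf
  obtain ⟨A₀, hA, hAx⟩ := hp.exists_tendsto_right hv hF
  obtain ⟨B₀, hB, hBx⟩ := hp.exists_tendsto_left hu hF
  obtain rfl := tendsto_nhds_unique hA hA0
  obtain rfl := tendsto_nhds_unique hB hB0
  have h1 : wronsk F F₁ v v₁ =o[𝓝[>] 0] fun x => x ^ (1 - μ) * ℓ x := by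
    refine (isLittleO_setIntegral hp.pos hv hw hvn).congr' ?_ EventuallyEq.rfl
    filter_upwards [Ioo_mem_nhdsGT hp.pos] with x hx
    rw [hAx x hx, zero_add]
    exact integral_congr_ae (Eventually.of_forall fun _ => mul_comm _ _)
  have h2 : wronsk u u₁ F F₁ =o[𝓝[>] 0] fun x => x ^ (1 + μ) := by
    refine (isLittleO_setIntegral hp.pos hu hw
      (hb.isBigO_l2norm_left hp hμ)).neg_left.congr' ?_ EventuallyEq.rfl
    filter_upwards [Ioo_mem_nhdsGT hp.pos] with x hx
    rw [hBx x hx, zero_sub]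
  obtain ⟨h3, h4⟩ := hp.isLittleO hb (isBigO_refl _ _) h1 h2
  refine ⟨F, hFf, hF.contDiffOn, h3, h4.congr' ?_ EventuallyEq.rfl⟩
  filter_upwards [self_mem_nhdsWithin] with x hx
  rw [hF.deriv_eq hx]

/-- In the limit point case, the coordinates of every element of the maximal domain obey the same
bounds as on the minimal domain. The factor `x ^ (1 - μ) * ρ x` is a gauge for the tail norms of
`v`. -/
lemma SolutionPair.isLittleO_wronsk (hp : SolutionPair β α c u u₁ v v₁)
    (hb : PairBounds c μ C ℓ u u₁ v v₁) (hμ : 1 ≤ μ)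
    (ha : Tendsto (fun x : ℝ => x ^ (1 - μ) * ρ x) (𝓝[>] 0) atTop) {K : ℝ}
    (hva : ∀ x ∈ Ioo 0 c, ∀ δ ∈ Ioo 0 c, x < δ →
      l2norm (Ioc x δ) v ≤ K * (x ^ (1 - μ) * ρ x)) (hF : IsMax β α F F₁ w) :
    (wronsk F F₁ v v₁ =o[𝓝[>] 0] fun x => x ^ (1 - μ) * ρ x) ∧
      wronsk u u₁ F F₁ =o[𝓝[>] 0] fun x => x ^ (1 + μ) := by
  have hu := hb.memLp_left hp (by linarith)
  have hS := hF.isStrong.mono (t := Ioo 0 c) Ioo_subset_Ioi_self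
  have hw := memLp_mono hF.memLp_image (t := Ioo 0 c) Ioo_subset_Ioi_self
  have hF2 := memLp_mono hF.memLp (t := Ioo 0 c) Ioo_subset_Ioi_self
  constructor
  · refine IsPrimitiveOn.isLittleO_gauge hp.pos ?_ hp.right.continuousOn hw ha hva
    exact (hS.isPrimitiveOn_wronsk hp.right ordConnected_Ioo isOpen_Ioo).congr ordConnected_Ioo
      (fun _ _ => rfl) fun x _ => by simp
  · obtain ⟨B₀, hB, hBx⟩ := hp.exists_tendsto_left hu hF
    obtain rfl := eq_zero_of_tendsto_wronsk hp.pos hμ hp.left hS hF2 hb.left hb.left_deriv hB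
    refine (isLittleO_setIntegral hp.pos hu hw
      (hb.isBigO_l2norm_left hp (by linarith))).neg_left.congr' ?_ EventuallyEq.rfl
    filter_upwards [Ioo_mem_nhdsGT hp.pos] with x hx
    rw [hBx x hx, zero_sub]

/-- The limit point case: the minimal and the maximal domain coincide, and their elements are small
at `0`. -/
lemma SolutionPair.limitPoint (hp : SolutionPair β α c u u₁ v v₁)
    (hb : PairBounds c μ C ℓ u u₁ v v₁) (hμ : 1 ≤ μ) (hℓ : ℓ =O[𝓝[>] 0] ρ)
    (ha : Tendsto (fun x : ℝ => x ^ (1 - μ) * ρ x) (𝓝[>] 0) atTop) {K : ℝ}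
    (hva : ∀ x ∈ Ioo 0 c, ∀ δ ∈ Ioo 0 c, x < δ →
      l2norm (Ioc x δ) v ≤ K * (x ^ (1 - μ) * ρ x))
    (hρ : Tendsto (fun x : ℝ => x ^ (2 : ℝ) * ρ x) (𝓝[>] 0) (𝓝 0)) :
    (Lmin β α).domain = (Lmax β α).domain ∧ ∀ f ∈ (Lmax β α).domain,
      ∃ F : ℝ → ℂ, Represents F f ∧ ContDiffOn ℝ 1 F (Ioi 0) ∧
        (F =o[𝓝[>] 0] fun x => x ^ (3 / 2 : ℝ) * ρ x) ∧
        deriv F =o[𝓝[>] 0] fun x => x ^ (1 / 2 : ℝ) * ρ x := by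
  constructor
  · refine le_antisymm (Lmin_domain_le β α) fun f hf => ?_
    obtain ⟨F, F₁, w, hFf, hF⟩ := exists_isMax_of_mem_domain hf
    rw [hF.mem_Lmin_domain_iff hFf]
    intro G G₁ k hG
    obtain ⟨hA, hB⟩ := hp.isLittleO_wronsk hb hμ ha hva hF
    obtain ⟨hA', hB'⟩ := hp.isLittleO_wronsk hb hμ ha hva hG
    have e := rpow_mul_rpow_eventuallyEq (a := 1 - μ) (b := 1 + μ) (d := 2) (by ring) ρ
    have h1 := (hA.mul hB').trans_eventuallyEq e
    have h2 := (hA'.mul hB).trans_eventuallyEq e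
    have h3 := (h1.sub h2).trans_tendsto hρ
    refine h3.congr' ?_
    filter_upwards [Ioo_mem_nhdsGT hp.pos] with x hx
    rw [hp.wronsk_eq (F := F) (F₁ := F₁) (G := G) (G₁ := G₁) hx]; ring
  · intro f hf
    obtain ⟨F, F₁, w, hFf, hF⟩ := exists_isMax_of_mem_domain hf
    obtain ⟨hA, hB⟩ := hp.isLittleO_wronsk hb hμ ha hva hF
    obtain ⟨h3, h4⟩ := hp.isLittleO hb hℓ hA hB
    refine ⟨F, hFf, hF.contDiffOn, h3, h4.congr' ?_ EventuallyEq.rfl⟩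
    filter_upwards [self_mem_nhdsWithin] with x hx
    rw [hF.deriv_eq hx]

end

section

variable {β α : ℂ} {c μ C : ℝ} {u u₁ v v₁ : ℝ → ℂ}

lemma PairBounds.memLp_right (hb : PairBounds c μ C (fun _ => 1) u u₁ v v₁)
    (hp : SolutionPair β α c u u₁ v v₁) (hμ : μ < 1) :
    MemLp v 2 (volume.restrict (Ioo 0 c)) :=
  memLp_of_norm_le_rpow (p := 1 / 2 - μ) (C := C) (by linarith) hp.right.continuousOn fun x hx => by
    simpa using hb.right x hx

lemma PairBounds.isBigO_l2norm_right (hb : PairBounds c μ C (fun _ => 1) u u₁ v v₁)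
    (hp : SolutionPair β α c u u₁ v v₁) (hμ : μ < 1) :
    (fun x => l2norm (Ioc 0 x) v) =O[𝓝[>] 0] fun x => x ^ (1 - μ) * 1 := by
  refine IsBigO.of_bound ((C ^ 2 / (2 * (1 / 2 - μ) + 1)) ^ (1 / 2 : ℝ)) ?_
  filter_upwards [Ioo_mem_nhdsGT hp.pos] with x hx
  rw [Real.norm_of_nonneg (l2norm_nonneg _ _), mul_one,
    Real.norm_of_nonneg (Real.rpow_nonneg hx.1.le _)]
  have := l2norm_Ioc_le_rpow (f := v) (C := C) (p := 1 / 2 - μ) (by linarith) hx.1 fun t ht => by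
    simpa using hb.right t ⟨ht.1, ht.2.trans_lt hx.2⟩
  rwa [show 1 / 2 - μ + 1 / 2 = 1 - μ by ring] at this

lemma sqrt_mul_abs_log_mono {s t : ℝ} (hs : 0 < s) (hst : s ≤ t) (ht : t ≤ Real.exp (-2)) :
    s ^ (1 / 2 : ℝ) * |Real.log s| ≤ t ^ (1 / 2 : ℝ) * |Real.log t| := by
  have ht0 : 0 < t := hs.trans_le hst
  have ht1 : t ≤ 1 := ht.trans (Real.exp_le_one_iff.mpr (by norm_num))
  have h := Real.log_div_sqrt_antitoneOn (a := t⁻¹) (b := s⁻¹)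
    (by rw [mem_Ici, ← neg_neg (2 : ℝ), Real.exp_neg]; exact inv_anti₀ ht0 ht)
    (by rw [mem_Ici, ← neg_neg (2 : ℝ), Real.exp_neg]; exact inv_anti₀ hs (hst.trans ht))
    (inv_anti₀ hs hst)
  simp only [Real.log_inv, Real.sqrt_inv, div_inv_eq_mul] at h
  rw [abs_of_nonpos (Real.log_nonpos hs.le (hst.trans ht1)),
    abs_of_nonpos (Real.log_nonpos ht0.le ht1), ← Real.sqrt_eq_rpow, ← Real.sqrt_eq_rpow]
  linarith

lemma PairBounds.memLp_right_log (hb : PairBounds c 0 C (fun x => |Real.log x|) u u₁ v v₁)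
    (hp : SolutionPair β α c u u₁ v v₁) (hC : 0 ≤ C) : MemLp v 2 (volume.restrict (Ioo 0 c)) :=
  memLp_of_norm_le_rpow (p := 0) (C := C * 2) (by norm_num) hp.right.continuousOn fun x hx => by
    refine (hb.right x hx).trans ?_
    rw [Real.rpow_zero, mul_one, sub_zero]
    refine mul_le_mul_of_nonneg_left ?_ hC
    have := Real.abs_log_mul_self_rpow_lt x (1 / 2) hx.1 (hx.2.le.trans hb.le_one) (by norm_num)
    rw [abs_mul, abs_of_nonneg (Real.rpow_nonneg hx.1.le (1 / 2))] at this
    linarith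

lemma PairBounds.isBigO_l2norm_right_log
    (hb : PairBounds c 0 C (fun x => |Real.log x|) u u₁ v v₁)
    (hp : SolutionPair β α c u u₁ v v₁) (hC : 0 ≤ C) :
    (fun x => l2norm (Ioc 0 x) v) =O[𝓝[>] 0] fun x => x ^ (1 - (0 : ℝ)) * |Real.log x| := by
  refine IsBigO.of_bound C ?_
  have hm : 0 < min c (Real.exp (-2)) := lt_min hp.pos (Real.exp_pos _)
  filter_upwards [Ioo_mem_nhdsGT hm] with x hx
  have hxc : x < c := hx.2.trans_le (min_le_left _ _)
  have hxe : x ≤ Real.exp (-2) := (hx.2.trans_le (min_le_right _ _)).le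
  have hx0 : 0 < x := hx.1
  rw [Real.norm_of_nonneg (l2norm_nonneg _ _), sub_zero, Real.rpow_one,
    Real.norm_of_nonneg (by positivity)]
  set M := C * (x ^ (1 / 2 : ℝ) * |Real.log x|) with hM
  have hM0 : 0 ≤ M := by positivity
  have := l2norm_le_of_norm_le (f := v) (K := M ^ 2 * x) (g := fun _ => M ^ 2)
    (measurableSet_Ioc (a := (0 : ℝ)) (b := x)) (fun t ht => by
      refine pow_le_pow_left₀ (norm_nonneg _) ?_ 2
      have h1 := hb.right t ⟨ht.1, ht.2.trans_lt hxc⟩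
      rw [sub_zero] at h1
      exact h1.trans (mul_le_mul_of_nonneg_left (sqrt_mul_abs_log_mono ht.1 ht.2 hxe) hC))
    continuous_const.integrableOn_Ioc (by
      rw [setIntegral_const, Real.volume_real_Ioc_of_le hx0.le, smul_eq_mul]
      exact le_of_eq (by ring))
  refine this.trans (le_of_eq ?_)
  rw [Real.mul_rpow (by positivity) hx0.le, ← Real.sqrt_eq_rpow, Real.sqrt_sq hM0, hM,
    ← Real.sqrt_eq_rpow]
  linear_combination C * |Real.log x| * Real.mul_self_sqrt hx0.le

lemma integral_rpow_Ioc_le {p x δ : ℝ} (hp : p < -1) (hx : 0 < x) (hxδ : x < δ) :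
    ∫ t in Ioc x δ, t ^ p ≤ x ^ (p + 1) / -(p + 1) := by
  rw [← intervalIntegral.integral_of_le hxδ.le, integral_rpow (Or.inr ⟨by linarith, by
    rw [uIcc_of_le hxδ.le]; exact fun h => absurd h.1 (not_le.mpr hx)⟩)]
  have h1 : 0 < -(p + 1) := by linarith
  have h2 : 0 ≤ δ ^ (p + 1) := Real.rpow_nonneg (hx.trans hxδ).le _
  rw [show (δ ^ (p + 1) - x ^ (p + 1)) / (p + 1) = (x ^ (p + 1) - δ ^ (p + 1)) / -(p + 1) by
    rw [← neg_div_neg_eq, neg_sub]]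
  gcongr
  linarith

lemma integrableOn_rpow_Ioc_of_pos {p x δ : ℝ} (hx : 0 < x) :
    IntegrableOn (fun t : ℝ => t ^ p) (Ioc x δ) := by
  have : ContinuousOn (fun t : ℝ => t ^ p) (Icc x δ) := fun t ht =>
    (Real.continuousAt_rpow_const t p (Or.inl (hx.trans_le ht.1).ne')).continuousWithinAt
  exact this.integrableOn_Icc.mono_set Ioc_subset_Icc_self

/-- Tail norms of the singular solution for `μ > 1`. -/
lemma PairBounds.l2norm_tail_le (hb : PairBounds c μ C (fun _ => 1) u u₁ v v₁) (hμ : 1 < μ)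
    {x δ : ℝ} (hx : x ∈ Ioo 0 c) (hδ : δ ∈ Ioo 0 c) (hxδ : x < δ) :
    l2norm (Ioc x δ) v ≤ (C ^ 2 / (2 * μ - 2)) ^ (1 / 2 : ℝ) * (x ^ (1 - μ) * 1) := by
  have hμ' : 0 < 2 * μ - 2 := by linarith
  have h := l2norm_le_of_norm_le (f := v) (K := C ^ 2 / (2 * μ - 2) * x ^ (2 - 2 * μ))
    (g := fun t => C ^ 2 * t ^ (2 * (1 / 2 - μ))) (measurableSet_Ioc (a := x) (b := δ))
    (fun t ht => by
      have ht0 : 0 < t := hx.1.trans ht.1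
      rw [← sq_mul_rpow ht0]
      refine pow_le_pow_left₀ (norm_nonneg _) ?_ 2
      simpa using hb.right t ⟨ht0, ht.2.trans_lt hδ.2⟩)
    ((integrableOn_rpow_Ioc_of_pos hx.1).const_mul _) (by
      rw [integral_const_mul]
      have := integral_rpow_Ioc_le (p := 2 * (1 / 2 - μ)) (by linarith) hx.1 hxδ
      rw [show 2 * (1 / 2 - μ) + 1 = 2 - 2 * μ by ring,
        show -(2 - 2 * μ) = 2 * μ - 2 by ring] at this
      calc _ ≤ C ^ 2 * (x ^ (2 - 2 * μ) / (2 * μ - 2)) :=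
            mul_le_mul_of_nonneg_left this (by positivity)
        _ = _ := by ring)
  refine h.trans (le_of_eq ?_)
  rw [Real.mul_rpow (by positivity) (Real.rpow_nonneg hx.1.le _), ← Real.rpow_mul hx.1.le,
    mul_one]
  congr 2; ring

/-- Tail norms of the singular solution for `μ = 1`. -/
lemma PairBounds.l2norm_tail_le_log (hb : PairBounds c 1 C (fun _ => 1) u u₁ v v₁)
    {x δ : ℝ} (hx : x ∈ Ioo 0 c) (hδ : δ ∈ Ioo 0 c) (hxδ : x < δ) :
    l2norm (Ioc x δ) v
      ≤ (C ^ 2) ^ (1 / 2 : ℝ) * (x ^ (1 - (1 : ℝ)) * |Real.log x| ^ (1 / 2 : ℝ)) := by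
  have h := l2norm_le_of_norm_le (f := v) (K := C ^ 2 * |Real.log x|)
    (g := fun t => C ^ 2 * t ^ (-1 : ℝ)) (measurableSet_Ioc (a := x) (b := δ))
    (fun t ht => by
      have ht0 : 0 < t := hx.1.trans ht.1
      have : t ^ (-1 : ℝ) = t ^ (2 * (-1 / 2) : ℝ) := by norm_num
      rw [this, ← sq_mul_rpow ht0]
      refine pow_le_pow_left₀ (norm_nonneg _) ?_ 2
      have h1 := hb.right t ⟨ht0, ht.2.trans_lt hδ.2⟩
      rw [mul_one] at h1
      rwa [show (-1 / 2 : ℝ) = 1 / 2 - 1 by norm_num])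
    ((integrableOn_rpow_Ioc_of_pos hx.1).const_mul _) (by
      rw [integral_const_mul]
      refine mul_le_mul_of_nonneg_left ?_ (by positivity)
      simp only [Real.rpow_neg_one]
      rw [← intervalIntegral.integral_of_le hxδ.le, integral_inv_of_pos hx.1 hδ.1,
        Real.log_div hδ.1.ne' hx.1.ne', abs_of_nonpos
          (Real.log_nonpos hx.1.le (hx.2.le.trans hb.le_one))]
      linarith [Real.log_nonpos hδ.1.le (hδ.2.le.trans hb.le_one)])
  refine h.trans (le_of_eq ?_)
  rw [Real.mul_rpow (by positivity) (abs_nonneg _), sub_self, Real.rpow_zero, one_mul]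

lemma tendsto_abs_log_rpow_atTop :
    Tendsto (fun x : ℝ => |Real.log x| ^ (1 / 2 : ℝ)) (𝓝[>] 0) atTop :=
  (tendsto_rpow_atTop (by norm_num)).comp
    (tendsto_abs_atBot_atTop.comp Real.tendsto_log_nhdsGT_zero)

lemma tendsto_sq_mul_abs_log_rpow :
    Tendsto (fun x : ℝ => x ^ (2 : ℝ) * |Real.log x| ^ (1 / 2 : ℝ)) (𝓝[>] 0) (𝓝 0) := by
  have h1 : Tendsto (fun x : ℝ => Real.log x * x ^ (1 : ℝ)) (𝓝[>] 0) (𝓝 0) :=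
    tendsto_log_mul_rpow_nhdsGT_zero one_pos
  have h2 := (h1.abs.rpow_const (p := 1 / 2) (Or.inr (by norm_num)))
  have h3 : Tendsto (fun x : ℝ => x ^ (3 / 2 : ℝ)) (𝓝[>] 0) (𝓝 0) := by
    have := (Real.continuousAt_rpow_const 0 (3 / 2) (Or.inr (by norm_num))).tendsto
    rw [Real.zero_rpow (by norm_num)] at this
    exact this.mono_left nhdsWithin_le_nhds
  have h4 := h3.mul h2
  rw [zero_mul] at h4
  refine h4.congr' ?_
  filter_upwards [self_mem_nhdsWithin] with x hx
  have hx0 : (0 : ℝ) < x := hx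
  have h5 : x ^ (2 : ℝ) = x ^ (3 / 2 : ℝ) * x ^ (1 / 2 : ℝ) := by
    rw [← Real.rpow_add hx0]; norm_num
  rw [Real.rpow_one, abs_mul, abs_of_pos hx0, Real.mul_rpow (abs_nonneg _) hx0.le, h5]
  ring

lemma SolutionPair.limitPoint_of_one_lt (hp : SolutionPair β α c u u₁ v v₁)
    (hb : PairBounds c μ C (fun _ => 1) u u₁ v v₁) (hμ : 1 < μ) :
    (Lmin β α).domain = (Lmax β α).domain ∧ ∀ f ∈ (Lmax β α).domain,
      ∃ F : ℝ → ℂ, Represents F f ∧ ContDiffOn ℝ 1 F (Ioi 0) ∧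
        (F =o[𝓝[>] 0] fun x => x ^ (3 / 2 : ℝ) * 1) ∧
        deriv F =o[𝓝[>] 0] fun x => x ^ (1 / 2 : ℝ) * 1 := by
  refine hp.limitPoint hb hμ.le (isBigO_refl _ _) ?_
    (fun x hx δ hδ hxδ => hb.l2norm_tail_le hμ hx hδ hxδ) ?_
  · simpa using tendsto_rpow_neg_nhdsGT_zero (show 1 - μ < 0 by linarith)
  · have := (Real.continuousAt_rpow_const 0 2 (Or.inr (by norm_num))).tendsto
    rw [Real.zero_rpow (by norm_num)] at this
    simpa only [mul_one] using this.mono_left nhdsWithin_le_nhds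

lemma SolutionPair.limitPoint_of_eq_one (hp : SolutionPair β α c u u₁ v v₁)
    (hb : PairBounds c 1 C (fun _ => 1) u u₁ v v₁) :
    (Lmin β α).domain = (Lmax β α).domain ∧ ∀ f ∈ (Lmax β α).domain,
      ∃ F : ℝ → ℂ, Represents F f ∧ ContDiffOn ℝ 1 F (Ioi 0) ∧
        (F =o[𝓝[>] 0] fun x => x ^ (3 / 2 : ℝ) * |Real.log x| ^ (1 / 2 : ℝ)) ∧
        deriv F =o[𝓝[>] 0] fun x => x ^ (1 / 2 : ℝ) * |Real.log x| ^ (1 / 2 : ℝ) := by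
  refine hp.limitPoint hb le_rfl ?_ ?_
    (fun x hx δ hδ hxδ => hb.l2norm_tail_le_log hx hδ hxδ) tendsto_sq_mul_abs_log_rpow
  · refine IsBigO.of_bound 1 ?_
    filter_upwards [tendsto_abs_log_rpow_atTop.eventually_ge_atTop 1] with x hx
    rw [one_mul, norm_one]
    exact hx.trans (le_abs_self _)
  · simpa using tendsto_abs_log_rpow_atTop

end

/-! ### The Bessel series and its dependence on the order -/

/-- The exponential generating series `∑ cₖ (-w)ᵏ / k!`. -/
noncomputable def expSeries (c : ℕ → ℂ) (w : ℂ) : ℂ :=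
  ∑' k : ℕ, c k * ((-w) ^ k / (Nat.factorial k : ℂ))

lemma norm_expSeries_term_le {c : ℕ → ℂ} {C : ℝ} (hc : ∀ k, ‖c k‖ ≤ C) {w : ℂ} {R : ℝ}
    (hw : ‖w‖ ≤ R) (k : ℕ) :
    ‖c k * ((-w) ^ k / (Nat.factorial k : ℂ))‖ ≤ C * (R ^ k / (Nat.factorial k : ℝ)) := by
  rw [norm_mul, norm_div, norm_pow, norm_neg, Complex.norm_natCast]
  exact mul_le_mul (hc k) (by gcongr) (by positivity) ((norm_nonneg _).trans (hc 0))

lemma summable_bound (C R : ℝ) : Summable fun k : ℕ => C * (R ^ k / (Nat.factorial k : ℝ)) :=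
  (Real.summable_pow_div_factorial R).mul_left C

lemma summable_expSeries {c : ℕ → ℂ} {C : ℝ} (hc : ∀ k, ‖c k‖ ≤ C) (w : ℂ) :
    Summable fun k : ℕ => c k * ((-w) ^ k / (Nat.factorial k : ℂ)) :=
  Summable.of_norm_bounded (summable_bound C ‖w‖) (norm_expSeries_term_le hc le_rfl)

lemma expSeries_zero (c : ℕ → ℂ) : expSeries c 0 = c 0 := by
  rw [expSeries, tsum_eq_single 0]
  · simp
  · intro k hk; simp [hk]

/-- Multiplication of the coefficients by `k` is multiplication by `-w` and a shift. -/
lemma expSeries_natCast_mul {c : ℕ → ℂ} {C : ℝ} (hc : ∀ k, ‖c k‖ ≤ C) (w : ℂ) :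
    HasSum (fun k : ℕ => (k : ℂ) * c k * ((-w) ^ k / (Nat.factorial k : ℂ)))
      (-w * expSeries (fun k => c (k + 1)) w) := by
  have h1 := ((summable_expSeries (c := fun k => c (k + 1)) (fun k => hc (k + 1))
    w).hasSum).mul_left (-w)
  rw [← hasSum_nat_add_iff' 1]
  simp only [Finset.range_one, Finset.sum_singleton, Nat.cast_zero, zero_mul, sub_zero]
  convert! h1 using 1
  funext k
  have := Nat.factorial_ne_zero k
  rw [Nat.factorial_succ]
  push_cast
  field_simp
  ring

lemma hasDerivAt_expSeries {c : ℕ → ℂ} {C : ℝ} (hc : ∀ k, ‖c k‖ ≤ C) (w : ℂ) :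
    HasDerivAt (expSeries c) (-expSeries (fun k => c (k + 1)) w) w := by
  have hU : IsOpen (Metric.ball (0 : ℂ) (‖w‖ + 1)) := Metric.isOpen_ball
  have hw : w ∈ Metric.ball (0 : ℂ) (‖w‖ + 1) := by simp
  have hdk : ∀ (k : ℕ) (z : ℂ), HasDerivAt (fun w => c k * ((-w) ^ k / (Nat.factorial k : ℂ)))
      (c k * (((k : ℂ) * (-z) ^ (k - 1) * (-1)) / (Nat.factorial k : ℂ))) z := fun k z =>
    (((hasDerivAt_id z).neg.pow k).div_const _).const_mul (c k)
  have hdiff : ∀ k : ℕ, DifferentiableOn ℂ (fun w => c k * ((-w) ^ k / (Nat.factorial k : ℂ)))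
      (Metric.ball (0 : ℂ) (‖w‖ + 1)) := fun k z _ =>
    (hdk k z).differentiableAt.differentiableWithinAt
  have hb : ∀ (k : ℕ) (z : ℂ), z ∈ Metric.ball (0 : ℂ) (‖w‖ + 1) →
      ‖c k * ((-z) ^ k / (Nat.factorial k : ℂ))‖
        ≤ C * ((‖w‖ + 1) ^ k / (Nat.factorial k : ℝ)) := fun k z hz =>
    norm_expSeries_term_le hc (by simpa using (mem_ball_zero_iff.mp hz).le) k
  have h1 := Complex.hasSum_deriv_of_summable_norm (summable_bound C (‖w‖ + 1)) hdiff hU hb hw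
  have h2 := (Complex.differentiableOn_tsum_of_summable_norm (summable_bound C (‖w‖ + 1)) hdiff hU
    hb).differentiableAt (hU.mem_nhds hw)
  refine h2.hasDerivAt.congr_deriv ?_
  refine h1.unique ?_
  have h3 := ((summable_expSeries (c := fun k => c (k + 1)) (fun k => hc (k + 1)) w).hasSum).neg
  rw [← hasSum_nat_add_iff' 1]
  simp only [Finset.range_one, Finset.sum_singleton]
  rw [(hdk 0 w).deriv]
  simp only [Nat.cast_zero, zero_mul, zero_div, mul_zero, sub_zero]
  convert! h3 using 1
  funext k
  rw [(hdk (k + 1) w).deriv, Nat.factorial_succ, Nat.add_sub_cancel]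
  push_cast
  field_simp

/-- The recursion `cₖ = (ν + k + 1) cₖ₊₁ + dₖ₊₁` of the coefficients, as an identity between the
series: the differential equation of Bessel type satisfied by `expSeries c`. -/
lemma expSeries_recursion {c d : ℕ → ℂ} {C D : ℝ} (hc : ∀ k, ‖c k‖ ≤ C) (hd : ∀ k, ‖d k‖ ≤ D)
    {ν : ℂ} (h : ∀ k, c k = (ν + k + 1) * c (k + 1) + d k) (w : ℂ) :
    expSeries c w = (ν + 1) * expSeries (fun k => c (k + 1)) w
      - w * expSeries (fun k => c (k + 2)) w + expSeries d w := by
  have h1 := expSeries_natCast_mul (c := fun k => c (k + 1)) (fun k => hc (k + 1)) w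
  have h2 := ((summable_expSeries (c := fun k => c (k + 1)) (fun k => hc (k + 1))
    w).hasSum).mul_left (ν + 1)
  have h3 := (summable_expSeries hd w).hasSum
  have h4 := (h2.add h1).add h3
  refine (tsum_congr fun k => ?_).trans (h4.tsum_eq.trans ?_)
  · rw [h k]; ring
  · simp only [expSeries]; ring

/-- The entire function `1 / Γ`. -/
noncomputable def invGamma (ν : ℂ) : ℂ := (Complex.Gamma ν)⁻¹

lemma differentiable_invGamma : Differentiable ℂ invGamma := Complex.differentiable_one_div_Gamma

lemma invGamma_eq (ν : ℂ) : invGamma ν = ν * invGamma (ν + 1) :=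
  Complex.one_div_Gamma_eq_self_mul_one_div_Gamma_add_one ν

/-- The functional equation of `1 / Γ`, differentiated. -/
lemma deriv_invGamma_eq (ν : ℂ) :
    deriv invGamma ν = ν * deriv invGamma (ν + 1) + invGamma (ν + 1) := by
  have h1 : HasDerivAt (fun ν => ν * invGamma (ν + 1))
      (1 * invGamma (ν + 1) + ν * deriv invGamma (ν + 1)) ν :=
    (hasDerivAt_id ν).mul ((differentiable_invGamma (ν + 1)).hasDerivAt.comp_add_const ν 1)
  have h2 : invGamma = fun ν => ν * invGamma (ν + 1) := funext invGamma_eq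
  conv_lhs => rw [h2]
  rw [h1.deriv]; ring

/-- The numbers `1 / Γ(μ + k + 1)` are bounded uniformly in `k ∈ ℕ` and in `μ` on bounded sets,
because `|μ + k + 1| ≥ 1` for all but finitely many `k`. -/
lemma exists_invGamma_bound (R : ℝ) :
    ∃ C, ∀ (k : ℕ) (μ : ℂ), ‖μ‖ ≤ R → ‖invGamma (μ + k + 1)‖ ≤ C := by
  have h1 : ∀ k : ℕ, ∃ M, ∀ μ ∈ Metric.closedBall (0 : ℂ) R, ‖invGamma (μ + k + 1)‖ ≤ M :=
    fun k => (isCompact_closedBall (0 : ℂ) R).exists_bound_of_continuousOn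
      (differentiable_invGamma.continuous.comp (by fun_prop)).continuousOn
  choose M hM using h1
  obtain ⟨K, hK⟩ := exists_nat_ge R
  have hle : ∀ k ≤ K, ∀ μ : ℂ, ‖μ‖ ≤ R →
      ‖invGamma (μ + k + 1)‖ ≤ ∑ i ∈ Finset.range (K + 1), |M i| := fun k hk μ hμ =>
    ((hM k μ (by simpa using hμ)).trans (le_abs_self _)).trans
      (Finset.single_le_sum (f := fun i => |M i|) (fun i _ => abs_nonneg _)
        (Finset.mem_range.mpr (by omega)))
  refine ⟨∑ i ∈ Finset.range (K + 1), |M i|, fun k μ hμ => ?_⟩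
  rcases le_total k K with hk | hk
  · exact hle k hk μ hμ
  · induction k, hk using Nat.le_induction with
    | base => exact hle K le_rfl μ hμ
    | succ k hk ih =>
      refine le_trans ?_ ih
      rw [invGamma_eq (μ + k + 1), norm_mul]
      push_cast
      rw [show μ + (k + 1) + 1 = μ + k + 1 + 1 by ring]
      refine le_mul_of_one_le_left (norm_nonneg _) ?_
      have h2 : ((k : ℝ) + 1) ≤ ‖μ + k + 1‖ + ‖μ‖ := by
        have := norm_sub_le (μ + k + 1) μ
        have h3 : μ + k + 1 - μ = ((k + 1 : ℕ) : ℂ) := by push_cast; ring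
        rw [h3, Complex.norm_natCast] at this
        exact_mod_cast this
      have : (K : ℝ) ≤ k := by exact_mod_cast hk
      linarith

/-- Cauchy's estimate carries the bound over to the derivative. -/
lemma exists_deriv_invGamma_bound (R : ℝ) :
    ∃ C, ∀ (k : ℕ) (μ : ℂ), ‖μ‖ ≤ R → ‖deriv invGamma (μ + k + 1)‖ ≤ C := by
  obtain ⟨C, hC⟩ := exists_invGamma_bound (R + 1)
  refine ⟨C / 1, fun k μ hμ => Complex.norm_deriv_le_of_forall_mem_sphere_norm_le one_pos
    differentiable_invGamma.diffContOnCl fun z hz => ?_⟩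
  have h1 : z = (z - (k + 1)) + k + 1 := by ring
  rw [h1]
  refine hC k _ ?_
  rw [mem_sphere_iff_norm] at hz
  calc ‖z - (k + 1)‖ = ‖μ + (z - (μ + k + 1))‖ := by congr 1; ring
    _ ≤ ‖μ‖ + ‖z - (μ + k + 1)‖ := norm_add_le _ _
    _ ≤ R + 1 := by rw [hz]; linarith

/-- The entire function `F_ν(w) = ∑ₖ (-w)ᵏ / (k! Γ(ν + k + 1))`, for which
`J_ν(z) = (z/2)^ν F_ν(z²/4)`. -/
noncomputable def besselF (ν w : ℂ) : ℂ := expSeries (fun k => invGamma (ν + k + 1)) w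

/-- The derivative of `F_ν(w)` with respect to the parameter `ν`. -/
noncomputable def besselG (ν w : ℂ) : ℂ := expSeries (fun k => deriv invGamma (ν + k + 1)) w

lemma besselF_shift (ν w : ℂ) :
    expSeries (fun k => invGamma (ν + (k + 1 : ℕ) + 1)) w = besselF (ν + 1) w := by
  simp only [besselF]
  congr 1; funext k; congr 1; push_cast; ring

lemma besselG_shift (ν w : ℂ) :
    expSeries (fun k => deriv invGamma (ν + (k + 1 : ℕ) + 1)) w = besselG (ν + 1) w := by
  simp only [besselG]
  congr 1; funext k; congr 1; push_cast; ring

lemma hasDerivAt_besselF (ν w : ℂ) : HasDerivAt (besselF ν) (-besselF (ν + 1) w) w := by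
  obtain ⟨C, hC⟩ := exists_invGamma_bound ‖ν‖
  rw [← besselF_shift]
  exact hasDerivAt_expSeries (fun k => hC k ν le_rfl) w

lemma hasDerivAt_besselG (ν w : ℂ) : HasDerivAt (besselG ν) (-besselG (ν + 1) w) w := by
  obtain ⟨C, hC⟩ := exists_deriv_invGamma_bound ‖ν‖
  rw [← besselG_shift]
  exact hasDerivAt_expSeries (fun k => hC k ν le_rfl) w

lemma besselF_recursion (ν w : ℂ) :
    besselF ν w = (ν + 1) * besselF (ν + 1) w - w * besselF (ν + 2) w := by
  obtain ⟨C, hC⟩ := exists_invGamma_bound ‖ν‖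
  have h := expSeries_recursion (c := fun k : ℕ => invGamma (ν + k + 1)) (d := 0) (D := 0) (ν := ν)
    (fun k => hC k ν le_rfl) (by simp) (fun k => by
      rw [invGamma_eq]; push_cast; simp [add_assoc, add_comm, add_left_comm]) w
  have h2 : expSeries (0 : ℕ → ℂ) w = 0 := by simp [expSeries]
  rw [h2, add_zero] at h
  refine h.trans ?_
  rw [besselF_shift]
  congr 2
  simp only [besselF]
  congr 1; funext k; congr 1; push_cast; ring

lemma besselG_recursion (ν w : ℂ) :
    besselG ν w = (ν + 1) * besselG (ν + 1) w - w * besselG (ν + 2) w + besselF (ν + 1) w := by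
  obtain ⟨C, hC⟩ := exists_deriv_invGamma_bound ‖ν‖
  obtain ⟨D, hD⟩ := exists_invGamma_bound ‖ν + 1‖
  have h := expSeries_recursion (c := fun k : ℕ => deriv invGamma (ν + k + 1))
    (d := fun k : ℕ => invGamma (ν + 1 + k + 1)) (ν := ν)
    (fun k => hC k ν le_rfl) (fun k => hD k _ le_rfl) (fun k => by
      rw [deriv_invGamma_eq]; push_cast; simp only [add_assoc, add_comm, add_left_comm]) w
  refine h.trans ?_
  rw [besselG_shift]
  congr 3
  simp only [besselG]
  congr 1; funext k; congr 1; push_cast; ring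

lemma besselF_zero (ν : ℂ) : besselF ν 0 = invGamma (ν + 1) := by
  simp [besselF, expSeries_zero]

lemma besselG_zero (ν : ℂ) : besselG ν 0 = deriv invGamma (ν + 1) := by
  simp [besselG, expSeries_zero]

lemma invGamma_one : invGamma 1 = 1 := by simp [invGamma]

lemma deriv_invGamma_zero : deriv invGamma 0 = 1 := by
  rw [deriv_invGamma_eq]; simp [invGamma_one]

lemma besselF_neg_one (w : ℂ) : besselF (-1) w = -w * besselF 1 w := by
  rw [besselF_recursion]; norm_num

/-- `F_ν(w)` is holomorphic in `ν`, with the termwise derivative. -/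
lemma hasDerivAt_besselF_param (ν w : ℂ) : HasDerivAt (fun μ => besselF μ w) (besselG ν w) ν := by
  obtain ⟨C, hC⟩ := exists_invGamma_bound (‖ν‖ + 1)
  have hU : IsOpen (Metric.ball (0 : ℂ) (‖ν‖ + 1)) := Metric.isOpen_ball
  have hν : ν ∈ Metric.ball (0 : ℂ) (‖ν‖ + 1) := by simp
  have hdk : ∀ (k : ℕ) (μ : ℂ),
      HasDerivAt (fun μ => invGamma (μ + k + 1) * ((-w) ^ k / (Nat.factorial k : ℂ)))
      (deriv invGamma (μ + k + 1) * ((-w) ^ k / (Nat.factorial k : ℂ))) μ := fun k μ => by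
    refine HasDerivAt.mul_const ?_ _
    have := (differentiable_invGamma (μ + (k + 1))).hasDerivAt.comp_add_const μ (k + 1)
    simpa only [add_assoc] using this
  have hdiff : ∀ k : ℕ, DifferentiableOn ℂ
      (fun μ => invGamma (μ + k + 1) * ((-w) ^ k / (Nat.factorial k : ℂ)))
      (Metric.ball (0 : ℂ) (‖ν‖ + 1)) := fun k z _ =>
    (hdk k z).differentiableAt.differentiableWithinAt
  have hb : ∀ (k : ℕ) (μ : ℂ), μ ∈ Metric.ball (0 : ℂ) (‖ν‖ + 1) →
      ‖invGamma (μ + k + 1) * ((-w) ^ k / (Nat.factorial k : ℂ))‖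
        ≤ C * (‖w‖ ^ k / (Nat.factorial k : ℝ)) := fun k μ hμ =>
    norm_expSeries_term_le (c := fun k => invGamma (μ + k + 1))
      (fun k => hC k μ (mem_ball_zero_iff.mp hμ).le) le_rfl k
  have h1 := Complex.hasSum_deriv_of_summable_norm (summable_bound C ‖w‖) hdiff hU hb hν
  have h2 := (Complex.differentiableOn_tsum_of_summable_norm (summable_bound C ‖w‖) hdiff hU
    hb).differentiableAt (hU.mem_nhds hν)
  refine h2.hasDerivAt.congr_deriv ?_
  rw [← h1.tsum_eq]
  simp only [(hdk _ _).deriv]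
  rfl

lemma besselJ_eq (ν z : ℂ) : besselJ ν z = (z / 2) ^ ν * besselF ν ((z / 2) ^ 2) := by
  rw [besselJ, besselF, expSeries]
  congr 2
  funext k
  rw [invGamma, neg_pow ((z / 2) ^ 2), ← pow_mul, div_eq_mul_inv, mul_inv, div_eq_mul_inv]
  ring

/-! ### Solutions of the form `x ^ (1/2 + m) g(x)` -/

/-- The function `x ^ (1/2 + m) g(x)`. -/
noncomputable def cpowMul (m : ℂ) (g : ℝ → ℂ) (x : ℝ) : ℂ := (x : ℂ) ^ (1 / 2 + m) * g x

/-- The derivative of `x ^ (1/2 + m) g(x)`, when `g₁` is the derivative of `g`. -/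
noncomputable def cpowMulDeriv (m : ℂ) (g g₁ : ℝ → ℂ) (x : ℝ) : ℂ :=
  (x : ℂ) ^ (1 / 2 + m) * ((1 / 2 + m) * g x / x + g₁ x)

lemma hasDerivAt_ofReal_cpow {s : ℂ} {x : ℝ} (hx : 0 < x) :
    HasDerivAt (fun x : ℝ => (x : ℂ) ^ s) (s * (x : ℂ) ^ s / x) x := by
  have hx0 : (x : ℂ) ≠ 0 := by exact_mod_cast hx.ne'
  have h := ((hasDerivAt_id (x : ℂ)).cpow_const (c := s)
    (Complex.ofReal_mem_slitPlane.mpr hx)).comp_ofReal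
  refine h.congr_deriv ?_
  rw [id, Complex.cpow_sub _ _ hx0, Complex.cpow_one]
  ring

lemma hasDerivAt_cpowMul {m : ℂ} {g g₁ : ℝ → ℂ} {x : ℝ} (hx : 0 < x)
    (h : HasDerivAt g (g₁ x) x) : HasDerivAt (cpowMul m g) (cpowMulDeriv m g g₁ x) x := by
  refine ((hasDerivAt_ofReal_cpow (s := 1 / 2 + m) hx).mul h).congr_deriv ?_
  rw [cpowMulDeriv]; ring

/-- The substitution `F = x ^ (1/2 + m) g` turns the homogeneous equation with `α = m²` into
`x g'' + (2 m + 1) g' + β g = 0`. -/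
lemma isStrong_cpowMul {β m : ℂ} {g g₁ g₂ : ℝ → ℂ} (h1 : ∀ x > 0, HasDerivAt g (g₁ x) x)
    (h2 : ∀ x > 0, HasDerivAt g₁ (g₂ x) x)
    (he : ∀ x : ℝ, 0 < x → (x : ℂ) * g₂ x + (2 * m + 1) * g₁ x + β * g x = 0) :
    IsStrong β (m ^ 2) (Ioi 0) (cpowMul m g) (cpowMulDeriv m g g₁) 0 := by
  refine IsStrong.of_hasDerivAt ordConnected_Ioi subset_rfl
    (fun x hx => hasDerivAt_cpowMul hx (h1 x hx)) (fun x hx => ?_) continuousOn_const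
  rw [mem_Ioi] at hx
  have hx0 : (x : ℂ) ≠ 0 := by exact_mod_cast hx.ne'
  have h3 := (hasDerivAt_ofReal_cpow (s := 1 / 2 + m) hx).mul
    ((((h1 x hx).const_mul (1 / 2 + m)).div (hasDerivAt_id x).ofReal_comp hx0).add (h2 x hx))
  refine h3.congr_deriv ?_
  have h4 := he x hx
  simp only [pot, cpowMul, Pi.add_apply, Pi.zero_apply, Pi.div_apply, id, Complex.ofReal_one]
  field_simp
  linear_combination 16 * (x : ℂ) ^ ((1 + 2 * m) / 2) * x * h4

lemma wronsk_cpowMul {m : ℂ} {p p₁ r r₁ : ℝ → ℂ} {x : ℝ} (hx : 0 < x) :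
    wronsk (cpowMul m p) (cpowMulDeriv m p p₁) (cpowMul (-m) r) (cpowMulDeriv (-m) r r₁) x
      = x * (p x * r₁ x - p₁ x * r x) - 2 * m * (p x * r x) := by
  have hx0 : (x : ℂ) ≠ 0 := by exact_mod_cast hx.ne'
  have h : (x : ℂ) ^ (1 / 2 + m) * (x : ℂ) ^ (1 / 2 + -m) = x := by
    rw [← Complex.cpow_add _ _ hx0, show 1 / 2 + m + (1 / 2 + -m) = 1 by ring, Complex.cpow_one]
  simp only [wronsk, cpowMul, cpowMulDeriv]
  linear_combination (p x * ((1 / 2 + -m) * r x / x + r₁ x) -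
    ((1 / 2 + m) * p x / x + p₁ x) * r x) * h + (-2 * m * (p x * r x)) * mul_inv_cancel₀ hx0

/-- The Wronskian of two solutions is determined by its limit at `0`. -/
lemma wronsk_eq_of_tendsto {β α : ℂ} {F F₁ G G₁ : ℝ → ℂ} (hF : IsStrong β α (Ioi 0) F F₁ 0)
    (hG : IsStrong β α (Ioi 0) G G₁ 0) {κ : ℂ}
    (h : Tendsto (wronsk F F₁ G G₁) (𝓝[>] 0) (𝓝 κ)) {x : ℝ} (hx : 0 < x) :
    wronsk F F₁ G G₁ x = κ := by
  refine tendsto_nhds_unique (tendsto_const_nhds.congr' ?_) h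
  filter_upwards [self_mem_nhdsWithin] with y hy
  exact hF.wronsk_eq hG ordConnected_Ioi isOpen_Ioi hx hy

/-- Two solutions with constant Wronskian `κ ≠ 0`, suitably normalized, form a solution pair. -/
lemma solutionPair_of_wronsk {β α : ℂ} {F F₁ G G₁ : ℝ → ℂ} (hF : IsStrong β α (Ioi 0) F F₁ 0)
    (hG : IsStrong β α (Ioi 0) G G₁ 0) {κ : ℂ} (hκ : κ ≠ 0)
    (h : ∀ x > 0, wronsk F F₁ G G₁ x = κ) {c : ℝ} (hc : 0 < c) :
    SolutionPair β α c F F₁ (fun x => κ⁻¹ * G x) (fun x => κ⁻¹ * G₁ x) where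
  pos := hc
  left := hF.mono Ioo_subset_Ioi_self
  right := by
    have := (hF.linearCombination hG ordConnected_Ioi 0 κ⁻¹).mono
      (show Ioo 0 c ⊆ Ioi 0 from Ioo_subset_Ioi_self)
    simpa using this
  wronsk_eq_one x hx := by
    have h1 := h x hx.1
    rw [wronsk] at h1 ⊢
    field_simp
    linear_combination h1

/-! ### The regular solution -/

lemma hasDerivAt_besselF_mul (β ν : ℂ) (x : ℝ) :
    HasDerivAt (fun x : ℝ => besselF ν (β * x)) (-β * besselF (ν + 1) (β * x)) x := by
  refine ((hasDerivAt_besselF ν (β * x)).comp (x : ℂ)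
    ((hasDerivAt_id (x : ℂ)).const_mul β)).comp_ofReal.congr_deriv ?_
  ring

lemma hasDerivAt_besselG_mul (β ν : ℂ) (x : ℝ) :
    HasDerivAt (fun x : ℝ => besselG ν (β * x)) (-β * besselG (ν + 1) (β * x)) x := by
  refine ((hasDerivAt_besselG ν (β * x)).comp (x : ℂ)
    ((hasDerivAt_id (x : ℂ)).const_mul β)).comp_ofReal.congr_deriv ?_
  ring

/-- The solution `x ^ (1/2 + m) F_{2m}(βx)`. -/
noncomputable def regSol (β m : ℂ) : ℝ → ℂ := cpowMul m fun x => besselF (2 * m) (β * x)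

/-- The derivative of `regSol`. -/
noncomputable def regSolDeriv (β m : ℂ) : ℝ → ℂ :=
  cpowMulDeriv m (fun x => besselF (2 * m) (β * x)) fun x => -β * besselF (2 * m + 1) (β * x)

lemma isStrong_regSol (β m : ℂ) :
    IsStrong β (m ^ 2) (Ioi 0) (regSol β m) (regSolDeriv β m) 0 := by
  refine isStrong_cpowMul (g₂ := fun x : ℝ => -β * (-β * besselF (2 * m + 1 + 1) (β * x)))
    (fun x _ => hasDerivAt_besselF_mul β _ x)
    (fun x _ => (hasDerivAt_besselF_mul β _ x).const_mul _) fun x _ => ?_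
  have := besselF_recursion (2 * m) (β * x)
  rw [show 2 * m + 1 + 1 = 2 * m + 2 by ring]
  linear_combination β * this

lemma continuous_besselF_mul (β ν : ℂ) : Continuous fun x : ℝ => besselF ν (β * x) :=
  continuous_iff_continuousAt.mpr fun x => (hasDerivAt_besselF_mul β ν x).continuousAt

/-- The Wronskian of the regular solutions for `m` and `-m`; it vanishes exactly when `2m` is an
integer. -/
lemma wronsk_regSol (β m : ℂ) {x : ℝ} (hx : 0 < x) :
    wronsk (regSol β m) (regSolDeriv β m) (regSol β (-m)) (regSolDeriv β (-m)) x
      = -2 * m * (invGamma (2 * m + 1) * invGamma (2 * -m + 1)) := by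
  have h2 := isStrong_regSol β (-m)
  rw [neg_sq] at h2
  refine wronsk_eq_of_tendsto (isStrong_regSol β m) h2 ?_ hx
  have hc : Continuous fun x : ℝ => (x : ℂ) * (besselF (2 * m) (β * x) *
      (-β * besselF (2 * -m + 1) (β * x)) - (-β * besselF (2 * m + 1) (β * x)) *
      besselF (2 * -m) (β * x)) - 2 * m * (besselF (2 * m) (β * x) * besselF (2 * -m) (β * x)) := by
    have h1 := fun ν => continuous_besselF_mul β ν
    exact (Complex.continuous_ofReal.mul (((h1 _).mul (continuous_const.mul (h1 _))).sub
      ((continuous_const.mul (h1 _)).mul (h1 _)))).sub (continuous_const.mul ((h1 _).mul (h1 _)))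
  have h3 := (hc.tendsto 0).mono_left (nhdsWithin_le_nhds (s := Ioi 0))
  simp only [Complex.ofReal_zero, mul_zero, zero_mul, zero_sub, besselF_zero] at h3
  rw [show -2 * m * (invGamma (2 * m + 1) * invGamma (2 * -m + 1))
    = -(2 * m * (invGamma (2 * m + 1) * invGamma (2 * -m + 1))) by ring]
  refine h3.congr' ?_
  filter_upwards [self_mem_nhdsWithin] with y hy
  exact (wronsk_cpowMul (m := m) (p := fun x : ℝ => besselF (2 * m) (β * x))
    (r := fun x : ℝ => besselF (2 * -m) (β * x))
    (p₁ := fun x : ℝ => -β * besselF (2 * m + 1) (β * x))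
    (r₁ := fun x : ℝ => -β * besselF (2 * -m + 1) (β * x)) hy).symm

lemma norm_ofReal_cpow {x : ℝ} (hx : 0 < x) (m : ℂ) :
    ‖(x : ℂ) ^ (1 / 2 + m)‖ = x ^ (1 / 2 + m.re) := by
  rw [Complex.norm_cpow_eq_rpow_re_of_pos hx]
  congr 1
  simp [Complex.add_re]

lemma exists_bound_regSol (β m : ℂ) : ∃ M, 0 ≤ M ∧ ∀ x ∈ Ioo (0 : ℝ) 1,
    ‖regSol β m x‖ ≤ M * x ^ (1 / 2 + m.re) ∧ ‖regSolDeriv β m x‖ ≤ M * x ^ (-1 / 2 + m.re) := by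
  obtain ⟨A, hA⟩ := (isCompact_Icc (a := (0 : ℝ)) (b := 1)).exists_bound_of_continuousOn
    (continuous_besselF_mul β (2 * m)).continuousOn
  obtain ⟨B, hB⟩ := (isCompact_Icc (a := (0 : ℝ)) (b := 1)).exists_bound_of_continuousOn
    (continuous_besselF_mul β (2 * m + 1)).continuousOn
  have hA0 : 0 ≤ A := (norm_nonneg _).trans (hA 0 ⟨le_rfl, zero_le_one⟩)
  have hB0 : 0 ≤ B := (norm_nonneg _).trans (hB 0 ⟨le_rfl, zero_le_one⟩)
  refine ⟨A + (‖1 / 2 + m‖ * A + ‖β‖ * B), by positivity, fun x hx => ?_⟩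
  have hA' := hA x ⟨hx.1.le, hx.2.le⟩
  have hB' := hB x ⟨hx.1.le, hx.2.le⟩
  constructor
  · rw [regSol, cpowMul, norm_mul, norm_ofReal_cpow hx.1, mul_comm]
    refine mul_le_mul_of_nonneg_right (hA'.trans ?_) (Real.rpow_nonneg hx.1.le _)
    have : 0 ≤ ‖1 / 2 + m‖ * A + ‖β‖ * B := by positivity
    linarith
  · rw [regSolDeriv, cpowMulDeriv, norm_mul, norm_ofReal_cpow hx.1,
      show (1 : ℝ) / 2 + m.re = (-1 / 2 + m.re) + 1 by ring, Real.rpow_add_one hx.1.ne', mul_assoc,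
      mul_comm]
    refine mul_le_mul_of_nonneg_right ?_ (Real.rpow_nonneg hx.1.le _)
    have h1 : x * ‖(1 / 2 + m) * besselF (2 * m) (β * x) / x + -β * besselF (2 * m + 1) (β * x)‖
        ≤ ‖1 / 2 + m‖ * A + x * (‖β‖ * B) := by
      calc _ ≤ x * (‖1 / 2 + m‖ * A / x + ‖β‖ * B) := by
            refine mul_le_mul_of_nonneg_left ((norm_add_le _ _).trans (add_le_add ?_ ?_)) hx.1.le
            · rw [norm_div, norm_mul, Complex.norm_real, Real.norm_of_nonneg hx.1.le]
              have := hx.1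
              gcongr
            · rw [norm_mul, norm_neg]
              gcongr
        _ = _ := by have := hx.1.ne'; field_simp
    have h2 : x * (‖β‖ * B) ≤ ‖β‖ * B := mul_le_of_le_one_left (by positivity) hx.2.le
    linarith

/-! ### The singular solution and its size -/

/-- Reduction of order: a solution `u` without zeros, of size `x ^ (1/2 + μ)`, has the companion
`v(x) = u(x) ∫_c^x u⁻²`, and the bounds on `u` are inherited by `v`. -/
lemma IsStrong.exists_pair_of_le {β α : ℂ} {u u₁ : ℝ → ℂ} {c μ M δ K : ℝ} {ℓ : ℝ → ℝ}
    (hu : IsStrong β α (Ioi 0) u u₁ 0) (hc : 0 < c) (hc1 : c ≤ 1) (hδ : 0 < δ) (hM : 0 ≤ M)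
    (hb : ∀ x ∈ Ioo 0 c, ‖u x‖ ≤ M * x ^ (1 / 2 + μ) ∧ ‖u₁ x‖ ≤ M * x ^ (-1 / 2 + μ))
    (hlow : ∀ x ∈ Ioc 0 c, δ * x ^ (1 / 2 + μ) ≤ ‖u x‖) (hK : 0 ≤ K)
    (hℓ : ∀ x ∈ Ioo 0 c, 1 ≤ ℓ x ∧ ∫ t in Ioc x c, t ^ (-1 - 2 * μ) ≤ K * (x ^ (-2 * μ) * ℓ x)) :
    ∃ C v v₁, 0 ≤ C ∧ SolutionPair β α c u u₁ v v₁ ∧ PairBounds c μ C ℓ u u₁ v v₁ := by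
  have hu0 : ∀ x ∈ Ioc 0 c, u x ≠ 0 := fun x hx => norm_pos_iff.mp
    ((mul_pos hδ (Real.rpow_pos_of_pos hx.1 _)).trans_le (hlow x hx))
  have hcu : ContinuousOn u (Ioi 0) := hu.continuousOn
  have hch : ContinuousOn (fun t => (u t ^ 2)⁻¹) (Ioc 0 c) :=
    ((hcu.mono Ioc_subset_Ioi_self).pow 2).inv₀ fun x hx => pow_ne_zero 2 (hu0 x hx)
  set H : ℝ → ℂ := fun x => ∫ t in c..x, (u t ^ 2)⁻¹ with hH
  have hint : ∀ x ∈ Ioo 0 c, IntervalIntegrable (fun t => (u t ^ 2)⁻¹) volume c x := fun x hx => by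
    refine ContinuousOn.intervalIntegrable (hch.mono ?_)
    rw [uIcc_of_ge hx.2.le]
    exact fun t ht => ⟨hx.1.trans_le ht.1, ht.2⟩
  have hHd : ∀ x ∈ Ioo 0 c, HasDerivAt H (u x ^ 2)⁻¹ x := fun x hx => by
    refine intervalIntegral.integral_hasDerivAt_right (hint x hx) ?_ ?_
    · exact (hch.mono Ioo_subset_Ioc_self).stronglyMeasurableAtFilter isOpen_Ioo x hx
    · exact hch.continuousAt (mem_of_superset (Ioo_mem_nhds hx.1 hx.2) Ioo_subset_Ioc_self)
  have hHb : ∀ x ∈ Ioo 0 c, ‖H x‖ ≤ δ⁻¹ ^ 2 * K * (x ^ (-2 * μ) * ℓ x) := fun x hx => by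
    have h1 : ‖H x‖ ≤ ∫ t in Ioc x c, δ⁻¹ ^ 2 * t ^ (-1 - 2 * μ) := by
      rw [hH]
      dsimp only
      rw [intervalIntegral.integral_symm, norm_neg, intervalIntegral.integral_of_le hx.2.le]
      refine norm_integral_le_of_norm_le ((integrableOn_rpow_Ioc_of_pos hx.1).const_mul _) ?_
      refine (ae_restrict_iff' measurableSet_Ioc).mpr (Eventually.of_forall fun t ht => ?_)
      have ht0 : 0 < t := hx.1.trans ht.1
      have h2 := hlow t ⟨ht0, ht.2⟩
      have h3 : 0 < δ * t ^ (1 / 2 + μ) := mul_pos hδ (Real.rpow_pos_of_pos ht0 _)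
      rw [norm_inv, norm_pow]
      calc (‖u t‖ ^ 2)⁻¹ ≤ ((δ * t ^ (1 / 2 + μ)) ^ 2)⁻¹ := by gcongr
        _ = δ⁻¹ ^ 2 * t ^ (-1 - 2 * μ) := by
          rw [mul_pow, mul_inv, inv_pow, ← Real.rpow_natCast (t ^ _), ← Real.rpow_mul ht0.le,
            ← Real.rpow_neg ht0.le]
          congr 2; push_cast; ring
    refine h1.trans ?_
    rw [integral_const_mul, mul_assoc]
    exact mul_le_mul_of_nonneg_left (hℓ x hx).2 (by positivity)
  refine ⟨M + (M * (δ⁻¹ ^ 2 * K) + δ⁻¹), fun x => u x * H x, fun x => u₁ x * H x + (u x)⁻¹,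
    by positivity, ⟨hc, hu.mono Ioo_subset_Ioi_self, ?_, ?_⟩, ⟨hc1, ?_, ?_, ?_, ?_⟩⟩
  · have hmono := hu.mono (show Ioo 0 c ⊆ Ioi 0 from Ioo_subset_Ioi_self)
    have hne : ∀ x ∈ Ioo 0 c, u x ≠ 0 := fun x hx => hu0 x ⟨hx.1, hx.2.le⟩
    have hHp : IsPrimitiveOn (Ioo 0 c) H fun x => (u x ^ 2)⁻¹ :=
      IsPrimitiveOn.of_hasDerivAt ordConnected_Ioo hHd (hch.mono Ioo_subset_Ioc_self)
    have hcu₁ : ContinuousOn u₁ (Ioo 0 c) :=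
      hmono.continuousOn_deriv ordConnected_Ioo isOpen_Ioo
    have hip : IsPrimitiveOn (Ioo 0 c) (fun x => (u x)⁻¹) fun x => -u₁ x / u x ^ 2 :=
      IsPrimitiveOn.of_hasDerivAt ordConnected_Ioo
        (fun x hx => (hmono.hasDerivAt x hx).inv (hne x hx))
        (hcu₁.neg.div (hmono.continuousOn.pow 2) fun x hx => pow_ne_zero 2 (hne x hx))
    refine ⟨fun x hx => ((hmono.hasDerivAt x hx).mul (hHd x hx)).congr_deriv ?_,
      ((hmono.prim.mul hHp ordConnected_Ioo).add hip).congr ordConnected_Ioo (fun _ _ => rfl)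
        fun x _ => ?_⟩
    · have := hne x hx
      field_simp
    · simp only [Pi.zero_apply]
      ring
  · intro x hx
    have := hu0 x ⟨hx.1, hx.2.le⟩
    rw [wronsk]
    field_simp
    ring
  all_goals intro x hx
  all_goals have hMnn : 0 ≤ M * (δ⁻¹ ^ 2 * K) + δ⁻¹ := by positivity
  all_goals obtain ⟨hb1, hb2⟩ := hb x hx
  all_goals have hx0 := hx.1
  · refine hb1.trans (mul_le_mul_of_nonneg_right (by linarith) (Real.rpow_nonneg hx0.le _))
  · refine hb2.trans (mul_le_mul_of_nonneg_right (by linarith) (Real.rpow_nonneg hx0.le _))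
  · have hℓ0 : 0 ≤ ℓ x := zero_le_one.trans (hℓ x hx).1
    have hm : x ^ (1 / 2 - μ) = x ^ (1 / 2 + μ) * x ^ (-2 * μ) := by
      rw [← Real.rpow_add hx0]; congr 1; ring
    rw [norm_mul]
    calc _ ≤ (M * x ^ (1 / 2 + μ)) * (δ⁻¹ ^ 2 * K * (x ^ (-2 * μ) * ℓ x)) :=
          mul_le_mul hb1 (hHb x hx) (norm_nonneg _) (by positivity)
      _ = (M * (δ⁻¹ ^ 2 * K)) * (x ^ (1 / 2 - μ) * ℓ x) := by rw [hm]; ring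
      _ ≤ _ := by
        refine mul_le_mul_of_nonneg_right ?_ (by positivity)
        have := inv_pos.mpr hδ
        linarith
  · have hℓ1 := (hℓ x hx).1
    have hm : x ^ (-1 / 2 - μ) = x ^ (-1 / 2 + μ) * x ^ (-2 * μ) := by
      rw [← Real.rpow_add hx0]; congr 1; ring
    have h1 : ‖u₁ x * H x‖ ≤ (M * (δ⁻¹ ^ 2 * K)) * (x ^ (-1 / 2 - μ) * ℓ x) := by
      rw [norm_mul]
      calc _ ≤ (M * x ^ (-1 / 2 + μ)) * (δ⁻¹ ^ 2 * K * (x ^ (-2 * μ) * ℓ x)) :=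
            mul_le_mul hb2 (hHb x hx) (norm_nonneg _) (by positivity)
        _ = _ := by rw [hm]; ring
    have h2 : ‖(u x)⁻¹‖ ≤ δ⁻¹ * (x ^ (-1 / 2 - μ) * ℓ x) := by
      have h3 : 0 < δ * x ^ (1 / 2 + μ) := mul_pos hδ (Real.rpow_pos_of_pos hx0 _)
      have h4 := hlow x ⟨hx0, hx.2.le⟩
      rw [norm_inv]
      calc ‖u x‖⁻¹ ≤ (δ * x ^ (1 / 2 + μ))⁻¹ := by gcongr
        _ = δ⁻¹ * x ^ (-1 / 2 - μ) := by
          rw [mul_inv, ← Real.rpow_neg hx0.le]; congr 2; ring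
        _ ≤ _ := by
          refine mul_le_mul_of_nonneg_left ?_ (inv_nonneg.mpr hδ.le)
          exact le_mul_of_one_le_right (by positivity) hℓ1
    refine (norm_add_le _ _).trans ((add_le_add h1 h2).trans ?_)
    rw [← add_mul]
    refine mul_le_mul_of_nonneg_right (by linarith) ?_
    have : 0 ≤ ℓ x := by linarith
    positivity

lemma invGamma_ne_zero {ν : ℂ} (h : 0 < ν.re) : invGamma ν ≠ 0 :=
  inv_ne_zero (Complex.Gamma_ne_zero_of_re_pos h)

/-- The regular solution does not vanish near `0`, because `F_{2m}(0) = 1 / Γ(2m + 1) ≠ 0`. -/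
lemma exists_regSol_lower (β : ℂ) {m : ℂ} (hm : 0 ≤ m.re) : ∃ δ > 0, ∀ᶠ c in 𝓝[>] (0 : ℝ),
    ∀ x ∈ Ioc 0 c, δ * x ^ (1 / 2 + m.re) ≤ ‖regSol β m x‖ := by
  have h0 : 0 < ‖besselF (2 * m) (β * (0 : ℝ))‖ := by
    rw [norm_pos_iff, Complex.ofReal_zero, mul_zero, besselF_zero]
    exact invGamma_ne_zero (by simp; linarith)
  refine ⟨‖besselF (2 * m) (β * (0 : ℝ))‖ / 2, half_pos h0, ?_⟩
  have h1 := (continuous_besselF_mul β (2 * m)).norm.continuousAt (x := 0)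
    |>.eventually (lt_mem_nhds (half_lt_self h0))
  obtain ⟨ε, hε, h2⟩ := Metric.eventually_nhds_iff.mp h1
  filter_upwards [Ioo_mem_nhdsGT hε] with c hc x hx
  have h3 := h2 (y := x) (by rw [Real.dist_0_eq_abs, abs_of_pos hx.1]; exact hx.2.trans_lt hc.2)
  rw [regSol, cpowMul, norm_mul, norm_ofReal_cpow hx.1, mul_comm]
  exact mul_le_mul_of_nonneg_left h3.le (Real.rpow_nonneg hx.1.le _)

lemma exists_pair_regSol (β : ℂ) {m : ℂ} (hm : 0 ≤ m.re) {K : ℝ} {ℓ : ℝ → ℝ} (hK : 0 ≤ K)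
    (hℓ : ∀ᶠ c in 𝓝[>] (0 : ℝ), ∀ x ∈ Ioo 0 c,
      1 ≤ ℓ x ∧ ∫ t in Ioc x c, t ^ (-1 - 2 * m.re) ≤ K * (x ^ (-2 * m.re) * ℓ x)) :
    ∃ c C u u₁ v v₁, 0 ≤ C ∧ SolutionPair β (m ^ 2) c u u₁ v v₁ ∧
      PairBounds c m.re C ℓ u u₁ v v₁ := by
  obtain ⟨δ, hδ, hlow⟩ := exists_regSol_lower β hm
  obtain ⟨M, hM, hb⟩ := exists_bound_regSol β m
  obtain ⟨c, h1, h2, h3⟩ := (hlow.and (hℓ.and (Ioo_mem_nhdsGT one_pos))).exists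
  obtain ⟨C, v, v₁, h⟩ := (isStrong_regSol β m).exists_pair_of_le h3.1 h3.2.le hδ hM
    (fun x hx => hb x ⟨hx.1, hx.2.trans h3.2⟩) h1 hK h2
  exact ⟨c, C, _, _, v, v₁, h⟩

/-- For `Re m > 0` the singular solution is of order `x ^ (1/2 - Re m)`. -/
lemma exists_pair_of_re_pos (β : ℂ) {m : ℂ} (hm : 0 < m.re) :
    ∃ c C u u₁ v v₁, 0 ≤ C ∧ SolutionPair β (m ^ 2) c u u₁ v v₁ ∧
      PairBounds c m.re C (fun _ => 1) u u₁ v v₁ := by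
  refine exists_pair_regSol β hm.le (K := (2 * m.re)⁻¹) (by positivity) ?_
  filter_upwards [] with c x hx
  refine ⟨le_rfl, (integral_rpow_Ioc_le (by linarith) hx.1 hx.2).trans (le_of_eq ?_)⟩
  rw [show -1 - 2 * m.re + 1 = -2 * m.re by ring]
  field_simp

/-- For `m = 0` the singular solution carries a logarithm. -/
lemma exists_pair_zero (β : ℂ) :
    ∃ c C u u₁ v v₁, 0 ≤ C ∧ SolutionPair β 0 c u u₁ v v₁ ∧
      PairBounds c 0 C (fun x => |Real.log x|) u u₁ v v₁ := by
  have := exists_pair_regSol β (m := 0) le_rfl (K := 1) (ℓ := fun x => |Real.log x|) zero_le_one ?_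
  · simpa using this
  -- below `exp (-1)` the factor `|log x|` is at least `1`
  filter_upwards [Ioo_mem_nhdsGT (Real.exp_pos (-1))] with c hc x hx
  have hx1 : Real.log x ≤ -1 :=
    (Real.log_le_log hx.1 (hx.2.le.trans hc.2.le)).trans_eq (Real.log_exp _)
  have hc1 : Real.log c ≤ -1 := (Real.log_le_log hc.1 hc.2.le).trans_eq (Real.log_exp _)
  have habs : |Real.log x| = -Real.log x := abs_of_nonpos (by linarith)
  refine ⟨by rw [habs]; linarith, ?_⟩
  simp only [Complex.zero_re, mul_zero, sub_zero, Real.rpow_zero, one_mul, Real.rpow_neg_one]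
  rw [← intervalIntegral.integral_of_le hx.2.le, integral_inv_of_pos hx.1 hc.1,
    Real.log_div hc.1.ne' hx.1.ne', habs]
  linarith

/-- For `Re m = 0`, `m ≠ 0`, both `regSol β m` and `regSol β (-m)` are of order `x ^ (1/2)`. -/
lemma exists_pair_of_re_eq_zero (β : ℂ) {m : ℂ} (hm : m.re = 0) (hm0 : m ≠ 0) :
    ∃ c C u u₁ v v₁, 0 ≤ C ∧ SolutionPair β (m ^ 2) c u u₁ v v₁ ∧
      PairBounds c m.re C (fun _ => 1) u u₁ v v₁ := by
  set κ := -2 * m * (invGamma (2 * m + 1) * invGamma (2 * -m + 1)) with hκd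
  have hκ : κ ≠ 0 := mul_ne_zero (mul_ne_zero (by norm_num) hm0)
    (mul_ne_zero (invGamma_ne_zero (by simp [hm])) (invGamma_ne_zero (by simp [hm])))
  have h2 := isStrong_regSol β (-m)
  rw [neg_sq] at h2
  obtain ⟨M, hM, hb⟩ := exists_bound_regSol β m
  obtain ⟨N, hN, hb'⟩ := exists_bound_regSol β (-m)
  refine ⟨1, M + ‖κ⁻¹‖ * N, _, _, _, _, by positivity, solutionPair_of_wronsk (isStrong_regSol β m)
    h2 hκ (fun x hx => wronsk_regSol β m hx) one_pos, le_rfl, ?_, ?_, ?_, ?_⟩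
  all_goals
    intro x hx
    have hn := mul_nonneg (norm_nonneg κ⁻¹) hN
    have hr : ∀ p : ℝ, 0 ≤ x ^ p := fun p => Real.rpow_nonneg hx.1.le p
    obtain ⟨h3, h4⟩ := hb x hx
    obtain ⟨h5, h6⟩ := hb' x hx
    simp only [hm, Complex.neg_re, neg_zero, add_zero, sub_zero, mul_one, norm_mul] at *
  · exact h3.trans (mul_le_mul_of_nonneg_right (by linarith) (hr _))
  · exact h4.trans (mul_le_mul_of_nonneg_right (by linarith) (hr _))
  · refine (mul_le_mul_of_nonneg_left h5 (norm_nonneg _)).trans ?_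
    rw [← mul_assoc]
    exact mul_le_mul_of_nonneg_right (by linarith) (hr _)
  · refine (mul_le_mul_of_nonneg_left h6 (norm_nonneg _)).trans ?_
    rw [← mul_assoc]
    exact mul_le_mul_of_nonneg_right (by linarith) (hr _)

lemma exists_pair_of_re_nonneg (β : ℂ) {m : ℂ} (hm : 0 ≤ m.re) (hm0 : m ≠ 0) :
    ∃ c C u u₁ v v₁, 0 ≤ C ∧ SolutionPair β (m ^ 2) c u u₁ v v₁ ∧
      PairBounds c m.re C (fun _ => 1) u u₁ v v₁ := by
  rcases hm.eq_or_lt with h | h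
  · exact exists_pair_of_re_eq_zero β h.symm hm0
  · exact exists_pair_of_re_pos β h

/-! ### Fundamental pairs and logarithmic solutions -/

/-- `F` and `G` are two solutions of `L u = 0` on `]0, ∞[` with nonzero Wronskian. -/
def IsFundamentalPair (β α : ℂ) (F G : ℝ → ℂ) : Prop :=
  ∃ F₁ G₁ κ, κ ≠ 0 ∧ IsStrong β α (Ioi 0) F F₁ 0 ∧ IsStrong β α (Ioi 0) G G₁ 0 ∧
    ∀ x > 0, wronsk F F₁ G G₁ x = κ

lemma IsStrong.congr_left {β α : ℂ} {s : Set ℝ} {F G F₁ w : ℝ → ℂ} (hF : IsStrong β α s F F₁ w)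
    (hs : s.OrdConnected) (ho : IsOpen s) (h : EqOn G F s) : IsStrong β α s G F₁ w where
  hasDerivAt x hx := (hF.hasDerivAt x hx).congr_of_eventuallyEq
    (eventually_of_mem (ho.mem_nhds hx) h)
  prim := hF.prim.congr hs (fun _ _ => rfl) fun x hx => by simp only [h hx]

lemma isFundamentalPair_of_continuous {β α : ℂ} {F F₁ G G₁ W : ℝ → ℂ}
    (hF : IsStrong β α (Ioi 0) F F₁ 0) (hG : IsStrong β α (Ioi 0) G G₁ 0) (hW : Continuous W)
    (h : ∀ x > 0, wronsk F F₁ G G₁ x = W x) (h0 : W 0 ≠ 0) : IsFundamentalPair β α F G := by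
  refine ⟨F₁, G₁, W 0, h0, hF, hG, fun x hx => wronsk_eq_of_tendsto hF hG ?_ hx⟩
  refine ((hW.tendsto 0).mono_left nhdsWithin_le_nhds).congr' ?_
  filter_upwards [self_mem_nhdsWithin] with y hy
  exact (h y hy).symm

/-- A triangular change of basis preserves fundamental pairs. -/
lemma IsFundamentalPair.of_eq {β α : ℂ} {F G J Y : ℝ → ℂ} (h : IsFundamentalPair β α F G)
    {a b d : ℂ} (ha : a ≠ 0) (hd : d ≠ 0) (hJ : ∀ x > 0, J x = a * F x)
    (hY : ∀ x > 0, Y x = b * F x + d * G x) : IsFundamentalPair β α J Y := by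
  obtain ⟨F₁, G₁, κ, hκ, hF, hG, hW⟩ := h
  have h1 := (hF.linearCombination hG ordConnected_Ioi a 0).congr_left (G := J) ordConnected_Ioi
    isOpen_Ioi fun x hx => by rw [hJ x hx]; ring
  have h2 := (hF.linearCombination hG ordConnected_Ioi b d).congr_left (G := Y) ordConnected_Ioi
    isOpen_Ioi fun x hx => by rw [hY x hx]
  refine ⟨_, _, a * d * κ, mul_ne_zero (mul_ne_zero ha hd) hκ, h1, h2, fun x hx => ?_⟩
  have h3 := hW x hx
  rw [wronsk] at h3 ⊢
  rw [hJ x hx, hY x hx]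
  linear_combination a * d * h3

/-- Two powers, for `β = 0`. -/
lemma isFundamentalPair_cpow {m : ℂ} (hm : m ≠ 0) :
    IsFundamentalPair 0 (m ^ 2) (cpowMul m fun _ => 1) (cpowMul (-m) fun _ => 1) := by
  have h : ∀ m : ℂ, IsStrong 0 (m ^ 2) (Ioi 0) (cpowMul m fun _ => 1)
      (cpowMulDeriv m (fun _ => 1) fun _ => 0) 0 := fun m =>
    isStrong_cpowMul (g₂ := fun _ => 0) (fun x _ => hasDerivAt_const x 1)
      (fun x _ => hasDerivAt_const x 0) fun x _ => by ring
  have h2 := h (-m)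
  rw [neg_sq] at h2
  refine ⟨_, _, -2 * m, mul_ne_zero (by norm_num) hm, h m, h2, fun x hx => ?_⟩
  rw [wronsk_cpowMul hx]
  ring

/-- When `2m` is not an integer, neither `2m + 1` nor `1 - 2m` is a pole of `Γ`. -/
lemma isFundamentalPair_regSol (β : ℂ) {m : ℂ} (hm : ∀ n : ℤ, 2 * m ≠ n) :
    IsFundamentalPair β (m ^ 2) (regSol β m) (regSol β (-m)) := by
  have h2 := isStrong_regSol β (-m)
  rw [neg_sq] at h2
  refine ⟨_, _, _, mul_ne_zero (mul_ne_zero (by norm_num) ?_) (mul_ne_zero ?_ ?_),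
    isStrong_regSol β m, h2, fun x hx => wronsk_regSol β m hx⟩
  · rintro rfl
    exact hm 0 (by simp)
  · refine inv_ne_zero fun h => ?_
    obtain ⟨k, hk⟩ := Complex.Gamma_eq_zero_iff _ |>.mp h
    exact hm (-k - 1) (by push_cast; linear_combination hk)
  · refine inv_ne_zero fun h => ?_
    obtain ⟨k, hk⟩ := Complex.Gamma_eq_zero_iff _ |>.mp h
    exact hm (k + 1) (by push_cast; linear_combination -hk)

lemma hasDerivAt_ofReal_log {x : ℝ} (hx : 0 < x) :
    HasDerivAt (fun x : ℝ => (Real.log x : ℂ)) (1 / x) x := by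
  refine (Real.hasDerivAt_log hx.ne').ofReal_comp.congr_deriv ?_
  push_cast; rw [one_div]

/-- The cofactor `g` in the logarithmic solution `x ^ (1/2) g(x)` for `m = 0`, obtained by
differentiating `x ^ m F_{2m}(βx)` with respect to `m`; the constant `k` is free. -/
noncomputable def logFactorZero (β k : ℂ) (x : ℝ) : ℂ :=
  (Real.log x / 2 + k) * besselF 0 (β * x) + besselG 0 (β * x)

/-- The Wronskian has the limit `F_0(0)² / 2` at `0`. -/
lemma isFundamentalPair_zero (β k : ℂ) :
    IsFundamentalPair β (0 ^ 2) (regSol β 0) (cpowMul 0 (logFactorZero β k)) := by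
  set p : ℝ → ℂ := fun x => besselF 0 (β * x) with hp
  set p₁ : ℝ → ℂ := fun x => -β * besselF 1 (β * x) with hp₁
  set p₂ : ℝ → ℂ := fun x => -β * (-β * besselF 2 (β * x)) with hp₂
  set r : ℝ → ℂ := fun x => besselG 0 (β * x) with hr
  set r₁ : ℝ → ℂ := fun x => -β * besselG 1 (β * x) with hr₁
  set r₂ : ℝ → ℂ := fun x => -β * (-β * besselG 2 (β * x)) with hr₂
  have dp : ∀ x, HasDerivAt p (p₁ x) x := fun x =>
    (hasDerivAt_besselF_mul β 0 x).congr_deriv (by simp [hp₁])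
  have dp₁ : ∀ x, HasDerivAt p₁ (p₂ x) x := fun x =>
    ((hasDerivAt_besselF_mul β 1 x).const_mul (-β)).congr_deriv (by norm_num [hp₂])
  have dr : ∀ x, HasDerivAt r (r₁ x) x := fun x =>
    (hasDerivAt_besselG_mul β 0 x).congr_deriv (by simp [hr₁])
  have dr₁ : ∀ x, HasDerivAt r₁ (r₂ x) x := fun x =>
    ((hasDerivAt_besselG_mul β 1 x).const_mul (-β)).congr_deriv (by norm_num [hr₂])
  have ep : ∀ x : ℝ, x * p₂ x + p₁ x + β * p x = 0 := fun x => by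
    have := besselF_recursion 0 (β * x)
    norm_num at this
    simp only [hp, hp₁, hp₂]
    linear_combination β * this
  have er : ∀ x : ℝ, x * r₂ x + r₁ x + β * r x = -p₁ x := fun x => by
    have := besselG_recursion 0 (β * x)
    norm_num at this
    simp only [hr, hp₁, hr₁, hr₂]
    linear_combination β * this
  have hreg : regSol β 0 = cpowMul 0 p := by simp [regSol, hp]
  have hlog : logFactorZero β k = fun x : ℝ => (Real.log x / 2 + k) * p x + r x := rfl
  have hp0 : p 0 = 1 := by simp [hp, besselF_zero, invGamma_one]
  clear_value p p₁ p₂ r r₁ r₂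
  rw [hreg, hlog]
  have hF := isStrong_cpowMul (β := β) (m := 0) (g := p) (g₁ := p₁) (g₂ := p₂)
    (fun x _ => dp x) (fun x _ => dp₁ x) fun x _ => by linear_combination ep x
  have hG := isStrong_cpowMul (β := β) (m := 0)
    (g := fun x : ℝ => (Real.log x / 2 + k) * p x + r x)
    (g₁ := fun x : ℝ => 1 / x / 2 * p x + (Real.log x / 2 + k) * p₁ x + r₁ x)
    (g₂ := fun x : ℝ => (-1 / x ^ 2 / 2 * p x + 1 / x / 2 * p₁ x) +
      (1 / x / 2 * p₁ x + (Real.log x / 2 + k) * p₂ x) + r₂ x)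
    (fun x hx => ?_) (fun x hx => ?_) fun x hx => ?_
  · refine isFundamentalPair_of_continuous hF hG
      (W := fun x : ℝ => p x ^ 2 / 2 + x * (p x * r₁ x - p₁ x * r x)) ?_ (fun x hx => ?_) ?_
    · have h1 : Continuous p := continuous_iff_continuousAt.mpr fun x => (dp x).continuousAt
      have h2 : Continuous p₁ := continuous_iff_continuousAt.mpr fun x => (dp₁ x).continuousAt
      have h3 : Continuous r := continuous_iff_continuousAt.mpr fun x => (dr x).continuousAt
      have h4 : Continuous r₁ := continuous_iff_continuousAt.mpr fun x => (dr₁ x).continuousAt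
      fun_prop
    · have := wronsk_cpowMul (m := 0) (p := p) (p₁ := p₁)
        (r := fun x : ℝ => (Real.log x / 2 + k) * p x + r x)
        (r₁ := fun x : ℝ => 1 / x / 2 * p x + (Real.log x / 2 + k) * p₁ x + r₁ x) hx
      rw [neg_zero] at this
      have hx0 : (x : ℂ) ≠ 0 := by exact_mod_cast hx.ne'
      rw [this]
      field_simp
      ring
    · simp [hp0]
  · exact (((hasDerivAt_ofReal_log hx).div_const 2).add_const k |>.mul (dp x)).add (dr x)
  · have hx0 : (x : ℂ) ≠ 0 := by exact_mod_cast hx.ne'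
    have hi : HasDerivAt (fun x : ℝ => 1 / (x : ℂ)) (-1 / x ^ 2) x := by
      have := (hasDerivAt_inv hx0).comp_ofReal
      simp only [one_div]
      exact this.congr_deriv (by ring)
    exact (((hi.div_const 2).mul (dp x)).add
      ((((hasDerivAt_ofReal_log hx).div_const 2).add_const k).mul (dp₁ x))).add (dr₁ x)
  · have hx0 : (x : ℂ) ≠ 0 := by exact_mod_cast hx.ne'
    field_simp
    linear_combination 2 * x * (Real.log x / 2 + k) * ep x + 2 * x * er x

/-- The cofactor `g` in the solution `x ^ 0 g(x)` with a logarithm for `m = ±1/2`, in terms of a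
square root `a` of `β`. The terms from `m = 1/2` and from `m = -1/2` do not solve the equation
separately. -/
noncomputable def logFactorHalf (a k : ℂ) (x : ℝ) : ℂ :=
  a * (x * ((Real.log x + k) * besselF 1 (a ^ 2 * x) + besselG 1 (a ^ 2 * x)))
    - a⁻¹ * besselG (-1) (a ^ 2 * x)

/-- The Wronskian has the limit `F_1(0) Ψ_{-1}(0) / a` at `0`, where `Ψ_ν = ∂_ν F_ν`; it is nonzero
because `1 / Γ` has a simple zero at `0`. -/
lemma isFundamentalPair_half {a : ℂ} (ha : a ≠ 0) (k : ℂ) :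
    IsFundamentalPair (a ^ 2) ((1 / 2) ^ 2) (regSol (a ^ 2) (1 / 2))
      (cpowMul (-(1 / 2)) (logFactorHalf a k)) := by
  obtain ⟨β, hβ⟩ : ∃ β, β = a ^ 2 := ⟨_, rfl⟩
  set p : ℝ → ℂ := fun x => besselF 1 (β * x) with hp
  set p₁ : ℝ → ℂ := fun x => -β * besselF 2 (β * x) with hp₁
  set p₂ : ℝ → ℂ := fun x => -β * (-β * besselF 3 (β * x)) with hp₂
  set r : ℝ → ℂ := fun x => besselG 1 (β * x) with hr
  set r₁ : ℝ → ℂ := fun x => -β * besselG 2 (β * x) with hr₁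
  set r₂ : ℝ → ℂ := fun x => -β * (-β * besselG 3 (β * x)) with hr₂
  set t : ℝ → ℂ := fun x => besselG (-1) (β * x) with ht
  set t₁ : ℝ → ℂ := fun x => -β * besselG 0 (β * x) with ht₁
  set t₂ : ℝ → ℂ := fun x => -β * (-β * besselG 1 (β * x)) with ht₂
  have dp : ∀ x, HasDerivAt p (p₁ x) x := fun x =>
    (hasDerivAt_besselF_mul β 1 x).congr_deriv (by norm_num [hp₁])
  have dp₁ : ∀ x, HasDerivAt p₁ (p₂ x) x := fun x =>
    ((hasDerivAt_besselF_mul β 2 x).const_mul (-β)).congr_deriv (by norm_num [hp₂])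
  have dr : ∀ x, HasDerivAt r (r₁ x) x := fun x =>
    (hasDerivAt_besselG_mul β 1 x).congr_deriv (by norm_num [hr₁])
  have dr₁ : ∀ x, HasDerivAt r₁ (r₂ x) x := fun x =>
    ((hasDerivAt_besselG_mul β 2 x).const_mul (-β)).congr_deriv (by norm_num [hr₂])
  have dt : ∀ x, HasDerivAt t (t₁ x) x := fun x =>
    (hasDerivAt_besselG_mul β (-1) x).congr_deriv (by norm_num [ht₁])
  have dt₁ : ∀ x, HasDerivAt t₁ (t₂ x) x := fun x =>
    ((hasDerivAt_besselG_mul β 0 x).const_mul (-β)).congr_deriv (by norm_num [ht₂])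
  have ep : ∀ x : ℝ, x * p₂ x + 2 * p₁ x + β * p x = 0 := fun x => by
    have := besselF_recursion 1 (β * x)
    norm_num at this
    simp only [hp, hp₁, hp₂]
    linear_combination β * this
  have er : ∀ x : ℝ, x * r₂ x + 2 * r₁ x + β * r x = -p₁ x := fun x => by
    have := besselG_recursion 1 (β * x)
    norm_num at this
    simp only [hr, hp₁, hr₁, hr₂]
    linear_combination β * this
  have et : ∀ x : ℝ, x * t₂ x + β * t x = β * (p x + x * p₁ x) := fun x => by
    have h1 := besselG_recursion (-1) (β * x)
    have h2 := besselF_recursion 0 (β * x)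
    norm_num at h1 h2
    simp only [hp, hp₁, ht, ht₂]
    linear_combination β * h1 + β * h2
  have hreg : regSol (a ^ 2) (1 / 2) = cpowMul (1 / 2) p := by
    rw [← hβ]; simp [regSol, hp]
  have hlog : logFactorHalf a k = fun x : ℝ =>
      a * (x * ((Real.log x + k) * p x + r x)) - a⁻¹ * t x := by
    funext x
    simp only [logFactorHalf, ← hβ, hp, hr, ht]
  have hp0 : p 0 = 1 := by
    have := invGamma_eq 1
    rw [invGamma_one, one_mul] at this
    simp only [hp, Complex.ofReal_zero, mul_zero, besselF_zero]
    exact this.symm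
  have ht0 : t 0 = 1 := by simp [ht, besselG_zero, deriv_invGamma_zero]
  clear_value p p₁ p₂ r r₁ r₂ t t₁ t₂
  rw [hreg, hlog, ← hβ]
  have hF := isStrong_cpowMul (β := β) (m := 1 / 2) (g := p) (g₁ := p₁) (g₂ := p₂)
    (fun x _ => dp x) (fun x _ => dp₁ x) fun x _ => by linear_combination ep x
  have hG := isStrong_cpowMul (β := β) (m := -(1 / 2))
    (g := fun x : ℝ => a * (x * ((Real.log x + k) * p x + r x)) - a⁻¹ * t x)
    (g₁ := fun x : ℝ => a * (1 * ((Real.log x + k) * p x + r x) +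
      x * (1 / x * p x + (Real.log x + k) * p₁ x + r₁ x)) - a⁻¹ * t₁ x)
    (g₂ := fun x : ℝ => a * (1 / x * p x + (Real.log x + k) * p₁ x + r₁ x +
      (p₁ x + (1 * ((Real.log x + k) * p₁ x + r₁ x) +
        x * (1 / x * p₁ x + (Real.log x + k) * p₂ x + r₂ x)))) - a⁻¹ * t₂ x)
    (fun x hx => ?_) (fun x hx => ?_) fun x hx => ?_
  · rw [neg_sq] at hG
    refine isFundamentalPair_of_continuous hF hG
      (W := fun x : ℝ => p x * (a * (x * (p x + x * r₁ x)) - a⁻¹ * (x * t₁ x) + a⁻¹ * t x)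
        - x * (p₁ x * (a * (x * r x) - a⁻¹ * t x))) ?_ (fun x hx => ?_) ?_
    · have h1 : Continuous p := continuous_iff_continuousAt.mpr fun x => (dp x).continuousAt
      have h2 : Continuous p₁ := continuous_iff_continuousAt.mpr fun x => (dp₁ x).continuousAt
      have h3 : Continuous r := continuous_iff_continuousAt.mpr fun x => (dr x).continuousAt
      have h4 : Continuous r₁ := continuous_iff_continuousAt.mpr fun x => (dr₁ x).continuousAt
      have h5 : Continuous t := continuous_iff_continuousAt.mpr fun x => (dt x).continuousAt
      have h6 : Continuous t₁ := continuous_iff_continuousAt.mpr fun x => (dt₁ x).continuousAt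
      fun_prop
    · have hx0 : (x : ℂ) ≠ 0 := by exact_mod_cast hx.ne'
      rw [wronsk_cpowMul hx]
      field_simp
      ring
    · simp [hp0, ht0, ha]
  · exact (((hasDerivAt_id x).ofReal_comp.mul ((((hasDerivAt_ofReal_log hx).add_const k).mul
      (dp x)).add (dr x))).const_mul a).sub ((dt x).const_mul a⁻¹)
  · have hx0 : (x : ℂ) ≠ 0 := by exact_mod_cast hx.ne'
    have h1 : HasDerivAt (fun x : ℝ => (Real.log x + k) * p x + r x)
        (1 / x * p x + (Real.log x + k) * p₁ x + r₁ x) x :=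
      (((hasDerivAt_ofReal_log hx).add_const k).mul (dp x)).add (dr x)
    have h2 : HasDerivAt (fun x : ℝ => (Real.log x + k) * p₁ x + r₁ x)
        (1 / x * p₁ x + (Real.log x + k) * p₂ x + r₂ x) x :=
      (((hasDerivAt_ofReal_log hx).add_const k).mul (dp₁ x)).add (dr₁ x)
    have h3 := ((h1.add ((dp x).add ((hasDerivAt_id x).ofReal_comp.mul h2))).const_mul a).sub
      ((dt₁ x).const_mul a⁻¹)
    refine (h3.congr_deriv ?_).congr_of_eventuallyEq ?_
    · simp
    · filter_upwards [lt_mem_nhds hx] with y hy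
      have hy0 : (y : ℂ) ≠ 0 := by exact_mod_cast (ne_of_gt hy)
      simp only [Pi.add_apply, Pi.sub_apply, Pi.mul_apply, id]
      field_simp
      ring
  · have hx0 : (x : ℂ) ≠ 0 := by exact_mod_cast hx.ne'
    have h := et x
    have hβ' : a⁻¹ * β = a := by rw [hβ]; field_simp
    have e1 : (x : ℂ) * (1 / x * p x) = p x := by field_simp
    have e2 : (x : ℂ) * (1 / x * p₁ x) = p₁ x := by field_simp
    linear_combination a * x * (Real.log x + k) * ep x + a * x * er x - a⁻¹ * et x
      + a * e1 + a * x * e2 - (p x + x * p₁ x) * hβ'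

/-! ### The zero-energy solutions `j_{β,m}` and `y_{β,m}` -/

/-- The derivative of `J_ν(z)` with respect to the order. -/
noncomputable def besselJParamDeriv (ν z : ℂ) : ℂ :=
  (z / 2) ^ ν * (Complex.log (z / 2) * besselF ν ((z / 2) ^ 2) + besselG ν ((z / 2) ^ 2))

lemma hasDerivAt_besselJ_param (ν : ℂ) {z : ℂ} (hz : z ≠ 0) :
    HasDerivAt (fun μ => besselJ μ z) (besselJParamDeriv ν z) ν := by
  have hz2 : z / 2 ≠ 0 := div_ne_zero hz two_ne_zero
  have h1 := ((hasDerivAt_id ν).const_cpow (c := z / 2) (Or.inl hz2)).mul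
    (hasDerivAt_besselF_param ν ((z / 2) ^ 2))
  simp only [funext fun μ => besselJ_eq μ z]
  refine h1.congr_deriv ?_
  simp only [besselJParamDeriv, id]
  ring

/-- The limiting value defining `Y_ν` at an integer `ν`, where `σ = cos(πν) = ±1`. -/
lemma besselY_of_int {ν σ z : ℂ} (hz : z ≠ 0) (hν : ∃ n : ℤ, ν = n)
    (hcos : Complex.cos (Real.pi * ν) = σ) (hsin : Complex.sin (Real.pi * ν) = 0)
    (hσ : σ ^ 2 = 1) (hJ : besselJ (-ν) z = σ * besselJ ν z) :
    besselY ν z = (besselJParamDeriv ν z + σ * besselJParamDeriv (-ν) z) / Real.pi := by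
  have hσ0 : σ ≠ 0 := by rintro rfl; norm_num at hσ
  have hpi : (Real.pi : ℂ) ≠ 0 := by exact_mod_cast Real.pi_ne_zero
  rw [besselY, if_pos hν]
  have hlin : HasDerivAt (fun μ : ℂ => (Real.pi : ℂ) * μ) Real.pi ν := by
    simpa using (hasDerivAt_id ν).const_mul (Real.pi : ℂ)
  have hS : HasDerivAt (fun μ : ℂ => Complex.sin (Real.pi * μ)) (σ * Real.pi) ν := by
    have := hlin.csin
    rwa [hcos] at this
  have hC : HasDerivAt (fun μ : ℂ => Complex.cos (Real.pi * μ)) 0 ν := by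
    have := hlin.ccos
    rwa [hsin, neg_zero, zero_mul] at this
  have hN : HasDerivAt (fun μ : ℂ => Complex.cos (Real.pi * μ) * besselJ μ z - besselJ (-μ) z)
      (σ * besselJParamDeriv ν z + besselJParamDeriv (-ν) z) ν := by
    have h1 := (hC.mul (hasDerivAt_besselJ_param ν hz)).sub
      ((hasDerivAt_besselJ_param (-ν) hz).comp ν (hasDerivAt_neg ν))
    refine h1.congr_deriv ?_
    rw [hcos]; ring
  have hN0 : Complex.cos (Real.pi * ν) * besselJ ν z - besselJ (-ν) z = 0 := by
    rw [hcos, hJ, sub_self]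
  -- numerator and denominator vanish at `ν`, so the quotient is a quotient of slopes
  have hlim := (hasDerivAt_iff_tendsto_slope.mp hN).div (hasDerivAt_iff_tendsto_slope.mp hS)
    (mul_ne_zero hσ0 hpi)
  have hval : (σ * besselJParamDeriv ν z + besselJParamDeriv (-ν) z) / (σ * Real.pi)
      = (besselJParamDeriv ν z + σ * besselJParamDeriv (-ν) z) / Real.pi := by
    rw [div_eq_div_iff (mul_ne_zero hσ0 hpi) hpi]
    linear_combination -(Real.pi : ℂ) * besselJParamDeriv (-ν) z * hσ
  rw [← hval]
  refine Tendsto.limUnder_eq (hlim.congr' ?_)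
  filter_upwards [self_mem_nhdsWithin] with μ hμ
  have hμ0 : (μ - ν)⁻¹ ≠ 0 := inv_ne_zero (sub_ne_zero.mpr hμ)
  simp only [Pi.div_apply, slope, vsub_eq_sub, smul_eq_mul]
  rw [hN0, hsin, sub_zero, sub_zero, mul_div_mul_left _ _ hμ0]
  rfl

section SquareRoot

/-- Half the logarithm of `β`. -/
noncomputable def halfLog (β : ℂ) : ℂ := Complex.log β / 2

variable {β : ℂ} {x : ℝ}

lemma exp_halfLog_sq (hβ : β ≠ 0) : Complex.exp (halfLog β) ^ 2 = β := by
  rw [← Complex.exp_nat_mul, halfLog, show ((2 : ℕ) : ℂ) * (Complex.log β / 2) = Complex.log β by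
    push_cast; ring, Complex.exp_log hβ]

lemma sqrt_mul_eq_exp (hβ : β ≠ 0) (hx : 0 < x) :
    (β * x) ^ (1 / 2 : ℂ) = Complex.exp (halfLog β + Real.log x / 2) := by
  have hx0 : (x : ℂ) ≠ 0 := by exact_mod_cast hx.ne'
  rw [Complex.cpow_def_of_ne_zero (mul_ne_zero hβ hx0), mul_comm β, Complex.log_ofReal_mul hx hβ,
    halfLog]
  congr 1; ring

/-- The principal logarithm of `√(βx)`; no branch is crossed because the imaginary part of
`log β / 2` is at most `π / 2`. -/
lemma log_sqrt_mul (hβ : β ≠ 0) (hx : 0 < x) :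
    Complex.log ((β * x) ^ (1 / 2 : ℂ)) = halfLog β + Real.log x / 2 := by
  have him : (halfLog β + Real.log x / 2).im = β.arg / 2 := by
    have h1 : ((Real.log x : ℂ) / 2) = ((Real.log x / 2 : ℝ) : ℂ) := by push_cast; rfl
    have h2 : halfLog β = ((1 / 2 : ℝ) : ℂ) * Complex.log β := by
      rw [halfLog]; push_cast; ring
    rw [h1, h2, Complex.add_im, Complex.ofReal_im, Complex.im_ofReal_mul, Complex.log_im]
    ring
  rw [sqrt_mul_eq_exp hβ hx, Complex.log_exp]
  · rw [him]; linarith [Complex.neg_pi_lt_arg β, Real.pi_pos]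
  · rw [him]; linarith [Complex.arg_le_pi β, Real.pi_pos]

lemma sqrt_mul_ne_zero (hβ : β ≠ 0) (hx : 0 < x) : (β * x) ^ (1 / 2 : ℂ) ≠ 0 := by
  rw [sqrt_mul_eq_exp hβ hx]; exact Complex.exp_ne_zero _

lemma sqrt_mul_sq (β : ℂ) (x : ℝ) : ((β * x) ^ (1 / 2 : ℂ)) ^ 2 = β * x := by
  rw [← Complex.cpow_nat_mul]; norm_num

/-- Powers of `√(βx)` split into a constant and a power of `x`. -/
lemma sqrt_mul_cpow (hβ : β ≠ 0) (hx : 0 < x) (ν : ℂ) :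
    ((β * x) ^ (1 / 2 : ℂ)) ^ ν = Complex.exp (halfLog β * ν) * (x : ℂ) ^ (ν / 2) := by
  have hx0 : (x : ℂ) ≠ 0 := by exact_mod_cast hx.ne'
  rw [Complex.cpow_def_of_ne_zero (sqrt_mul_ne_zero hβ hx), log_sqrt_mul hβ hx,
    Complex.cpow_def_of_ne_zero hx0, ← Complex.exp_add, Complex.ofReal_log hx.le]
  congr 1; ring

/-- The constant in front of the Bessel functions for dimension one. -/
noncomputable def prefactor (β : ℂ) : ℂ := Complex.exp ((Real.log Real.pi + halfLog β) / 2)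

lemma prefactor_eq (hβ : β ≠ 0) (hx : 0 < x) :
    (x : ℂ) ^ (1 / 4 : ℂ) * (Real.pi * (2 * (β * x) ^ (1 / 2 : ℂ)) / 2) ^ (1 / 2 : ℂ)
      = prefactor β * (x : ℂ) ^ (1 / 2 : ℂ) := by
  have hx0 : (x : ℂ) ≠ 0 := by exact_mod_cast hx.ne'
  rw [show (Real.pi : ℂ) * (2 * (β * x) ^ (1 / 2 : ℂ)) / 2 = Real.pi * (β * x) ^ (1 / 2 : ℂ) by
    ring, Complex.cpow_def_of_ne_zero (mul_ne_zero (by exact_mod_cast Real.pi_ne_zero)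
    (sqrt_mul_ne_zero hβ hx)), Complex.log_ofReal_mul Real.pi_pos (sqrt_mul_ne_zero hβ hx),
    log_sqrt_mul hβ hx, Complex.cpow_def_of_ne_zero hx0, Complex.cpow_def_of_ne_zero hx0, prefactor,
    ← Complex.exp_add, ← Complex.exp_add, Complex.ofReal_log hx.le]
  congr 1; ring

lemma zeroJ_eq (hβ : β ≠ 0) (hx : 0 < x) (m : ℂ) : zeroJ β m x
    = prefactor β * (x : ℂ) ^ (1 / 2 : ℂ) * besselJ (2 * m) (2 * (β * x) ^ (1 / 2 : ℂ)) := by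
  rw [zeroJ, if_neg hβ, besselJ1, ← mul_assoc, prefactor_eq hβ hx]

lemma zeroY_eq (hβ : β ≠ 0) (hx : 0 < x) (m : ℂ) : zeroY β m x
    = prefactor β * (x : ℂ) ^ (1 / 2 : ℂ) * besselY (2 * m) (2 * (β * x) ^ (1 / 2 : ℂ)) := by
  rw [zeroY, if_neg hβ, besselY1, ← mul_assoc, prefactor_eq hβ hx]

lemma besselJ_two_sqrt (hβ : β ≠ 0) (hx : 0 < x) (ν : ℂ) :
    besselJ ν (2 * (β * x) ^ (1 / 2 : ℂ))
      = Complex.exp (halfLog β * ν) * (x : ℂ) ^ (ν / 2) * besselF ν (β * x) := by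
  rw [besselJ_eq, mul_div_cancel_left₀ _ (two_ne_zero' ℂ), sqrt_mul_sq, sqrt_mul_cpow hβ hx]

lemma besselJParamDeriv_two_sqrt (hβ : β ≠ 0) (hx : 0 < x) (ν : ℂ) :
    besselJParamDeriv ν (2 * (β * x) ^ (1 / 2 : ℂ))
      = Complex.exp (halfLog β * ν) * (x : ℂ) ^ (ν / 2) *
        ((halfLog β + Real.log x / 2) * besselF ν (β * x) + besselG ν (β * x)) := by
  rw [besselJParamDeriv, mul_div_cancel_left₀ _ (two_ne_zero' ℂ), sqrt_mul_sq,
    sqrt_mul_cpow hβ hx, log_sqrt_mul hβ hx]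

lemma sqrt_mul_besselJ (hβ : β ≠ 0) (hx : 0 < x) (m : ℂ) :
    (x : ℂ) ^ (1 / 2 : ℂ) * besselJ (2 * m) (2 * (β * x) ^ (1 / 2 : ℂ))
      = Complex.exp (halfLog β * (2 * m)) * regSol β m x := by
  have hx0 : (x : ℂ) ≠ 0 := by exact_mod_cast hx.ne'
  rw [besselJ_two_sqrt hβ hx, regSol, cpowMul, Complex.cpow_add _ _ hx0,
    mul_div_cancel_left₀ _ (two_ne_zero' ℂ)]
  ring

lemma zeroJ_eq_regSol (hβ : β ≠ 0) (hx : 0 < x) (m : ℂ) :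
    zeroJ β m x = prefactor β * Complex.exp (halfLog β * (2 * m)) * regSol β m x := by
  rw [zeroJ_eq hβ hx, mul_assoc, sqrt_mul_besselJ hβ hx, mul_assoc]

end SquareRoot

lemma prefactor_ne_zero (β : ℂ) : prefactor β ≠ 0 := Complex.exp_ne_zero _

lemma isFundamentalPair_zeroJ_zeroY_of_not_int {β m : ℂ} (hβ : β ≠ 0) (hm : ∀ n : ℤ, 2 * m ≠ n) :
    IsFundamentalPair β (m ^ 2) (zeroJ β m) (zeroY β m) := by
  have hsin : Complex.sin (Real.pi * (2 * m)) ≠ 0 := fun h => by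
    obtain ⟨k, hk⟩ := Complex.sin_eq_zero_iff.mp h
    refine hm k (mul_left_cancel₀ (show (Real.pi : ℂ) ≠ 0 by exact_mod_cast Real.pi_ne_zero) ?_)
    rw [hk, mul_comm]
  refine (isFundamentalPair_regSol β hm).of_eq
    (a := prefactor β * Complex.exp (halfLog β * (2 * m)))
    (b := prefactor β * (Complex.cos (Real.pi * (2 * m)) * Complex.exp (halfLog β * (2 * m))) /
      Complex.sin (Real.pi * (2 * m)))
    (d := -(prefactor β * Complex.exp (halfLog β * (2 * -m))) / Complex.sin (Real.pi * (2 * m)))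
    (mul_ne_zero (prefactor_ne_zero β) (Complex.exp_ne_zero _))
    (div_ne_zero (neg_ne_zero.mpr (mul_ne_zero (prefactor_ne_zero β) (Complex.exp_ne_zero _))) hsin)
    (fun x hx => zeroJ_eq_regSol hβ hx m) fun x hx => ?_
  rw [zeroY_eq hβ hx, besselY, if_neg (by rintro ⟨n, hn⟩; exact hm n hn), neumannQuotient]
  have h1 := sqrt_mul_besselJ hβ hx m
  have h2 := sqrt_mul_besselJ hβ hx (-m)
  rw [show -(2 * m) = 2 * -m by ring]
  generalize Complex.sin (Real.pi * (2 * m)) = S at *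
  generalize Complex.exp (halfLog β * (2 * m)) = E at *
  generalize Complex.exp (halfLog β * (2 * -m)) = E' at *
  generalize Complex.cos (Real.pi * (2 * m)) = T at *
  generalize besselJ (2 * -m) _ = J' at *
  field_simp
  linear_combination prefactor β * T * h1 - prefactor β * h2

lemma isFundamentalPair_zeroJ_zeroY_zero {β : ℂ} (hβ : β ≠ 0) :
    IsFundamentalPair β (0 ^ 2) (zeroJ β 0) (zeroY β 0) := by
  have hpi : (Real.pi : ℂ) ≠ 0 := by exact_mod_cast Real.pi_ne_zero
  refine (isFundamentalPair_zero β (halfLog β)).of_eq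
    (a := prefactor β * Complex.exp (halfLog β * (2 * 0))) (b := 0)
    (d := prefactor β * 2 / Real.pi)
    (mul_ne_zero (prefactor_ne_zero β) (Complex.exp_ne_zero _))
    (div_ne_zero (mul_ne_zero (prefactor_ne_zero β) two_ne_zero) hpi)
    (fun x hx => zeroJ_eq_regSol hβ hx 0) fun x hx => ?_
  have hz := mul_ne_zero (two_ne_zero' ℂ) (sqrt_mul_ne_zero hβ hx)
  rw [zeroY_eq hβ hx, mul_zero, besselY_of_int (σ := 1) hz ⟨0, by simp⟩ (by simp) (by simp)
    (by simp) (by simp), neg_zero, besselJParamDeriv_two_sqrt hβ hx, cpowMul, logFactorZero]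
  simp only [mul_zero, zero_div, add_zero, Complex.exp_zero, Complex.cpow_zero]
  field_simp
  ring

/-- The relation `J_{-1} = -J_1`, from `F_{-1}(w) = -w F_1(w)`. -/
lemma besselJ_neg_one {β : ℂ} {x : ℝ} (hβ : β ≠ 0) (hx : 0 < x) :
    besselJ (-1) (2 * (β * x) ^ (1 / 2 : ℂ)) = -besselJ 1 (2 * (β * x) ^ (1 / 2 : ℂ)) := by
  have hω := sqrt_mul_ne_zero hβ hx
  rw [besselJ_eq, besselJ_eq, mul_div_cancel_left₀ _ (two_ne_zero' ℂ), besselF_neg_one,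
    Complex.cpow_neg_one, Complex.cpow_one]
  field_simp

lemma isFundamentalPair_zeroJ_zeroY_half {β : ℂ} (hβ : β ≠ 0) :
    IsFundamentalPair β ((1 / 2) ^ 2) (zeroJ β (1 / 2)) (zeroY β (1 / 2)) := by
  have hpi : (Real.pi : ℂ) ≠ 0 := by exact_mod_cast Real.pi_ne_zero
  have h := isFundamentalPair_half (Complex.exp_ne_zero (halfLog β)) (2 * halfLog β)
  have hsq := exp_halfLog_sq hβ
  refine (hsq ▸ h).of_eq
    (a := prefactor β * Complex.exp (halfLog β * (2 * (1 / 2)))) (b := 0)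
    (d := prefactor β / Real.pi)
    (mul_ne_zero (prefactor_ne_zero β) (Complex.exp_ne_zero _))
    (div_ne_zero (prefactor_ne_zero β) hpi)
    (fun x hx => zeroJ_eq_regSol hβ hx (1 / 2)) fun x hx => ?_
  have hx0 : (x : ℂ) ≠ 0 := by exact_mod_cast hx.ne'
  have hz := mul_ne_zero (two_ne_zero' ℂ) (sqrt_mul_ne_zero hβ hx)
  rw [zeroY_eq hβ hx, show (2 : ℂ) * (1 / 2) = 1 by norm_num,
    besselY_of_int (σ := -1) hz ⟨1, by simp⟩ (by simp) (by simp)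
    (by simp) (by rw [besselJ_neg_one hβ hx]; ring), besselJParamDeriv_two_sqrt hβ hx,
    besselJParamDeriv_two_sqrt hβ hx, cpowMul, logFactorHalf, hsq, besselF_neg_one]
  have e1 : (x : ℂ) ^ (1 / 2 : ℂ) * (x : ℂ) ^ (1 / 2 : ℂ) = x := by
    rw [← Complex.cpow_add _ _ hx0, show (1 / 2 + 1 / 2 : ℂ) = 1 by norm_num, Complex.cpow_one]
  have e2 : (x : ℂ) ^ (1 / 2 : ℂ) * (x : ℂ) ^ (-1 / 2 : ℂ) = 1 := by
    rw [← Complex.cpow_add _ _ hx0, show (1 / 2 + -1 / 2 : ℂ) = 0 by norm_num, Complex.cpow_zero]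
  have e3 : Complex.exp (halfLog β * -1) = (Complex.exp (halfLog β))⁻¹ := by
    rw [← Complex.exp_neg]; congr 1; ring
  have e4 : (1 / 2 + -(1 / 2) : ℂ) = 0 := by norm_num
  rw [e3, e4, mul_one, Complex.cpow_zero]
  generalize (x : ℂ) ^ (1 / 2 : ℂ) = X at *
  generalize (x : ℂ) ^ (-1 / 2 : ℂ) = X' at *
  have hE : Complex.exp (halfLog β) ≠ 0 := Complex.exp_ne_zero _
  generalize Complex.exp (halfLog β) = E at *
  subst hsq
  field_simp
  linear_combination prefactor (E ^ 2) * E ^ 2 * ((halfLog (E ^ 2) * 2 + Real.log x) *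
    besselF 1 (E ^ 2 * x) + 2 * besselG 1 (E ^ 2 * x)) * e1 + prefactor (E ^ 2) *
    (E ^ 2 * (halfLog (E ^ 2) * 2 + Real.log x) * x * besselF 1 (E ^ 2 * x)
      - 2 * besselG (-1) (E ^ 2 * x)) * e2

/-- The pair for `m = -1/2` is the negative of the pair for `m = 1/2`. -/
lemma isFundamentalPair_zeroJ_zeroY_neg_half {β : ℂ} (hβ : β ≠ 0) :
    IsFundamentalPair β ((-(1 / 2)) ^ 2) (zeroJ β (-(1 / 2))) (zeroY β (-(1 / 2))) := by
  rw [neg_sq]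
  refine (isFundamentalPair_zeroJ_zeroY_half hβ).of_eq (a := -1) (b := 0) (d := -1)
    (by norm_num) (by norm_num) (fun x hx => ?_) fun x hx => ?_
  · rw [zeroJ_eq hβ hx, zeroJ_eq hβ hx, show (2 : ℂ) * -(1 / 2) = -1 by norm_num,
      show (2 : ℂ) * (1 / 2) = 1 by norm_num, besselJ_neg_one hβ hx]
    ring
  · have hz := mul_ne_zero (two_ne_zero' ℂ) (sqrt_mul_ne_zero hβ hx)
    rw [zeroY_eq hβ hx, zeroY_eq hβ hx, show (2 : ℂ) * -(1 / 2) = -1 by norm_num,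
      show (2 : ℂ) * (1 / 2) = 1 by norm_num,
      besselY_of_int (ν := 1) (σ := -1) hz ⟨1, by simp⟩ (by simp) (by simp)
        (by simp) (by rw [besselJ_neg_one hβ hx]; ring),
      besselY_of_int (ν := -1) (σ := -1) hz ⟨-1, by simp⟩ (by simp) (by simp)
        (by simp) (by rw [besselJ_neg_one hβ hx, neg_neg]; ring), neg_neg]
    ring

lemma isFundamentalPair_zeroJ_zeroY_of_beta_eq_zero (m : ℂ) :
    IsFundamentalPair 0 (m ^ 2) (zeroJ 0 m) (zeroY 0 m) := by
  rcases eq_or_ne m 0 with rfl | hm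
  · refine (isFundamentalPair_zero 0 0).of_eq (a := 1) (b := -2 * besselG 0 0) (d := 2) one_ne_zero
      two_ne_zero (fun x _ => ?_) fun x _ => ?_
    · simp [zeroJ, regSol, cpowMul, besselF_zero, invGamma_one]
    · simp [zeroY, regSol, cpowMul, logFactorZero, besselF_zero, invGamma_one]
      ring
  · refine (isFundamentalPair_cpow hm).of_eq (a := 1) (b := 0) (d := 1) one_ne_zero one_ne_zero
      (fun x _ => ?_) fun x _ => ?_
    · simp [zeroJ, cpowMul]
    · simp [zeroY, cpowMul, hm, sub_eq_add_neg]

/-- For `|Re m| < 1` the functions `j_{β,m}` and `y_{β,m}` are linearly independent solutions. The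
orders `2m ∈ {0, ±1}`, where `y_{β,m}` is a limit, are treated separately. -/
lemma isFundamentalPair_zeroJ_zeroY (β : ℂ) {m : ℂ} (hm : |m.re| < 1) :
    IsFundamentalPair β (m ^ 2) (zeroJ β m) (zeroY β m) := by
  rcases eq_or_ne β 0 with rfl | hβ
  · exact isFundamentalPair_zeroJ_zeroY_of_beta_eq_zero m
  by_cases h : ∀ n : ℤ, 2 * m ≠ n
  · exact isFundamentalPair_zeroJ_zeroY_of_not_int hβ h
  push Not at h
  obtain ⟨n, hn⟩ := h
  have hre : 2 * m.re = n := by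
    have := congrArg Complex.re hn
    simpa using this
  obtain ⟨h1, h2⟩ := abs_lt.mp hm
  have h3 : (-2 : ℝ) < n := by linarith
  have h4 : (n : ℝ) < 2 := by linarith
  have h5 : -2 < n := by exact_mod_cast h3
  have h6 : n < 2 := by exact_mod_cast h4
  have hmn : m = n / 2 := by rw [← hn]; ring
  interval_cases n
  · rw [show m = -(1 / 2) by rw [hmn]; push_cast; ring]
    exact isFundamentalPair_zeroJ_zeroY_neg_half hβ
  · rw [show m = 0 by rw [hmn]; simp]
    exact isFundamentalPair_zeroJ_zeroY_zero hβ
  · rw [show m = 1 / 2 by rw [hmn]; simp]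
    exact isFundamentalPair_zeroJ_zeroY_half hβ

/-! ### The domains of the minimal and maximal operators -/

/-- Only `m²` matters in the operator, so `Re m ≥ 0` may be assumed. -/
lemma exists_sq_eq_re_eq_abs (m : ℂ) : ∃ n : ℂ, n ^ 2 = m ^ 2 ∧ n.re = |m.re| := by
  rcases le_total 0 m.re with h | h
  · exact ⟨m, rfl, (abs_of_nonneg h).symm⟩
  · exact ⟨-m, neg_sq m, by rw [abs_of_nonpos h, Complex.neg_re]⟩

/-- For `|Re m| < 1` all solutions of the homogeneous equation are square integrable near `0`. -/
lemma exists_memLp_pair (β : ℂ) {m : ℂ} (hm : |m.re| < 1) :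
    ∃ c u u₁ v v₁, SolutionPair β (m ^ 2) c u u₁ v v₁ ∧
      MemLp u 2 (volume.restrict (Ioo 0 c)) ∧ MemLp v 2 (volume.restrict (Ioo 0 c)) := by
  rcases eq_or_ne m 0 with rfl | hm0
  · obtain ⟨c, C, u, u₁, v, v₁, hC, hp, hb⟩ := exists_pair_zero β
    rw [zero_pow two_ne_zero]
    exact ⟨c, u, u₁, v, v₁, hp, hb.memLp_left hp le_rfl, hb.memLp_right_log hp hC⟩
  · obtain ⟨n, hn, hre⟩ := exists_sq_eq_re_eq_abs m
    have hn0 : n ≠ 0 := by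
      rintro rfl
      exact hm0 (by simpa using hn.symm)
    obtain ⟨c, C, u, u₁, v, v₁, -, hp, hb⟩ :=
      exists_pair_of_re_nonneg β (hre ▸ abs_nonneg _) hn0
    rw [hn] at hp
    exact ⟨c, u, u₁, v, v₁, hp, hb.memLp_left hp (hre ▸ abs_nonneg _),
      hb.memLp_right hp (hre ▸ hm)⟩

/-- The functions `j_{β,m}` and `y_{β,m}`, the latter suitably normalized, form a pair of square
integrable solutions near `0`. -/
lemma exists_memLp_pair_zeroJ_zeroY (β : ℂ) {m : ℂ} (hm : |m.re| < 1) :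
    ∃ c κ J₁ Y₁, κ ≠ 0 ∧ SolutionPair β (m ^ 2) c (zeroJ β m) J₁ (fun x => κ⁻¹ * zeroY β m x) Y₁ ∧
      MemLp (zeroJ β m) 2 (volume.restrict (Ioo 0 c)) ∧
      MemLp (fun x => κ⁻¹ * zeroY β m x) 2 (volume.restrict (Ioo 0 c)) := by
  obtain ⟨c, u, u₁, v, v₁, hp, hu, hv⟩ := exists_memLp_pair β hm
  obtain ⟨J₁, Y₁, κ, hκ, hJ, hY, hW⟩ := isFundamentalPair_zeroJ_zeroY β hm
  have h := solutionPair_of_wronsk hJ hY hκ hW hp.pos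
  exact ⟨c, κ, J₁, _, hκ, h, hp.memLp_of_isStrong hu hv h.left, hp.memLp_of_isStrong hu hv h.right⟩

theorem regularity_and_decay (β α : ℂ) {f : L2Pos} (hf : f ∈ (Lmax β α).domain) :
    ∃ F : ℝ → ℂ, Represents F f ∧ ContDiffOn ℝ 1 F (Ioi 0) ∧ Tendsto F atTop (𝓝 0) ∧
      Tendsto (deriv F) atTop (𝓝 0) := by
  obtain ⟨F, F₁, w, hFf, hF⟩ := exists_isMax_of_mem_domain hf
  obtain ⟨h1, h2⟩ := hF.isStrong.tendsto_atTop hF.memLp hF.memLp_image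
  refine ⟨F, hFf, hF.contDiffOn, h1, h2.congr' ?_⟩
  filter_upwards [eventually_gt_atTop 0] with x hx
  exact (hF.deriv_eq hx).symm

theorem behavior_Lmin_zero (β : ℂ) {f : L2Pos} (hf : f ∈ (Lmin β 0).domain) :
    ∃ F : ℝ → ℂ, Represents F f ∧ ContDiffOn ℝ 1 F (Ioi 0) ∧
      F =o[𝓝[>] 0] (fun x : ℝ => x ^ (3 / 2 : ℝ) * |Real.log x|) ∧
      deriv F =o[𝓝[>] 0] (fun x : ℝ => x ^ (1 / 2 : ℝ) * |Real.log x|) := by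
  obtain ⟨c, C, u, u₁, v, v₁, hC, hp, hb⟩ := exists_pair_zero β
  exact hp.behavior_Lmin hb le_rfl (hb.memLp_right_log hp hC) (hb.isBigO_l2norm_right_log hp hC) hf

theorem behavior_Lmin_of_ne (β : ℂ) {m : ℂ} (hm0 : m ≠ 0) (hm : |m.re| ≠ 1) {f : L2Pos}
    (hf : f ∈ (Lmin β (m ^ 2)).domain) :
    ∃ F : ℝ → ℂ, Represents F f ∧ ContDiffOn ℝ 1 F (Ioi 0) ∧
      F =o[𝓝[>] 0] (fun x : ℝ => x ^ (3 / 2 : ℝ)) ∧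
      deriv F =o[𝓝[>] 0] (fun x : ℝ => x ^ (1 / 2 : ℝ)) := by
  obtain ⟨n, hn, hre⟩ := exists_sq_eq_re_eq_abs m
  have hn0 : n ≠ 0 := by
    rintro rfl
    exact hm0 (by simpa using hn.symm)
  have hn' : 0 ≤ n.re := hre ▸ abs_nonneg _
  obtain ⟨c, C, u, u₁, v, v₁, -, hp, hb⟩ := exists_pair_of_re_nonneg β hn' hn0
  rw [← hre] at hm
  rw [← hn] at hf
  rcases hm.lt_or_gt with h | h
  · simpa only [mul_one] using hp.behavior_Lmin hb hn' (hb.memLp_right hp h)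
      (hb.isBigO_l2norm_right hp h) hf
  · simpa only [mul_one] using (hp.limitPoint_of_one_lt hb h).2 f (Lmin_domain_le β _ hf)

lemma exists_pair_of_abs_re_eq_one (β : ℂ) {m : ℂ} (hm : |m.re| = 1) :
    ∃ c C u u₁ v v₁, SolutionPair β (m ^ 2) c u u₁ v v₁ ∧
      PairBounds c 1 C (fun _ => 1) u u₁ v v₁ := by
  obtain ⟨n, hn, hre⟩ := exists_sq_eq_re_eq_abs m
  rw [hm] at hre
  obtain ⟨c, C, u, u₁, v, v₁, -, hp, hb⟩ := exists_pair_of_re_pos β (hre ▸ one_pos)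
  rw [hn] at hp
  rw [hre] at hb
  exact ⟨c, C, u, u₁, v, v₁, hp, hb⟩

theorem behavior_Lmin_borderline (β : ℂ) {m : ℂ} (hm : |m.re| = 1) {f : L2Pos}
    (hf : f ∈ (Lmin β (m ^ 2)).domain) :
    ∃ F : ℝ → ℂ, Represents F f ∧ ContDiffOn ℝ 1 F (Ioi 0) ∧
      F =o[𝓝[>] 0] (fun x : ℝ => x ^ (3 / 2 : ℝ) * |Real.log x| ^ (1 / 2 : ℝ)) ∧
      deriv F =o[𝓝[>] 0] (fun x : ℝ => x ^ (1 / 2 : ℝ) * |Real.log x| ^ (1 / 2 : ℝ)) := by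
  obtain ⟨c, C, u, u₁, v, v₁, hp, hb⟩ := exists_pair_of_abs_re_eq_one β hm
  exact (hp.limitPoint_of_eq_one hb).2 f (Lmin_domain_le β _ hf)

theorem domain_eq_of_one_le (β : ℂ) {m : ℂ} (hm : 1 ≤ |m.re|) :
    (Lmin β (m ^ 2)).domain = (Lmax β (m ^ 2)).domain := by
  rcases hm.eq_or_lt with h | h
  · obtain ⟨c, C, u, u₁, v, v₁, hp, hb⟩ := exists_pair_of_abs_re_eq_one β h.symm
    exact (hp.limitPoint_of_eq_one hb).1
  · obtain ⟨n, hn, hre⟩ := exists_sq_eq_re_eq_abs m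
    obtain ⟨c, C, u, u₁, v, v₁, -, hp, hb⟩ :=
      exists_pair_of_re_pos β (hre ▸ one_pos.trans h : 0 < n.re)
    rw [← hn]
    exact (hp.limitPoint_of_one_lt hb (hre ▸ h)).1

end Whittaker

theorem mainTheorem10 (β : ℂ) :
    -- regularity on the half-line and decay at infinity
    (∀ α : ℂ, ∀ f ∈ (Whittaker.Lmax β α).domain, ∃ F : ℝ → ℂ, Whittaker.Represents F f ∧
      ContDiffOn ℝ 1 F (Ioi 0) ∧ Tendsto F atTop (𝓝 0) ∧ Tendsto (deriv F) atTop (𝓝 0)) ∧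
    -- behavior at zero on the minimal domain, `α = 0`
    (∀ f ∈ (Whittaker.Lmin β 0).domain, ∃ F : ℝ → ℂ, Whittaker.Represents F f ∧
      ContDiffOn ℝ 1 F (Ioi 0) ∧
      F =o[𝓝[>] 0] (fun x : ℝ => x ^ (3 / 2 : ℝ) * |Real.log x|) ∧
      deriv F =o[𝓝[>] 0] (fun x : ℝ => x ^ (1 / 2 : ℝ) * |Real.log x|)) ∧
    -- behavior at zero on the minimal domain, `α = m² ≠ 0` and `|Re m| ≠ 1`
    (∀ m : ℂ, m ≠ 0 → |m.re| ≠ 1 → ∀ f ∈ (Whittaker.Lmin β (m ^ 2)).domain,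
      ∃ F : ℝ → ℂ, Whittaker.Represents F f ∧ ContDiffOn ℝ 1 F (Ioi 0) ∧
      F =o[𝓝[>] 0] (fun x : ℝ => x ^ (3 / 2 : ℝ)) ∧
      deriv F =o[𝓝[>] 0] (fun x : ℝ => x ^ (1 / 2 : ℝ))) ∧
    -- behavior at zero on the minimal domain, borderline `|Re m| = 1`
    (∀ m : ℂ, |m.re| = 1 → ∀ f ∈ (Whittaker.Lmin β (m ^ 2)).domain,
      ∃ F : ℝ → ℂ, Whittaker.Represents F f ∧ ContDiffOn ℝ 1 F (Ioi 0) ∧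
      F =o[𝓝[>] 0] (fun x : ℝ => x ^ (3 / 2 : ℝ) * |Real.log x| ^ (1 / 2 : ℝ)) ∧
      deriv F =o[𝓝[>] 0] (fun x : ℝ => x ^ (1 / 2 : ℝ) * |Real.log x| ^ (1 / 2 : ℝ))) ∧
    -- the maximal domain around zero, `|Re m| < 1`
    (∀ m : ℂ, |m.re| < 1 →
      (∀ f ∈ (Whittaker.Lmax β (m ^ 2)).domain, ∃ a b : ℂ,
        Whittaker.InDomainAroundZero (Whittaker.Lmin β (m ^ 2))
          (fun x => f x - a * Whittaker.zeroJ β m x - b * Whittaker.zeroY β m x)) ∧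
      (∀ a b : ℂ, Whittaker.InDomainAroundZero (Whittaker.Lmax β (m ^ 2))
          (fun x => a * Whittaker.zeroJ β m x + b * Whittaker.zeroY β m x))) ∧
    -- equality of the domains, `|Re m| ≥ 1`
    (∀ m : ℂ, 1 ≤ |m.re| →
      (Whittaker.Lmin β (m ^ 2)).domain = (Whittaker.Lmax β (m ^ 2)).domain) ∧
    -- codimension two, `|Re m| < 1`
    (∀ m : ℂ, |m.re| < 1 →
      (Whittaker.Lmin β (m ^ 2)).domain ≤ (Whittaker.Lmax β (m ^ 2)).domain ∧
      Module.finrank ℂ ((Whittaker.Lmax β (m ^ 2)).domain ⧸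
        (Whittaker.Lmin β (m ^ 2)).domain.submoduleOf (Whittaker.Lmax β (m ^ 2)).domain) = 2) := by
  refine ⟨fun α f hf => Whittaker.regularity_and_decay β α hf,
    fun f hf => Whittaker.behavior_Lmin_zero β hf,
    fun m hm0 hm f hf => Whittaker.behavior_Lmin_of_ne β hm0 hm hf,
    fun m hm f hf => Whittaker.behavior_Lmin_borderline β hm hf, fun m hm => ⟨fun f hf => ?_,
    fun a b => ?_⟩, fun m hm => Whittaker.domain_eq_of_one_le β hm,
    fun m hm => ⟨Whittaker.Lmin_domain_le β _, ?_⟩⟩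
  · obtain ⟨c, κ, J₁, Y₁, -, hp, hJ, hY⟩ := Whittaker.exists_memLp_pair_zeroJ_zeroY β hm
    obtain ⟨a, b, h⟩ := hp.inDomainAroundZero_Lmin hJ hY hf
    exact ⟨a, b * κ⁻¹, by simpa only [mul_assoc] using h⟩
  · obtain ⟨c, κ, J₁, Y₁, hκ, hp, hJ, hY⟩ := Whittaker.exists_memLp_pair_zeroJ_zeroY β hm
    have h := hp.inDomainAroundZero_Lmax hJ hY a (b * κ)
    simpa only [mul_assoc, mul_inv_cancel_left₀ hκ] using h
  · obtain ⟨c, u, u₁, v, v₁, hp, hu, hv⟩ := Whittaker.exists_memLp_pair β hm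
    exact hp.finrank_quotient hu hv
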